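/- Let $K$ be a non-Archimedean local field with ring of integers $\mathcal O_K$, uniformizer $\pi$ and residue field $\mathbb F_q$. Let $n,h,k\ge 1$ be integers, let $L/K$ be the unramified extension of degree $n$, with ring of integers $\mathcal O_L$ and Frobenius $\varphi\in\mathrm{Gal}(L/K)$, and write $m^+=\max(m,0)$. Let $$\mathcal R=\mathcal O_L\langle\tau\rangle/(\tau^n-\pi^k,\ \pi^h,\ \pi^{(h-k)^+}\tau,\ \dots,\ \pi^{(h-k)^+}\tau^{n-1}),\qquad \tau a=\varphi(a)\tau\quad(a\in\mathcal O_L).$$ Its elements are $\sum_{i=0}^{n-1}A_i\tau^i$ with $A_0\in\mathcal O_L/\pi^h$ and $A_i\in\mathcal O_L/\pi^{(h-k)^+}$ for $i>0$. (The ring $\mathcal O_L$ is $\mathbb W(\mathbb F_{q^n})$, the ring of $\mathcal O_K$-Witt vectors if $\mathrm{char}\,K=0$, and $\mathbb F_{q^n}[[\pi]]$ if $\mathrm{char}\,K>0$.) Write $A_{ij}\in\mathbb F_{q^n}$ for the $j$-th coordinate of $A_i$, so that $A_{i0}=\dots=A_{ij}=0$ if and only if $\pi^{j+1}\mid A_i$.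 Define the finite groups $$U=U_{h,k}^{n,q}(\mathbb F_{q^n})=\{\textstyle\sum A_i\tau^i\in\mathcal R^\times: A_0\equiv 1 \bmod \pi\},\qquad H=\{A_0\in U\}\cong U_L^1/U_L^h,$$ where $U_L^r=1+\pi^r\mathcal O_L$, and the subgroups of $U$ $$H'=\{\textstyle\sum A_i\tau^i\in U: A_{ij}=0\text{ if } i>0,\ j\le \tfrac{h-k}2-\tfrac in\},$$ $$H^+=\{\textstyle\sum A_i\tau^i\in U: A_{ij}=0\text{ if } i>0,\ j< \tfrac{h-k}2-\tfrac in,\ \text{ and } A_{n/2,(h-k-1)/2}\in\mathbb F_{q^{n/2}}\},$$ the last condition being imposed only if $n$ is even, $h>k$ and $h-k$ is odd. All characters and representations have coefficients in an algebraically closed field of characteristic $0$ (for example $\overline{\mathbb Q}_\ell$). Let $Z$ be the center of $U$, on which $\mathrm{Gal}(L/K)$ acts by $A_0\mapsto\sigma(A_0)$. Let $C=U_L^{h-1}/U_L^h\subset Z\cap H$ (for $h=1$ let $C$ be trivial); or, if $k=1$ or $h\le k$, let $C$ be either this group or the whole center $Z$. Let $\mathcal A$ be the set of characters $\chi$ of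 $H$ such that $\chi|_C$ has trivial stabilizer in $\mathrm{Gal}(L/K)$, and let $\mathcal G$ be the set of isomorphism classes of irreducible representations of $U$ whose central character, restricted to $C$, has trivial stabilizer in $\mathrm{Gal}(L/K)$. For $\chi\in\mathcal A$ put $\chi^\sharp(\sum A_i\tau^i)=\chi(A_0)$ on $H'$. Then for every $\chi\in\mathcal A$ the function $\chi^\sharp$ extends to a character of $H^+$, and for every extension $\widetilde\chi$ of $\chi^\sharp$ to a character of $H^+$ the representation $\rho_\chi=\mathrm{Ind}_{H^+}^{U}(\widetilde\chi)$ is irreducible, of dimension $q^{n(n-1)(h-k)^+/2}$, and belongs to $\mathcal G$. Moreover $\mathcal G=\{\rho_\chi:\chi\in\mathcal A\}$, whichever extension $\widetilde\chi$ is chosen for each $\chi\in\mathcal A$. -/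

import Mathlib

set_option linter.unusedSectionVars false

open ValuativeRel

/-- Coefficient data: a commutative ring `O` with an automorphism `φ` such that `φ ^ n = 1`
and an element `π` fixed by `φ`. -/
structure CyclicData (O : Type*) [CommRing O] (n : ℕ) where
  φ : RingAut O
  π : O
  φ_pow : φ ^ n = 1
  φ_π : φ π = π

/-- The elements `A_0 + A_1 τ + ⋯ + A_{n-1} τ^{n-1}` of the ring `O⟨τ⟩ / (τ ^ n - π ^ k)`,
where `τ a = φ(a) τ`; `coeff i` is `A_i`. -/
@[ext]
structure TwistedOrder {O : Type*} [CommRing O] {n : ℕ} (D : CyclicData O n) (k : ℕ) where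
  coeff : Fin n → O

namespace TwistedOrder

variable {O : Type*} [CommRing O] {n : ℕ} {D : CyclicData O n} {k : ℕ}

lemma phi_pow_pi (D : CyclicData O n) (i : ℕ) : (D.φ ^ i) D.π = D.π := by
  induction i with
  | zero => simp
  | succ i ih => rw [pow_succ, RingAut.mul_apply, D.φ_π, ih]

lemma phi_pow_mod (D : CyclicData O n) (i : ℕ) : D.φ ^ (i % n) = D.φ ^ i := by
  conv_rhs => rw [← Nat.mod_add_div i n, pow_add, pow_mul, D.φ_pow, one_pow, mul_one]

instance : Zero (TwistedOrder D k) := ⟨⟨0⟩⟩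
instance : Add (TwistedOrder D k) := ⟨fun a b => ⟨a.coeff + b.coeff⟩⟩
instance : Neg (TwistedOrder D k) := ⟨fun a => ⟨-a.coeff⟩⟩
instance : Sub (TwistedOrder D k) := ⟨fun a b => ⟨a.coeff - b.coeff⟩⟩
instance : SMul ℕ (TwistedOrder D k) := ⟨fun m a => ⟨m • a.coeff⟩⟩
instance : SMul ℤ (TwistedOrder D k) := ⟨fun m a => ⟨m • a.coeff⟩⟩

lemma coeff_injective :
    Function.Injective (coeff : TwistedOrder D k → Fin n → O) := fun _ _ h => TwistedOrder.ext h

instance : AddCommGroup (TwistedOrder D k) :=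
  coeff_injective.addCommGroup _ rfl (fun _ _ => rfl) (fun _ => rfl) (fun _ _ => rfl)
    (fun _ _ => rfl) (fun _ _ => rfl)

@[simp] lemma coeff_zero (i : Fin n) : (0 : TwistedOrder D k).coeff i = 0 := rfl
@[simp] lemma coeff_add (a b : TwistedOrder D k) (i : Fin n) :
    (a + b).coeff i = a.coeff i + b.coeff i := rfl
@[simp] lemma coeff_neg (a : TwistedOrder D k) (i : Fin n) : (-a).coeff i = -a.coeff i := rfl
@[simp] lemma coeff_sub (a b : TwistedOrder D k) (i : Fin n) :
    (a - b).coeff i = a.coeff i - b.coeff i := rfl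

variable [NeZero n]

/-- The constant `x = x + 0 τ + ⋯ + 0 τ^{n-1}`. -/
def const (D : CyclicData O n) (k : ℕ) (x : O) : TwistedOrder D k := ⟨Pi.single 0 x⟩

instance : One (TwistedOrder D k) := ⟨const D k 1⟩

/-- The exponent of `π` in `τ^p τ^r = π^(carry k p r) τ^((p + r) mod n)`. -/
def carry (k : ℕ) (p r : Fin n) : ℕ := k * (((p : ℕ) + (r : ℕ)) / n)

/-- Multiplication, from `(a τ^p) (b τ^r) = a φ^p(b) τ^(p+r)` and `τ^n = π^k`: the coefficient
of `τ^l` collects the pairs `(p, r)` with `r ≡ l - p` modulo `n` (subtraction in `Fin n` is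
modulo `n`). -/
instance : Mul (TwistedOrder D k) := ⟨fun a b => ⟨fun l => ∑ p : Fin n,
  a.coeff p * (D.φ ^ (p : ℕ)) (b.coeff (l - p)) * D.π ^ carry k p (l - p)⟩⟩

lemma coeff_one (i : Fin n) : (1 : TwistedOrder D k).coeff i = if i = 0 then 1 else 0 := by
  change (Pi.single 0 1 : Fin n → O) i = _
  simp [Pi.single_apply]

lemma coeff_mul (a b : TwistedOrder D k) (l : Fin n) :
    (a * b).coeff l = ∑ p : Fin n,
      a.coeff p * (D.φ ^ (p : ℕ)) (b.coeff (l - p)) * D.π ^ carry k p (l - p) := rfl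

lemma carry_zero_left (p : Fin n) : carry k 0 p = 0 := by
  simp [carry, Nat.div_eq_of_lt p.2]

lemma carry_zero_right (p : Fin n) : carry k p 0 = 0 := by
  simp [carry, Nat.div_eq_of_lt p.2]

lemma carry_assoc (p r m : Fin n) :
    carry k p r + carry k (p + r) m = carry k r m + carry k p (r + m) := by
  have hn : 0 < n := Nat.pos_of_ne_zero (NeZero.ne n)
  have key : ∀ x y : ℕ, x / n + (x % n + y) / n = (x + y) / n := by
    intro x y
    conv_rhs => rw [← Nat.mod_add_div x n]
    rw [show x % n + n * (x / n) + y = x % n + y + n * (x / n) by ring,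
      Nat.add_mul_div_left _ _ hn, add_comm]
  simp only [carry, ← mul_add, Fin.val_add]
  rw [key, add_comm (p : ℕ) (((r : ℕ) + m) % n), key, add_comm ((r : ℕ) + m) p, add_assoc]

lemma phi_pow_add (D : CyclicData O n) (p r : Fin n) (x : O) :
    (D.φ ^ ((p + r : Fin n) : ℕ)) x = (D.φ ^ (p : ℕ)) ((D.φ ^ (r : ℕ)) x) := by
  rw [Fin.val_add, phi_pow_mod, pow_add, RingAut.mul_apply]

instance : Ring (TwistedOrder D k) where
  mul_assoc a b c := by
    ext l
    simp only [coeff_mul, Finset.sum_mul, map_sum, Finset.mul_sum]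
    rw [Finset.sum_comm]
    refine Finset.sum_congr rfl fun p _ => ?_
    refine Fintype.sum_equiv (Equiv.subRight p) _ _ fun s => ?_
    obtain ⟨r, rfl⟩ : ∃ r, s = p + r := ⟨s - p, by abel⟩
    have e1 : p + r - p = r := by abel
    have e2 : l - (p + r) = l - p - r := by abel
    obtain ⟨m, rfl⟩ : ∃ m, l = p + r + m := ⟨l - p - r, by abel⟩
    have e3 : p + r + m - (p + r) = m := by abel
    have e4 : p + r + m - p = r + m := by abel
    have e5 : r + m - r = m := by abel
    simp only [Equiv.subRight_apply, e1, e3, e4, e5, map_mul, map_pow, phi_pow_pi, phi_pow_add]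
    have := carry_assoc (k := k) p r m
    calc _ = a.coeff p * (D.φ ^ (p : ℕ)) (b.coeff r) *
          (D.φ ^ (p : ℕ)) ((D.φ ^ (r : ℕ)) (c.coeff m)) *
          D.π ^ (carry k p r + carry k (p + r) m) := by rw [pow_add]; ring
      _ = _ := by rw [this, pow_add]; ring
  one_mul a := by
    ext l
    rw [coeff_mul, Finset.sum_eq_single 0]
    · simp [coeff_one, carry_zero_left]
    · intro p _ hp
      simp [coeff_one, hp]
    · simp
  mul_one a := by
    ext l
    rw [coeff_mul, Finset.sum_eq_single l]
    · simp [coeff_one, carry_zero_right]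
    · intro p _ hp
      simp [coeff_one, sub_eq_zero, Ne.symm hp]
    · simp
  left_distrib a b c := by
    ext l
    simp only [coeff_mul, coeff_add, map_add, ← Finset.sum_add_distrib]
    exact Finset.sum_congr rfl fun p _ => by ring
  right_distrib a b c := by
    ext l
    simp only [coeff_mul, coeff_add, ← Finset.sum_add_distrib]
    exact Finset.sum_congr rfl fun p _ => by ring
  zero_mul a := by
    ext l
    simp [coeff_mul]
  mul_zero a := by
    ext l
    simp [coeff_mul]
  zsmul := fun m a => m • a
  zsmul_zero' := fun a => zero_zsmul a
  zsmul_succ' := fun m a => SubNegMonoid.zsmul_succ' m a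
  zsmul_neg' := fun m a => SubNegMonoid.zsmul_neg' m a
  nsmul := fun m a => m • a
  nsmul_zero := fun a => zero_nsmul a
  nsmul_succ := fun m a => AddMonoid.nsmul_succ m a
  neg_add_cancel := neg_add_cancel
  sub_eq_add_neg := sub_eq_add_neg

lemma carry_eq (p r : Fin n) : ∃ c : ℕ, carry k p r = k * c ∧
    (p : ℕ) + r = ((p + r : Fin n) : ℕ) + n * c :=
  ⟨((p : ℕ) + r) / n, rfl, by rw [Fin.val_add, Nat.mod_add_div]⟩

lemma trunc_le (h : ℕ) {s : Fin n} (p r : Fin n) (hs : p = s ∨ r = s) :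
    (if p + r = 0 then h else h - k) ≤ (if s = 0 then h else h - k) + carry k p r := by
  by_cases hs0 : s = 0
  · rw [if_pos hs0]; split_ifs <;> omega
  · rw [if_neg hs0]
    split_ifs with hpr
    · obtain ⟨c, hc, hc'⟩ := carry_eq (k := k) p r
      rw [hpr] at hc'
      have hsv : (s : ℕ) ≠ 0 := fun h0 => hs0 (Fin.ext h0)
      have hc0 : c ≠ 0 := by
        rintro rfl
        rcases hs with rfl | rfl <;> simp at hc' <;> omega
      have : k * 1 ≤ k * c := Nat.mul_le_mul_left k (Nat.one_le_iff_ne_zero.mpr hc0)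
      omega
    · omega

/-- The two-sided ideal `(π^h, π^(h-k) τ, …, π^(h-k) τ^(n-1))`; here `h - k` is truncated
subtraction, that is `(h - k)^+`. -/
def truncIdeal (D : CyclicData O n) (k h : ℕ) : Ideal (TwistedOrder D k) where
  carrier := {a | ∀ i, D.π ^ (if i = 0 then h else h - k) ∣ a.coeff i}
  zero_mem' := fun i => by simp
  add_mem' := fun ha hb i => dvd_add (ha i) (hb i)
  smul_mem' := fun c a ha l => by
    rw [smul_eq_mul, coeff_mul]
    refine Finset.dvd_sum fun p _ => ?_
    obtain ⟨r, rfl⟩ : ∃ r, l = p + r := ⟨l - p, by abel⟩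
    rw [show p + r - p = r by abel, mul_assoc]
    refine Dvd.dvd.mul_left ?_ _
    have h1 := map_dvd (D.φ ^ (p : ℕ)) (ha r)
    rw [map_pow, phi_pow_pi] at h1
    refine (pow_dvd_pow _ ?_).trans ((pow_add D.π _ _).symm ▸ mul_dvd_mul_right h1 _)
    exact trunc_le h p r (Or.inr rfl)

instance (D : CyclicData O n) (k h : ℕ) : (truncIdeal D k h).IsTwoSided where
  mul_mem_of_left := fun {a} b ha l => by
    rw [coeff_mul]
    refine Finset.dvd_sum fun p _ => ?_
    obtain ⟨r, rfl⟩ : ∃ r, l = p + r := ⟨l - p, by abel⟩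
    rw [show p + r - p = r by abel, mul_right_comm]
    refine Dvd.dvd.mul_right ?_ _
    refine (pow_dvd_pow _ ?_).trans ((pow_add D.π _ _).symm ▸ mul_dvd_mul_right (ha p) _)
    exact trunc_le h p r (Or.inl rfl)

/-- The ring `O⟨τ⟩ / (τ^n - π^k, π^h, π^(h-k) τ, …, π^(h-k) τ^(n-1))`. -/
abbrev TruncRing (D : CyclicData O n) (k h : ℕ) : Type _ := TwistedOrder D k ⧸ truncIdeal D k h

/-- The class of `A_0 + A_1 τ + ⋯ + A_{n-1} τ^{n-1}` in the truncated ring. -/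
abbrev cls (h : ℕ) (a : TwistedOrder D k) : TruncRing D k h := Ideal.Quotient.mk _ a

lemma dvd_term {a b : TwistedOrder D k} {p r : Fin n} {e f : ℕ} (ha : D.π ^ e ∣ a.coeff p)
    (hb : D.π ^ f ∣ b.coeff r) : D.π ^ (e + f + carry k p r) ∣
      a.coeff p * (D.φ ^ (p : ℕ)) (b.coeff r) * D.π ^ carry k p r := by
  have h1 := map_dvd (D.φ ^ (p : ℕ)) hb
  rw [map_pow, phi_pow_pi] at h1
  rw [pow_add, pow_add]
  exact mul_dvd_mul_right (mul_dvd_mul ha h1) _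

lemma dvd_coeff_mul {a b : TwistedOrder D k} {l : Fin n} {g : ℕ}
    (H : ∀ p r : Fin n, p + r = l → ∃ e f, D.π ^ e ∣ a.coeff p ∧ D.π ^ f ∣ b.coeff r ∧
      g ≤ e + f + carry k p r) : D.π ^ g ∣ (a * b).coeff l := by
  rw [coeff_mul]
  refine Finset.dvd_sum fun p _ => ?_
  obtain ⟨e, f, he, hf, hg⟩ := H p (l - p) (by abel)
  exact (pow_dvd_pow _ hg).trans (dvd_term he hf)

lemma exists_level {x y : O} {Q : ℕ → Prop} (hQ : ∀ j, Q j → y ^ (j + 1) ∣ x)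
    (hex : ∃ j, ¬ Q j) : ∃ e, y ^ e ∣ x ∧ ¬ Q e := by
  classical
  refine ⟨Nat.find hex, ?_, Nat.find_spec hex⟩
  rcases hm : Nat.find hex with _ | m
  · simp
  · exact hQ m (not_not.mp (Nat.find_min hex (by omega)))

lemma lt_level_iff (h k j i : ℕ) : (j : ℚ) < ((h : ℚ) - k) / 2 - (i : ℚ) / n ↔
    2 * n * j + 2 * i + n * k < n * h := by
  have hn : (0 : ℚ) < n := by exact_mod_cast Nat.pos_of_ne_zero (NeZero.ne n)
  rw [← @Nat.cast_lt ℚ, ← mul_lt_mul_iff_right₀ (show (0 : ℚ) < 2 * n by positivity)]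
  have : 2 * (n : ℚ) * (((h : ℚ) - k) / 2 - (i : ℚ) / n) = n * h - n * k - 2 * i := by
    field_simp
  rw [this]
  push_cast
  constructor <;> intro H <;> linarith

lemma le_level_iff (h k j i : ℕ) : (j : ℚ) ≤ ((h : ℚ) - k) / 2 - (i : ℚ) / n ↔
    2 * n * j + 2 * i + n * k ≤ n * h := by
  have hn : (0 : ℚ) < n := by exact_mod_cast Nat.pos_of_ne_zero (NeZero.ne n)
  rw [← @Nat.cast_le ℚ, ← mul_le_mul_iff_right₀ (show (0 : ℚ) < 2 * n by positivity)]
  have : 2 * (n : ℚ) * (((h : ℚ) - k) / 2 - (i : ℚ) / n) = n * h - n * k - 2 * i := by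
    field_simp
  rw [this]
  push_cast
  constructor <;> intro H <;> linarith

lemma carry_pos [NeZero k] {p r : Fin n} (hp : p ≠ 0) (hpr : p + r = 0) : 1 ≤ carry k p r := by
  obtain ⟨c, hc, hc'⟩ := carry_eq (k := k) p r
  rw [hpr] at hc'
  have hpv : (p : ℕ) ≠ 0 := fun h0 => hp (Fin.ext h0)
  have hc0 : c ≠ 0 := by
    rintro rfl
    simp at hc'
    omega
  rw [hc]
  exact Nat.one_le_iff_ne_zero.mpr (mul_ne_zero (NeZero.ne k) hc0)

lemma pi_dvd_mul_zero [NeZero k] {a b : TwistedOrder D k} (ha : D.π ∣ a.coeff 0) :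
    D.π ∣ (a * b).coeff 0 := by
  rw [← pow_one D.π]
  refine dvd_coeff_mul fun p r hpr => ?_
  by_cases hp : p = 0
  · subst hp
    exact ⟨1, 0, by simpa using ha, by simp, by omega⟩
  · exact ⟨0, 0, by simp, by simp, by have := carry_pos (k := k) hp hpr; omega⟩

/-- The elements `∑ A_i τ^i` with `π ∣ A_0`. -/
def jUnip (D : CyclicData O n) (k : ℕ) [NeZero k] : NonUnitalSubring (TwistedOrder D k) where
  carrier := {a | D.π ∣ a.coeff 0}
  zero_mem' := dvd_zero _
  add_mem' := fun ha hb => dvd_add ha hb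
  neg_mem' := fun ha => (dvd_neg (α := O)).mpr ha
  mul_mem' := fun ha _ => pi_dvd_mul_zero ha

/-- The elements `A_0` with `π^m ∣ A_0` and `π ∣ A_0`. -/
def jConst (D : CyclicData O n) (k m : ℕ) [NeZero k] : NonUnitalSubring (TwistedOrder D k) where
  carrier := {a | D.π ∣ a.coeff 0 ∧ D.π ^ m ∣ a.coeff 0 ∧ ∀ i, i ≠ 0 → a.coeff i = 0}
  zero_mem' := ⟨dvd_zero _, dvd_zero _, fun _ _ => rfl⟩
  add_mem' := fun ha hb => ⟨dvd_add ha.1 hb.1, dvd_add ha.2.1 hb.2.1,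
    fun i hi => by simp [ha.2.2 i hi, hb.2.2 i hi]⟩
  neg_mem' := fun ha => ⟨(dvd_neg (α := O)).mpr ha.1, (dvd_neg (α := O)).mpr ha.2.1,
    fun i hi => by simp [ha.2.2 i hi]⟩
  mul_mem' := by
    rintro a b ⟨ha, ha', ha''⟩ ⟨hb, hb', hb''⟩
    have key : ∀ l, (a * b).coeff l = a.coeff 0 * b.coeff l := by
      intro l
      rw [coeff_mul, Finset.sum_eq_single 0]
      · simp [carry_zero_left]
      · intro p _ hp
        simp [ha'' p hp]
      · simp
    exact ⟨key 0 ▸ ha.mul_right _, key 0 ▸ ha'.mul_right _,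
      fun i hi => by rw [key, hb'' i hi, mul_zero]⟩

/-- The elements `∑ A_i τ^i` with `π ∣ A_0`, whose `j`-th coordinate `A_{ij}` vanishes if `i > 0`
and `j ≤ (h-k)/2 - i/n`. The vanishing of `A_{i0}, …, A_{ij}` means `π^(j+1) ∣ A_i`. -/
def jPrime (D : CyclicData O n) (k h : ℕ) [NeZero k] : NonUnitalSubring (TwistedOrder D k) where
  carrier := {a | D.π ∣ a.coeff 0 ∧ ∀ (i : Fin n) (j : ℕ), i ≠ 0 →
    (j : ℚ) ≤ ((h : ℚ) - k) / 2 - ((i : ℕ) : ℚ) / n → D.π ^ (j + 1) ∣ a.coeff i}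
  zero_mem' := ⟨dvd_zero _, fun _ _ _ _ => dvd_zero _⟩
  add_mem' := fun ha hb => ⟨dvd_add ha.1 hb.1,
    fun i j hi hj => dvd_add (ha.2 i j hi hj) (hb.2 i j hi hj)⟩
  neg_mem' := fun ha => ⟨(dvd_neg (α := O)).mpr ha.1,
    fun i j hi hj => (dvd_neg (α := O)).mpr (ha.2 i j hi hj)⟩
  mul_mem' := by
    rintro a b ⟨ha, ha'⟩ ⟨hb, hb'⟩
    refine ⟨pi_dvd_mul_zero ha, fun l j hl hj => dvd_coeff_mul fun p r hpr => ?_⟩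
    have hn : 0 < n := Nat.pos_of_ne_zero (NeZero.ne n)
    by_cases hp : p = 0
    · subst hp
      rw [zero_add] at hpr
      subst hpr
      exact ⟨0, j + 1, by simp, hb' _ _ hl hj, by omega⟩
    by_cases hr : r = 0
    · subst hr
      rw [add_zero] at hpr
      subst hpr
      exact ⟨j + 1, 0, ha' _ _ hl hj, by simp, by omega⟩
    obtain ⟨e, he, he'⟩ := exists_level (fun j hj => ha' p j hp hj) ⟨h, by
      rw [le_level_iff, not_le]; nlinarith [Nat.pos_of_ne_zero (NeZero.ne k)]⟩
    obtain ⟨f, hf, hf'⟩ := exists_level (fun j hj => hb' r j hr hj) ⟨h, by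
      rw [le_level_iff, not_le]; nlinarith [Nat.pos_of_ne_zero (NeZero.ne k)]⟩
    refine ⟨e, f, he, hf, ?_⟩
    obtain ⟨c, hc, hc'⟩ := carry_eq (k := k) p r
    rw [hpr] at hc'
    rw [le_level_iff] at hj he' hf'
    rw [hc]
    by_contra hcon
    have hck : c ≤ k * c := Nat.le_mul_of_pos_left _ (Nat.pos_of_ne_zero (NeZero.ne k))
    have h1 : n * (e + f + c) ≤ n * j := Nat.mul_le_mul_left n (by omega)
    nlinarith

/-- The elements `∑ A_i τ^i` with `π ∣ A_0`, whose `j`-th coordinate `A_{ij}` vanishes if `i > 0`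
and `j < (h-k)/2 - i/n`, and such that `A_{n/2, (h-k-1)/2}` lies in the fixed field of
`φ^(n/2)` (no condition if `n` is odd, `h - k` is even or `h ≤ k`). -/
def jPlus (D : CyclicData O n) (k h : ℕ) [NeZero k] : NonUnitalSubring (TwistedOrder D k) where
  carrier := {a | D.π ∣ a.coeff 0 ∧ (∀ (i : Fin n) (j : ℕ), i ≠ 0 →
    (j : ℚ) < ((h : ℚ) - k) / 2 - ((i : ℕ) : ℚ) / n → D.π ^ (j + 1) ∣ a.coeff i) ∧
    ∀ (i : Fin n) (j : ℕ), 2 * (i : ℕ) = n → 2 * j + 1 + k = h →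
      ∃ b, a.coeff i = D.π ^ j * b ∧ D.π ∣ (D.φ ^ (n / 2)) b - b}
  zero_mem' := ⟨dvd_zero _, fun _ _ _ _ => dvd_zero _, fun _ _ _ _ => ⟨0, by simp, by simp⟩⟩
  add_mem' := by
    rintro a b ⟨ha, ha', ha''⟩ ⟨hb, hb', hb''⟩
    refine ⟨dvd_add ha hb, fun i j hi hj => dvd_add (ha' i j hi hj) (hb' i j hi hj),
      fun i j hi hj => ?_⟩
    obtain ⟨x, hx, hx'⟩ := ha'' i j hi hj
    obtain ⟨y, hy, hy'⟩ := hb'' i j hi hj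
    refine ⟨x + y, by rw [coeff_add, hx, hy, mul_add], ?_⟩
    rw [map_add, add_sub_add_comm]
    exact dvd_add hx' hy'
  neg_mem' := by
    rintro a ⟨ha, ha', ha''⟩
    refine ⟨(dvd_neg (α := O)).mpr ha, fun i j hi hj => (dvd_neg (α := O)).mpr (ha' i j hi hj),
      fun i j hi hj => ?_⟩
    obtain ⟨x, hx, hx'⟩ := ha'' i j hi hj
    refine ⟨-x, by rw [coeff_neg, hx, mul_neg], ?_⟩
    rw [map_neg, neg_sub_neg, dvd_sub_comm]
    exact hx'
  mul_mem' := by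
    rintro a b ⟨ha, ha', ha''⟩ ⟨hb, hb', hb''⟩
    have hn : 0 < n := Nat.pos_of_ne_zero (NeZero.ne n)
    have hk : 0 < k := Nat.pos_of_ne_zero (NeZero.ne k)
    refine ⟨pi_dvd_mul_zero ha, fun l j hl hj => dvd_coeff_mul fun p r hpr => ?_,
      fun l j hl hj => ?_⟩
    · by_cases hp : p = 0
      · subst hp
        rw [zero_add] at hpr
        subst hpr
        exact ⟨0, j + 1, by simp, hb' _ _ hl hj, by omega⟩
      by_cases hr : r = 0
      · subst hr
        rw [add_zero] at hpr
        subst hpr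
        exact ⟨j + 1, 0, ha' _ _ hl hj, by simp, by omega⟩
      obtain ⟨e, he, he'⟩ := exists_level (fun j hj => ha' p j hp hj) ⟨h, by
        rw [lt_level_iff, not_lt]; nlinarith⟩
      obtain ⟨f, hf, hf'⟩ := exists_level (fun j hj => hb' r j hr hj) ⟨h, by
        rw [lt_level_iff, not_lt]; nlinarith⟩
      refine ⟨e, f, he, hf, ?_⟩
      obtain ⟨c, hc, hc'⟩ := carry_eq (k := k) p r
      rw [hpr] at hc'
      rw [lt_level_iff] at hj he' hf'
      rw [hc]
      by_contra hcon
      have hck : c ≤ k * c := Nat.le_mul_of_pos_left _ hk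
      have h1 : n * (e + f + c) ≤ n * j := Nat.mul_le_mul_left n (by omega)
      nlinarith
    · have hl0 : l ≠ 0 := by
        rintro rfl
        simp at hl
        omega
      have : D.π ^ (j + 1) ∣ (a * b).coeff l := by
        refine dvd_coeff_mul fun p r hpr => ?_
        by_cases hp : p = 0
        · subst hp
          rw [zero_add] at hpr
          subst hpr
          obtain ⟨y, hy, -⟩ := hb'' r j hl hj
          exact ⟨1, j, by simpa using ha, hy ▸ dvd_mul_right _ _, by omega⟩
        by_cases hr : r = 0
        · subst hr
          rw [add_zero] at hpr
          subst hpr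
          obtain ⟨y, hy, -⟩ := ha'' p j hl hj
          exact ⟨j, 1, hy ▸ dvd_mul_right _ _, by simpa using hb, by omega⟩
        obtain ⟨e, he, he'⟩ := exists_level (fun j hj => ha' p j hp hj) ⟨h, by
          rw [lt_level_iff, not_lt]; nlinarith⟩
        obtain ⟨f, hf, hf'⟩ := exists_level (fun j hj => hb' r j hr hj) ⟨h, by
          rw [lt_level_iff, not_lt]; nlinarith⟩
        refine ⟨e, f, he, hf, ?_⟩
        obtain ⟨c, hc, hc'⟩ := carry_eq (k := k) p r
        rw [hpr] at hc'
        rw [lt_level_iff] at he' hf'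
        rw [hc]
        by_contra hcon
        have hck : c ≤ k * c := Nat.le_mul_of_pos_left _ hk
        have h1 : n * (e + f + c) ≤ n * j := Nat.mul_le_mul_left n (by omega)
        subst hj
        nlinarith
      obtain ⟨y, hy⟩ := this
      refine ⟨D.π * y, by rw [hy, pow_succ]; ring, ?_⟩
      rw [map_mul, phi_pow_pi, ← mul_sub]
      exact dvd_mul_right _ _

lemma weight_pow [NeZero k] {a : TwistedOrder D k} (ha : D.π ∣ a.coeff 0) (m : ℕ) :
    ∀ (i : Fin n) (j : ℕ), (i : ℕ) + n * j < m → D.π ^ (j + 1) ∣ (a ^ m).coeff i := by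
  have hn : 0 < n := Nat.pos_of_ne_zero (NeZero.ne n)
  have hk : 0 < k := Nat.pos_of_ne_zero (NeZero.ne k)
  induction m with
  | zero => intro i j hij; omega
  | succ m ih =>
    intro l j hij
    rw [pow_succ a m]
    refine dvd_coeff_mul (a := a ^ m) (b := a) fun p r hpr => ?_
    have hex : ∃ j : ℕ, ¬ (p : ℕ) + n * j < m := ⟨m, by rw [not_lt]; nlinarith⟩
    obtain ⟨e, he, he'⟩ := exists_level (Q := fun j => (p : ℕ) + n * j < m) (ih p) hex
    obtain ⟨f, hf, hf'⟩ : ∃ f : ℕ, D.π ^ f ∣ a.coeff r ∧ 1 ≤ (r : ℕ) + n * f := by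
      by_cases hr : r = 0
      · subst hr
        exact ⟨1, by simpa using ha, by simp; omega⟩
      · have hrv : (r : ℕ) ≠ 0 := fun h0 => hr (Fin.ext h0)
        exact ⟨0, by simp, by omega⟩
    refine ⟨e, f, he, hf, ?_⟩
    obtain ⟨c, hc, hc'⟩ := carry_eq (k := k) p r
    rw [hpr] at hc'
    rw [hc]
    by_contra hcon
    have hck : c ≤ k * c := Nat.le_mul_of_pos_left _ hk
    have h1 : n * (e + f + c) ≤ n * j := Nat.mul_le_mul_left n (by omega)
    nlinarith

lemma pow_mem_truncIdeal [NeZero k] (h : ℕ) {a : TwistedOrder D k} (ha : D.π ∣ a.coeff 0) :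
    a ^ (n + n * h) ∈ truncIdeal D k h := by
  intro i
  have hn : 0 < n := Nat.pos_of_ne_zero (NeZero.ne n)
  have h1 := weight_pow ha (n + n * h) i h (by have := i.2; omega)
  exact (pow_dvd_pow _ (by split_ifs <;> omega)).trans h1

/-- For a set `J` of nilpotent elements closed under `+`, `-` and `*`: the group of all classes of
elements `1 + x` with `x ∈ J`. -/
def oneAdd [NeZero k] (h : ℕ) (J : NonUnitalSubring (TwistedOrder D k)) (hJ : J ≤ jUnip D k) :
    Subgroup (TruncRing D k h)ˣ where
  carrier := {u | ∃ x ∈ J, (u : TruncRing D k h) = cls h (1 + x)}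
  one_mem' := ⟨0, J.zero_mem, by simp⟩
  mul_mem' := by
    rintro u v ⟨x, hx, hu⟩ ⟨y, hy, hv⟩
    refine ⟨x + y + x * y, J.add_mem (J.add_mem hx hy) (J.mul_mem hx hy), ?_⟩
    rw [Units.val_mul, hu, hv, ← map_mul]
    congr 1
    noncomm_ring
  inv_mem' := by
    rintro u ⟨x, hx, hu⟩
    set N := n + n * h
    have hgeom : ∀ m : ℕ, ∃ y ∈ J, (1 + x) * (1 + y) = 1 - (-x) ^ (m + 1) := by
      intro m
      induction m with
      | zero => exact ⟨0, J.zero_mem, by simp⟩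
      | succ m ih =>
        obtain ⟨y, hy, hxy⟩ := ih
        have hpow : ∀ m : ℕ, (-x) ^ (m + 1) ∈ J := by
          intro m
          induction m with
          | zero => simpa using J.neg_mem hx
          | succ m ih => rw [pow_succ]; exact J.mul_mem ih (J.neg_mem hx)
        refine ⟨y + (-x) ^ (m + 1), J.add_mem hy (hpow m), ?_⟩
        rw [← add_assoc, mul_add, hxy, pow_succ' (-x) (m + 1)]
        noncomm_ring
    obtain ⟨y, hy, hxy⟩ := hgeom N
    refine ⟨y, hy, ?_⟩
    refine Units.inv_eq_of_mul_eq_one_right ?_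
    have hmem : (-x) ^ (N + 1) ∈ truncIdeal D k h := by
      rw [pow_succ]
      exact Ideal.IsTwoSided.mul_mem_of_left _
        (pow_mem_truncIdeal h (hJ (J.neg_mem hx)))
    rw [hu, ← map_mul, hxy, map_sub, Ideal.Quotient.eq_zero_iff_mem.mpr hmem, map_one, sub_zero]

/-- The finite unipotent group `{∑ A_i τ^i : A_0 ≡ 1 mod π}` in the units of the truncated
ring. -/
def unip (D : CyclicData O n) (k h : ℕ) [NeZero k] : Subgroup (TruncRing D k h)ˣ :=
  oneAdd h (jUnip D k) le_rfl

/-- `U_L^1 / U_L^h`, as the subgroup of the classes of `A_0 ≡ 1 mod π`. -/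
def subH (D : CyclicData O n) (k h : ℕ) [NeZero k] : Subgroup (unip D k h) :=
  (oneAdd h (jConst D k 1) fun _ hx => hx.1).subgroupOf _

/-- `U_L^(h-1) / U_L^h`, as the subgroup of the classes of `A_0 ≡ 1 mod π^(h-1)`
(and `A_0 ≡ 1 mod π`, which matters only for `h = 1`, when the group is trivial). -/
def lastLayer (D : CyclicData O n) (k h : ℕ) [NeZero k] : Subgroup (unip D k h) :=
  (oneAdd h (jConst D k (h - 1)) fun _ hx => hx.1).subgroupOf _

/-- The subgroup `H'`. -/
def subHPrime (D : CyclicData O n) (k h : ℕ) [NeZero k] : Subgroup (unip D k h) :=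
  (oneAdd h (jPrime D k h) fun _ hx => hx.1).subgroupOf _

/-- The subgroup `H⁺`. -/
def subHPlus (D : CyclicData O n) (k h : ℕ) [NeZero k] : Subgroup (unip D k h) :=
  (oneAdd h (jPlus D k h) fun _ hx => hx.1).subgroupOf _

/-- The class of `∑ A_i τ^i` in the truncated ring is the element `u` of the group. -/
def Represents {h : ℕ} [NeZero k] (a : TwistedOrder D k) (u : unip D k h) : Prop :=
  cls h a = ((u : (TruncRing D k h)ˣ) : TruncRing D k h)

/-- `χt` is a character of `H⁺` that extends `χ^♯`, where `χ^♯(∑ A_i τ^i) = χ(A_0)` on `H'`. -/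
def ExtendsSharp {h : ℕ} [NeZero k] {F : Type*} [Field F] (χ : subH D k h →* Fˣ)
    (χt : subHPlus D k h →* Fˣ) : Prop :=
  ∀ (u : subHPlus D k h) (v : subH D k h) (a : TwistedOrder D k),
    (u : unip D k h) ∈ subHPrime D k h → Represents a (u : unip D k h) →
    Represents (const D k (a.coeff 0)) (v : unip D k h) → χt u = χ v

end TwistedOrder

/-- The one-dimensional representation on `F` given by a character. -/
def charRep {G F : Type*} [Group G] [Field F] (χ : G →* Fˣ) : Representation F G F :=
  (algebraMap F (Module.End F F)).toMonoidHom.comp ((Units.coeHom F).comp χ)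

/-- `ω` is the central character of `ρ`. -/
def IsCentralCharacter {G F V : Type*} [Group G] [Field F] [AddCommGroup V] [Module F V]
    (ρ : Representation F G V) (ω : Subgroup.center G →* Fˣ) : Prop :=
  ∀ (z : Subgroup.center G) (v : V), ρ z v = (ω z : F) • v

section LocalField

variable (K : Type*) [Field K] [ValuativeRel K] [TopologicalSpace K]
  [IsNonarchimedeanLocalField K] (L : Type*) [Field L] [Algebra K L] [FiniteDimensional K L]

/-- The ring of integers of the finite extension `L` of the local field `K`. -/
abbrev ringOfInt : Type _ := integralClosure 𝒪[K] L

variable {K L}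

/-- The action of `Gal(L/K)` on the ring of integers of `L`. -/
noncomputable def galAct (σ : Gal(L/K)) : RingAut (ringOfInt K L) :=
  (galRestrict 𝒪[K] K L (ringOfInt K L) σ).toRingEquiv

/-- The coefficient ring `𝒪_L` with an automorphism `φ` of `L/K` and an element `π` of `𝒪_K`. -/
noncomputable def localData [IsGalois K L] {n : ℕ} (hn : Module.finrank K L = n) (φ : Gal(L/K))
    (π : 𝒪[K]) : CyclicData (ringOfInt K L) n where
  φ := galAct φ
  π := algebraMap 𝒪[K] (ringOfInt K L) π
  φ_pow := by
    have h1 : φ ^ n = 1 := by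
      rw [← hn, ← IsGalois.card_aut_eq_finrank K L]
      exact pow_card_eq_one'
    have h2 : ∀ m : ℕ, galAct φ ^ m = galAct (φ ^ m) := by
      intro m
      induction m with
      | zero => ext x; simp [galAct]
      | succ m ih => rw [pow_succ, ih, pow_succ]; ext x; simp [galAct]
    rw [h2, h1]
    ext x
    simp [galAct]
  φ_π := (galRestrict 𝒪[K] K L (ringOfInt K L) φ).commutes π

open TwistedOrder in
/-- The restriction of the character `ω` of `S` to `S ⊓ C` has trivial stabilizer in `Gal(L/K)`,
where `σ` acts by `A_0 ↦ σ(A_0)`. Used for groups `C` of classes of elements `A_0`. -/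
def HasTrivialStabilizer [IsGalois K L] {n : ℕ} [NeZero n] {hn : Module.finrank K L = n}
    {φ : Gal(L/K)} {π : 𝒪[K]} {k h : ℕ} [NeZero k] {F : Type*} [Field F]
    (C S : Subgroup (unip (localData hn φ π) k h)) (ω : S →* Fˣ) : Prop :=
  ∀ σ : Gal(L/K), (∀ (x : ringOfInt K L) (u v : S),
    (u : unip (localData hn φ π) k h) ∈ C → (v : unip (localData hn φ π) k h) ∈ C →
    Represents (const (localData hn φ π) k x) (u : unip (localData hn φ π) k h) →
    Represents (const (localData hn φ π) k (galAct σ x)) (v : unip (localData hn φ π) k h) →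
    ω v = ω u) → σ = 1

end LocalField

/-!
The group `U` is filtered by weights, where the monomial `π^j τ^i` has weight `i + n j`; the
commutator of `1 + α π^j τ^i` and `1 + β π^j' τ^(n-i)` with `j + j' = h - k - 1` (total weight
`n (h - k)`) lies in the last layer `1 + π^(h-1) γ` and is given by
`γ = β φ^(n-i)(α) - α φ^i(β)`, up to sign (`mono_commutator`). A character of the last layer that
is not fixed by any `φ^i`, `0 < i < n` (`LayerRegular`), therefore pairs the terms of complementary
weights perfectly, and the representation theory of `U` is that of an iterated Heisenberg group:
`H⁺` is, modulo the kernel of `χ^♯`, maximal isotropic for this pairing. In the middle degree `n / 2`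
the pairing on the residue field is `(α, β) ↦ β φ^(n/2)(α) - α φ^(n/2)(β)`, for which the fixed
field of `φ^(n/2)` is maximal isotropic.

* Extension: the commutators of `H⁺` lie in `H'` and have trivial constant term
  (`subHPlus_commutator`), so `χ^♯` is trivial on them and extends by duality for finite abelian
  groups (`exists_extendsSharp`).
* Irreducibility: for an element `g` outside `H⁺`, its term of lowest bad weight is paired with a
  complementary monomial in `H⁺` to produce an element of `H⁺` on which `χt` and its conjugate by
  `g` differ (`exists_conj_ne`). This is Mackey's criterion (`ind_isIrreducible_of_mackey`); it
  also shows that the center lies in `H⁺`, so that the central character is the restriction of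
  `χt`.
* Exhaustion: an irreducible representation with regular central character has vectors fixed by
  the elements `1 + a` with `a_0 = 0` of large weight. Descending through the weights, conjugation
  moves every character of the next layer to the trivial one (`exists_fixed_offSub`); both this
  and the transitivity on the extensions of `χ^♯` (`exists_conj_extendsSharp`) are instances of
  `exists_conj_eigenvector`, which rests on orthogonality of characters. Frobenius reciprocity
  (`nonempty_equiv_ind`) concludes.
* Dimension: the index of `H⁺` is a product of additive indices over the coefficients, and the
  degrees `i` and `n - i` contribute `(q^n)^(h-k)` together (`index_plusCoeff_mul_neg`).

It remains to see that a trivial stabilizer implies regularity if `h > k`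
(`layerRegular_of_not_fixedBy`). For `C` the last layer this is a direct translation. For `C` the
center and `k = 1`, a constant `x` in the center commutes with `1 + τ`, so that
`φ(x) = x + π^(h-1) w`; the trace of `w` vanishes, and additive Hilbert 90 on the residue field
(`exists_sub_eq_of_trace_eq_zero`) writes `w` as `φ(δ) - δ` modulo `π`.
-/

/-! ### Induction from a character -/

section InducedCharacter

open Representation

variable {F G : Type*} [Field F] [Group G] (S : Subgroup G) (χ : S →* Fˣ)

lemma charRep_apply {H : Type*} [Group H] (χ : H →* Fˣ) (g : H) (a : F) :
    charRep χ g a = (χ g : F) * a := rfl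

/-- The image of `[g] ⊗ 1` in the representation induced from a character. -/
noncomputable def indVec (g : G) : IndV S.subtype (charRep χ) := IndV.mk _ _ g 1

lemma ind_indVec (g x : G) :
    ind S.subtype (charRep χ) g (indVec S χ x) = indVec S χ (x * g⁻¹) :=
  ind_mk _ _ _ _ _

lemma indVec_mul (s : S) (g : G) : indVec S χ (s * g) = ((χ s)⁻¹ : Fˣ) • indVec S χ g := by
  have h := Coinvariants.mk_self_apply
    (Representation.tprod ((leftRegular F G).comp S.subtype) (charRep χ)) s
    (MonoidAlgebra.single g (1 : F) ⊗ₜ[F] (1 : F))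
  rw [eq_inv_smul_iff]
  have h2 : ((χ s : Fˣ) : F) • indVec S χ (s * g) = indVec S χ g := by
    rw [indVec, indVec, ← map_smul]
    refine Eq.trans ?_ h
    simp [charRep_apply, IndV.mk]
  exact h2

lemma indVec_of_mem (s : S) : indVec S χ s = ((χ s)⁻¹ : Fˣ) • indVec S χ 1 := by
  simpa using indVec_mul S χ s 1

variable {S χ} in
lemma ind_hom_ext {W : Type*} [AddCommGroup W] [Module F W]
    {f g : IndV S.subtype (charRep χ) →ₗ[F] W} (H : ∀ x, f (indVec S χ x) = g (indVec S χ x)) :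
    f = g :=
  IndV.hom_ext _ _ fun x => LinearMap.ext_ring (H x)

/-- The linear map out of an induced representation with prescribed values on the vectors
`indVec S χ x`. -/
noncomputable def indLift {W : Type*} [AddCommGroup W] [Module F W] (f : G → W)
    (hf : ∀ (s : S) g, f (s * g) = ((χ s)⁻¹ : Fˣ) • f g) :
    IndV S.subtype (charRep χ) →ₗ[F] W :=
  Coinvariants.lift _
    (TensorProduct.lift <| (Finsupp.lift _ _ _ fun x => LinearMap.toSpanSingleton F W (f x)) ∘ₗ
      (MonoidAlgebra.coeffLinearEquiv F).toLinearMap)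
    fun s ↦ by
      ext x
      have := hf s x
      simp [charRep_apply, this]
      change (χ s : F) • (((χ s)⁻¹ : Fˣ) : F) • f x = f x
      simp [smul_smul]

lemma indLift_indVec {W : Type*} [AddCommGroup W] [Module F W] (f : G → W)
    (hf : ∀ (s : S) g, f (s * g) = ((χ s)⁻¹ : Fˣ) • f g) (x : G) :
    indLift S χ f hf (indVec S χ x) = f x := by
  simp [indLift, indVec, IndV.mk]

open Classical in
/-- The coefficient of `indVec S χ 1`, which vanishes on `indVec S χ x` for `x ∉ S`. -/
noncomputable def indCoeff : IndV S.subtype (charRep χ) →ₗ[F] F :=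
  indLift S χ (fun x => if hx : x ∈ S then (((χ ⟨x, hx⟩)⁻¹ : Fˣ) : F) else 0) fun s g => by
    by_cases hg : g ∈ S
    · have h1 : (s : G) * g ∈ S := S.mul_mem s.2 hg
      have h2 : (⟨(s : G) * g, h1⟩ : S) = s * ⟨g, hg⟩ := rfl
      simp only [h1, hg, dif_pos, h2, map_mul, mul_inv, Units.val_mul]
      rfl
    · have h1 : (s : G) * g ∉ S := fun h => hg ((S.mul_mem_cancel_left s.2).mp h)
      simp [h1, hg]

lemma indCoeff_of_mem (s : S) : indCoeff S χ (indVec S χ s) = (((χ s)⁻¹ : Fˣ) : F) := by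
  simp [indCoeff, indLift_indVec]

lemma indCoeff_of_notMem {x : G} (hx : x ∉ S) : indCoeff S χ (indVec S χ x) = 0 := by
  simp [indCoeff, indLift_indVec, hx]

/-- The induced representation of a character is the space of functions on the cosets. -/
noncomputable def indEquiv [Finite G] :
    IndV S.subtype (charRep χ) ≃ₗ[F] (G ⧸ S → F) := by
  classical
  haveI := Fintype.ofFinite (G ⧸ S)
  refine LinearEquiv.ofLinearMap
    (LinearMap.pi fun q => indCoeff S χ ∘ₗ ind S.subtype (charRep χ) q.out⁻¹)
    (∑ q : G ⧸ S, (LinearMap.toSpanSingleton F _ (indVec S χ q.out⁻¹)) ∘ₗ LinearMap.proj q) ?_ ?_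
  · refine LinearMap.pi_ext' fun q => LinearMap.ext_ring ?_
    ext q'
    simp only [LinearMap.comp_apply, LinearMap.sum_apply, LinearMap.toSpanSingleton_apply,
      LinearMap.proj_apply, LinearMap.single_apply, LinearMap.pi_apply, LinearMap.id_apply,
      map_sum]
    rw [Finset.sum_eq_single q]
    · rw [Pi.single_eq_same, one_smul, ind_indVec, inv_inv]
      by_cases hq : q' = q
      · subst hq
        rw [inv_mul_cancel, Pi.single_eq_same]
        simpa using indCoeff_of_mem S χ 1
      · rw [indCoeff_of_notMem, Pi.single_eq_of_ne hq]
        rw [← QuotientGroup.eq, QuotientGroup.out_eq', QuotientGroup.out_eq']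
        exact Ne.symm hq
    · intro b _ hb
      simp [Pi.single_eq_of_ne hb]
    · simp
  · refine ind_hom_ext fun x => ?_
    simp only [LinearMap.comp_apply, LinearMap.sum_apply, LinearMap.toSpanSingleton_apply,
      LinearMap.proj_apply, LinearMap.pi_apply, LinearMap.id_apply, ind_indVec, inv_inv]
    set q : G ⧸ S := QuotientGroup.mk x⁻¹ with hq
    have hmem : x * q.out ∈ S := by
      have h : (QuotientGroup.mk x⁻¹ : G ⧸ S) = QuotientGroup.mk q.out :=
        (QuotientGroup.out_eq' q).symm
      simpa using QuotientGroup.eq.mp h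
    rw [Finset.sum_eq_single q]
    · have h1 := indCoeff_of_mem S χ ⟨_, hmem⟩
      have h2 := indVec_mul S χ ⟨_, hmem⟩ q.out⁻¹
      simp only at h1 h2
      rw [mul_inv_cancel_right] at h2
      rw [h1, h2]
      rfl
    · intro b _ hb
      rw [indCoeff_of_notMem, zero_smul]
      intro h
      refine hb ?_
      rw [hq, ← QuotientGroup.out_eq' b]
      exact (QuotientGroup.eq.mpr (by simpa using h)).symm
    · simp

lemma finrank_ind [Finite G] : Module.finrank F (IndV S.subtype (charRep χ)) = S.index := by
  have := Fintype.ofFinite (G ⧸ S)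
  rw [(indEquiv S χ).finrank_eq, Module.finrank_pi, Subgroup.index, Nat.card_eq_fintype_card]

lemma eq_zero_of_indCoeff [Finite G] {w : IndV S.subtype (charRep χ)}
    (hw : ∀ g, indCoeff S χ (ind S.subtype (charRep χ) g w) = 0) : w = 0 := by
  rw [← (indEquiv S χ).map_eq_zero_iff]
  ext q
  exact hw q.out⁻¹

/-- Mackey's criterion for the irreducibility of a representation induced from a character. -/
theorem ind_isIrreducible_of_mackey [Finite G] [CharZero F]
    (H : ∀ g ∉ S, ∃ (s : S) (h : g⁻¹ * s * g ∈ S), χ ⟨_, h⟩ ≠ χ s) :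
    (ind S.subtype (charRep χ)).IsIrreducible := by
  classical
  have := Fintype.ofFinite S
  set ρ := ind S.subtype (charRep χ) with hρ
  -- `p` is `|S|` times the projection to the `χ`-isotypic part for `S`, which is a line.
  set p : IndV S.subtype (charRep χ) →ₗ[F] IndV S.subtype (charRep χ) :=
    ∑ s : S, (((χ s)⁻¹ : Fˣ) : F) • ρ s with hp
  have hpt : ∀ (t : S) w, p (ρ t w) = (χ t : F) • p w := by
    intro t w
    simp only [hp, LinearMap.sum_apply, LinearMap.smul_apply, Finset.smul_sum]
    refine Fintype.sum_equiv (Equiv.mulRight t) _ _ fun s => ?_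
    simp only [Equiv.coe_mulRight, map_mul, Subgroup.coe_mul, mul_inv, Units.val_mul,
      Module.End.mul_apply, smul_smul]
    congr 1
    rw [mul_left_comm, Units.mul_inv, mul_one]
  have hp1 : ∀ w, p w = (Fintype.card S : F) • indCoeff S χ w • indVec S χ 1 := by
    intro w
    have : p = (Fintype.card S : F) • (LinearMap.toSpanSingleton F _ (indVec S χ 1)) ∘ₗ
        indCoeff S χ := by
      refine ind_hom_ext fun x => ?_
      by_cases hx : x ∈ S
      · have h1 : p (indVec S χ 1) = (Fintype.card S : F) • indVec S χ 1 := by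
          simp only [hp, LinearMap.sum_apply, LinearMap.smul_apply, hρ, ind_indVec]
          rw [Finset.sum_congr rfl (g := fun _ => indVec S χ 1), Finset.sum_const,
            Finset.card_univ, Nat.cast_smul_eq_nsmul]
          intro s _
          rw [one_mul, ← Subgroup.coe_inv, indVec_of_mem, map_inv, inv_inv, Units.smul_def,
            smul_smul, Units.inv_mul, one_smul]
        have h2 := indVec_of_mem S χ ⟨x, hx⟩
        have h3 := indCoeff_of_mem S χ ⟨x, hx⟩
        simp only at h2 h3
        simp only [LinearMap.smul_apply, LinearMap.comp_apply, h3,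
          LinearMap.toSpanSingleton_apply]
        rw [h2, Units.smul_def, map_smul, h1, smul_comm]
      · simp only [LinearMap.smul_apply, LinearMap.comp_apply, indCoeff_of_notMem S χ hx,
          map_zero, smul_zero]
        obtain ⟨t, ht, hne⟩ := H x⁻¹ (fun h => hx (by simpa using S.inv_mem h))
        rw [inv_inv] at ht
        have h1 := hpt t (indVec S χ x)
        have h2 := indVec_mul S χ (⟨x * t * x⁻¹, ht⟩⁻¹) x
        simp only [Subgroup.coe_inv] at h2
        rw [hρ, ind_indVec, show x * (t : G)⁻¹ = (x * t * x⁻¹)⁻¹ * x by group, h2, map_inv,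
          inv_inv, Units.smul_def, map_smul] at h1
        by_contra h0
        simp only [inv_inv] at hne
        exact hne (Units.ext (smul_left_injective F h0 h1))
    rw [this]
    rfl
  have hcard : (Fintype.card S : F) ≠ 0 := by exact_mod_cast Fintype.card_ne_zero
  have key : ∀ (W : Subrepresentation ρ) (w), w ∈ W → w ≠ 0 → W = ⊤ := by
    intro W w hw h0
    obtain ⟨g, hg⟩ : ∃ g, indCoeff S χ (ρ g w) ≠ 0 := by
      by_contra! h
      exact h0 (eq_zero_of_indCoeff S χ h)
    have h1 : p (ρ g w) ∈ W.toSubmodule := by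
      rw [hp, LinearMap.sum_apply]
      exact Submodule.sum_mem _ fun s _ => Submodule.smul_mem _ _
        (W.apply_mem_toSubmodule _ (W.apply_mem_toSubmodule _ hw))
    rw [hp1, smul_smul, Submodule.smul_mem_iff _ (mul_ne_zero hcard hg)] at h1
    have h2 : W.toSubmodule = ⊤ := by
      rw [← Submodule.ker_mkQ W.toSubmodule, LinearMap.ker_eq_top]
      refine ind_hom_ext fun x => ?_
      rw [LinearMap.zero_apply, Submodule.mkQ_apply, Submodule.Quotient.mk_eq_zero]
      have h2 : ρ x⁻¹ (indVec S χ 1) = indVec S χ x := by rw [hρ, ind_indVec, one_mul, inv_inv]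
      exact h2 ▸ W.apply_mem_toSubmodule x⁻¹ h1
    exact Subrepresentation.toSubmodule_injective h2
  have h1 : indVec S χ 1 ≠ 0 := by
    intro h
    have := indCoeff_of_mem S χ 1
    simp [h] at this
  have : Nontrivial (Subrepresentation ρ) := by
    refine ⟨⊥, ⊤, fun h => h1 ?_⟩
    have : indVec S χ 1 ∈ (⊥ : Subrepresentation ρ).toSubmodule := h ▸ Submodule.mem_top
    exact this
  refine ⟨fun W => ?_⟩
  by_cases hW : ∃ w ∈ W, w ≠ 0
  · obtain ⟨w, hw, h0⟩ := hW
    exact Or.inr (key W w hw h0)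
  · push Not at hW
    refine Or.inl (Subrepresentation.toSubmodule_injective ?_)
    exact (Submodule.eq_bot_iff _).mpr hW

/-- Frobenius reciprocity for irreducible representations: an eigenvector for `χ` in `ρ`
identifies `ρ` with the representation induced from `χ`. -/
theorem nonempty_equiv_ind {V : Type*} [AddCommGroup V] [Module F V] (ρ : Representation F G V)
    (hρ : ρ.IsIrreducible) (hχ : (ind S.subtype (charRep χ)).IsIrreducible) {v : V} (hv : v ≠ 0)
    (hS : ∀ s : S, ρ s v = (χ s : F) • v) :
    Nonempty (ρ.Equiv (ind S.subtype (charRep χ))) := by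
  set f : IndV S.subtype (charRep χ) →ₗ[F] V := indLift S χ (fun x => ρ x⁻¹ v) fun s g => by
    rw [mul_inv_rev, map_mul, Module.End.mul_apply, ← Subgroup.coe_inv, hS, map_smul, map_inv]
    rfl
  have hf : ∀ x, f (indVec S χ x) = ρ x⁻¹ v := indLift_indVec S χ _ _
  set T : IntertwiningMap (ind S.subtype (charRep χ)) ρ := ⟨f, fun g => ind_hom_ext fun x => by
    simp only [LinearMap.comp_apply, ind_indVec, hf, mul_inv_rev, inv_inv, map_mul,
      Module.End.mul_apply]⟩
  rcases IsIrreducible.bijective_or_eq_zero T with hT | hT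
  · exact ⟨(T.ofBijective hT).symm⟩
  · exfalso
    refine hv ?_
    have h1 : T (indVec S χ 1) = ρ 1⁻¹ v := hf 1
    rw [hT] at h1
    simpa using h1.symm

end InducedCharacter

/-! ### Characters and eigenvectors of finite groups -/

section Characters

variable {F G : Type*} [Field F] [Group G]

/-- An irreducible representation of a finite group is finite dimensional. -/
lemma Representation.IsIrreducible.finiteDimensional [Finite G] {V : Type*} [AddCommGroup V]
    [Module F V] {ρ : Representation F G V} (hρ : ρ.IsIrreducible) : FiniteDimensional F V := by
  by_cases hV : ∃ v : V, v ≠ 0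
  · obtain ⟨v, hv⟩ := hV
    set W : Subrepresentation ρ :=
      { toSubmodule := Submodule.span F (Set.range fun g => ρ g v)
        apply_mem_toSubmodule := by
          intro g w hw
          induction hw using Submodule.span_induction with
          | mem x hx =>
            obtain ⟨g', rfl⟩ := hx
            refine Submodule.subset_span ⟨g * g', ?_⟩
            simp
          | zero => simp
          | add x y _ _ hx hy => rw [map_add]; exact Submodule.add_mem _ hx hy
          | smul a x _ hx => rw [map_smul]; exact Submodule.smul_mem _ _ hx } with hW
    have hvW : v ∈ W.toSubmodule := Submodule.subset_span ⟨1, by simp⟩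
    have htop : W = ⊤ := by
      rcases hρ.eq_bot_or_eq_top W with h | h
      · exact absurd ((Submodule.mem_bot F).mp (show v ∈ (⊥ : Subrepresentation ρ).toSubmodule
          from h ▸ hvW)) hv
      · exact h
    have hspan : Submodule.span F (Set.range fun g => ρ g v) = ⊤ :=
      congrArg Subrepresentation.toSubmodule htop
    exact ⟨hspan ▸ Submodule.fg_span (Set.finite_range _)⟩
  · push Not at hV
    have : Subsingleton V := ⟨fun a b => (hV a).trans (hV b).symm⟩
    infer_instance

/-- A commuting family of operators on a nonzero finite-dimensional space over an algebraically
closed field has a common eigenvector. -/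
lemma exists_common_eigenvector [IsAlgClosed F] {ι : Type*} (m : ℕ) :
    ∀ {V : Type*} [AddCommGroup V] [Module F V] [FiniteDimensional F V] [Nontrivial V]
      (f : ι → Module.End F V), (∀ i j, Commute (f i) (f j)) → Module.finrank F V ≤ m →
      ∃ v ≠ 0, ∀ i, ∃ c : F, f i v = c • v := by
  induction m with
  | zero =>
    intro V _ _ _ _ f _ h
    exact absurd h (by have := Module.finrank_pos (R := F) (M := V); omega)
  | succ m ih =>
    intro V _ _ _ _ f hf hm
    by_cases hs : ∀ i, ∃ c : F, ∀ v, f i v = c • v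
    · obtain ⟨v, hv⟩ := exists_ne (0 : V)
      exact ⟨v, hv, fun i => (hs i).imp fun c hc => hc v⟩
    push Not at hs
    obtain ⟨i, hi⟩ := hs
    obtain ⟨c, hc⟩ := Module.End.exists_eigenvalue (f i)
    set E := (f i).eigenspace c
    have hE : ∀ j, ∀ x ∈ E, f j x ∈ E := by
      intro j x hx
      rw [Module.End.mem_eigenspace_iff] at hx ⊢
      rw [← Module.End.mul_apply, (hf i j).eq, Module.End.mul_apply, hx, map_smul]
    have hlt : Module.finrank F E < Module.finrank F V := by
      refine Submodule.finrank_lt fun htop => ?_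
      obtain ⟨v, hv⟩ := hi c
      exact hv (Module.End.mem_eigenspace_iff.mp (htop ▸ Submodule.mem_top : v ∈ E))
    have : Nontrivial E := (Submodule.nontrivial_iff_ne_bot).mpr hc
    obtain ⟨v, hv, hv'⟩ := ih (fun j => (f j).restrict (hE j)) (fun j j' => by
      ext x
      exact congrArg (fun g : Module.End F V => g x) (hf j j').eq) (by omega)
    refine ⟨v, fun h => hv (Subtype.ext h), fun j => ?_⟩
    obtain ⟨d, hd⟩ := hv' j
    exact ⟨d, congrArg Subtype.val hd⟩

/-- If `S` commutes modulo `N ≤ S`, it has an eigenvector in the space fixed by `N`. -/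
lemma exists_eigenvector_of_fixed [IsAlgClosed F] {V : Type*} [AddCommGroup V] [Module F V]
    [FiniteDimensional F V] (ρ : Representation F G V) {N S : Subgroup G} (hNS : N ≤ S)
    (hcomm : ∀ s ∈ S, ∀ t ∈ S, ∃ c ∈ N, s * t = t * s * c) {v : V} (hv : v ≠ 0)
    (hN : ∀ x ∈ N, ρ x v = v) :
    ∃ (Λ : S →* Fˣ) (w : V), w ≠ 0 ∧ (∀ s : S, ρ s w = (Λ s : F) • w) ∧
      ∀ s : S, (s : G) ∈ N → Λ s = 1 := by
  set W : Submodule F V := ⨅ x : N, LinearMap.ker (ρ x - 1) with hW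
  have memW : ∀ w, w ∈ W ↔ ∀ x ∈ N, ρ x w = w := by
    intro w
    simp [hW, Submodule.mem_iInf, sub_eq_zero]
  have hstab : ∀ s : S, ∀ w ∈ W, ρ s w ∈ W := by
    intro s w hw
    rw [memW] at hw ⊢
    intro x hx
    obtain ⟨c, hc, h⟩ := hcomm x (hNS hx) s s.2
    rw [← Module.End.mul_apply, ← map_mul, h, map_mul, map_mul, Module.End.mul_apply, hw c hc,
      Module.End.mul_apply, hw x hx]
  have : Nontrivial W := by
    refine ⟨⟨v, (memW v).mpr hN⟩, 0, fun h => hv (congrArg Subtype.val h)⟩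
  obtain ⟨w, hw, h⟩ := exists_common_eigenvector (F := F) _ (fun s : S => (ρ s).restrict (hstab s))
    (fun s t => by
      ext x
      obtain ⟨c, hc, h⟩ := hcomm s s.2 t t.2
      change ρ s (ρ t x) = ρ t (ρ s x)
      rw [← Module.End.mul_apply, ← map_mul, h, map_mul, map_mul, Module.End.mul_apply,
        (memW _).mp x.2 c hc, Module.End.mul_apply]) le_rfl
  choose c hc using h
  have hw0 : (w : V) ≠ 0 := fun h => hw (Subtype.ext h)
  have hc' : ∀ s : S, ρ s (w : V) = c s • (w : V) := fun s => congrArg Subtype.val (hc s)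
  have cinj := smul_left_injective F hw0
  have c1 : c 1 = 1 := cinj (by simpa using (hc' 1).symm)
  have cmul : ∀ s t, c (s * t) = c s * c t := by
    intro s t
    refine cinj ?_
    simp only
    rw [← hc', Subgroup.coe_mul, map_mul, Module.End.mul_apply, hc', map_smul, hc', smul_smul,
      mul_comm]
  set Λ : S →* F := ⟨⟨c, c1⟩, cmul⟩
  refine ⟨Λ.toHomUnits, w, hw0, hc', fun s hs => Units.ext (cinj ?_)⟩
  change c s • (w : V) = (1 : F) • (w : V)
  rw [← hc', (memW _).mp w.2 s hs, one_smul]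

/-- A character of a subgroup that is trivial on all commutators of a finite group extends. -/
lemma exists_extension_of_commutators [IsAlgClosed F] [CharZero F] {T : Type*} [Group T] [Finite T]
    (N : Subgroup T) (χ : N →* Fˣ)
    (hχ : ∀ x : N, (x : T) ∈ commutator T → χ x = 1) : ∃ χ' : T →* Fˣ, ∀ x : N, χ' x = χ x := by
  have hker : (Abelianization.of.comp N.subtype).rangeRestrict.ker ≤ χ.ker := by
    intro x hx
    rw [MonoidHom.mem_ker] at hx ⊢
    refine hχ x ?_
    have : Abelianization.of (x : T) = 1 := congrArg Subtype.val hx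
    exact (QuotientGroup.eq_one_iff _).mp this
  set ψ := ((Abelianization.of.comp N.subtype).rangeRestrict).liftOfSurjective
    (MonoidHom.rangeRestrict_surjective _) ⟨χ, hker⟩
  have : Finite (Abelianization T) := Quotient.finite _
  have : NeZero (Monoid.exponent (Abelianization T) : F) :=
    ⟨by exact_mod_cast Monoid.exponent_ne_zero_of_finite⟩
  obtain ⟨χ', hχ'⟩ := MonoidHom.domRestrict_surjective (M := F)
    (Abelianization.of.comp N.subtype).range ψ
  refine ⟨χ'.comp Abelianization.of, fun x => ?_⟩
  have h1 := DFunLike.congr_fun hχ' ((Abelianization.of.comp N.subtype).rangeRestrict x)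
  have h2 : ψ ((Abelianization.of.comp N.subtype).rangeRestrict x) = χ x :=
    MonoidHom.liftOfRightInverse_comp_apply _ _ _ _ _
  rw [← h2, ← h1]
  rfl

/-- A character of `S` is in the range of a pairing if it vanishes on the elements that pair
trivially with everything; this is the orthogonality of characters. -/
lemma exists_pairing_eq [CharZero F] {Γ S : Type*} [Group Γ] [Group S] [Finite Γ] [Finite S]
    (P : Γ →* S →* Fˣ) (Λ : S →* Fˣ) (h : ∀ s, (∀ g, P g s = 1) → Λ s = 1) : ∃ g, P g = Λ := by
  classical
  by_contra! hne
  have := Fintype.ofFinite Γ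
  have := Fintype.ofFinite S
  have h1 : ∑ s, ∑ g, (((P g * Λ⁻¹ : S →* Fˣ) s : Fˣ) : F) = 0 := by
    rw [Finset.sum_comm]
    refine Finset.sum_eq_zero fun g _ => ?_
    refine sum_hom_units_eq_zero ((Units.coeHom F).comp (P g * Λ⁻¹)) fun h0 => hne g ?_
    rw [← mul_inv_eq_one]
    ext s
    exact DFunLike.congr_fun h0 s
  have h2 : ∀ s, ∑ g, (((P g * Λ⁻¹ : S →* Fˣ) s : Fˣ) : F) =
      if ∀ g, P g s = 1 then (Fintype.card Γ : F) else 0 := by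
    intro s
    split_ifs with hs
    · simp [hs, h s hs]
    · have := sum_hom_units_eq_zero
        ((Units.coeHom F).comp ((MonoidHom.eval s : (S →* Fˣ) →* Fˣ).comp P)) fun h0 =>
          hs fun g => by
          ext
          exact DFunLike.congr_fun h0 g
      simp only [MonoidHom.mul_apply, Units.val_mul, ← Finset.sum_mul]
      rw [show ∑ g, ((P g s : Fˣ) : F) = 0 from this, zero_mul]
  rw [Finset.sum_congr rfl fun s _ => h2 s, Finset.sum_ite, Finset.sum_const_zero, add_zero,
    Finset.sum_const, nsmul_eq_mul, mul_eq_zero] at h1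
  rcases h1 with h1 | h1
  · have : (1 : S) ∈ Finset.univ.filter fun s => ∀ g, P g s = 1 := by simp
    rw [Nat.cast_eq_zero, Finset.card_eq_zero] at h1
    rw [h1] at this
    simp at this
  · exact Fintype.card_ne_zero (by exact_mod_cast h1 : Fintype.card Γ = 0)

/-- Let `θ` be a character of `N` such that `θ` is invariant under conjugation by `Γ` and `S`,
and `[S, Γ] ≤ N`. Then conjugation by `Γ` moves a `θ`-eigenvector of `N` that is an eigenvector
of `S` to one on which `S` acts by any given character, provided that the two characters of `S`
agree on the elements whose commutators with `Γ` are killed by `θ`. -/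
lemma exists_conj_eigenvector [CharZero F] [Finite G] {V : Type*} [AddCommGroup V] [Module F V]
    (ρ : Representation F G V) (S Γ N : Subgroup G) (θ : N →* Fˣ)
    (hc : ∀ g ∈ Γ, ∀ s ∈ S, s⁻¹ * g⁻¹ * s * g ∈ N)
    (hinv : ∀ (g : G) (x : N), g ∈ Γ ∨ g ∈ S → ∃ h : g⁻¹ * x * g ∈ N, θ ⟨_, h⟩ = θ x)
    (Λ Λ' : S →* Fˣ)
    (hΛ : ∀ s : S, (∀ (g : G) (hg : g ∈ Γ), θ ⟨_, hc g hg s s.2⟩ = 1) → Λ s = Λ' s)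
    {v : V} (hN : ∀ x : N, ρ x v = (θ x : F) • v) (hS : ∀ s : S, ρ s v = (Λ s : F) • v) :
    ∃ g ∈ Γ, ∀ s : S, ρ s (ρ g v) = (Λ' s : F) • ρ g v := by
  set P : Γ →* S →* Fˣ := MonoidHom.mk' (fun g => MonoidHom.mk' (fun s => θ ⟨_, hc g g.2 s s.2⟩)
    (by
      intro s t
      obtain ⟨h, h'⟩ := hinv t ⟨_, hc g g.2 s s.2⟩ (Or.inr t.2)
      rw [← h', ← map_mul]
      congr 1
      ext
      simp only [Subgroup.coe_mul, mul_inv_rev]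
      group))
    (by
      intro g g'
      ext s
      obtain ⟨h, h'⟩ := hinv g' ⟨_, hc g g.2 s s.2⟩ (Or.inl g'.2)
      simp only [MonoidHom.mk'_apply, MonoidHom.mul_apply]
      rw [← h', mul_comm, ← map_mul]
      congr 2
      ext
      simp only [Subgroup.coe_mul, mul_inv_rev]
      group) with hP
  obtain ⟨g, hg⟩ := exists_pairing_eq P (Λ' * Λ⁻¹) fun s hs => by
    rw [MonoidHom.mul_apply, MonoidHom.inv_apply, mul_inv_eq_one]
    exact (hΛ s fun g hg => hs ⟨g, hg⟩).symm
  refine ⟨g, g.2, fun s => ?_⟩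
  have h1 : θ ⟨_, hc g g.2 s s.2⟩ = Λ' s * (Λ s)⁻¹ := DFunLike.congr_fun hg s
  have h2 : (s : G) * g = g * s * ((s : G)⁻¹ * (g : G)⁻¹ * s * g) := by group
  rw [← Module.End.mul_apply, ← map_mul, h2, map_mul, map_mul, Module.End.mul_apply,
    Module.End.mul_apply, show ρ ((s : G)⁻¹ * (g : G)⁻¹ * s * g) v = _ from
      hN ⟨_, hc g g.2 s s.2⟩, h1, map_smul, hS, map_smul, map_smul, smul_smul,
    Units.val_mul, mul_assoc, Units.inv_mul, mul_one]

end Characters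

/-! ### Coefficients, weights and classes of `1 + x` -/

namespace TwistedOrder

variable {O : Type*} [CommRing O] {n : ℕ} {D : CyclicData O n} {k : ℕ} [NeZero n]

section Weights

/-- The monomial `x τ^i`. -/
def mono (D : CyclicData O n) (k : ℕ) (i : Fin n) (x : O) : TwistedOrder D k := ⟨Pi.single i x⟩

lemma coeff_mono_self (i : Fin n) (x : O) : (mono D k i x).coeff i = x := by simp [mono]

lemma coeff_mono_ne {i l : Fin n} (hl : l ≠ i) (x : O) : (mono D k i x).coeff l = 0 := by
  simp [mono, Pi.single_eq_of_ne hl]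

lemma coeff_const_zero (x : O) : (const D k x).coeff 0 = x := coeff_mono_self 0 x

lemma coeff_const_ne {l : Fin n} (hl : l ≠ 0) (x : O) : (const D k x).coeff l = 0 :=
  coeff_mono_ne hl x

lemma coeff_const_mul (x : O) (a : TwistedOrder D k) (l : Fin n) :
    (const D k x * a).coeff l = x * a.coeff l := by
  rw [coeff_mul, Finset.sum_eq_single 0]
  · simp [carry_zero_left, coeff_const_zero]
  · intro p _ hp
    simp [coeff_const_ne hp]
  · simp

lemma coeff_mul_const (x : O) (a : TwistedOrder D k) (l : Fin n) :
    (a * const D k x).coeff l = a.coeff l * (D.φ ^ (l : ℕ)) x := by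
  rw [coeff_mul, Finset.sum_eq_single l]
  · simp [carry_zero_right, coeff_const_zero]
  · intro p _ hp
    simp [coeff_const_ne (sub_ne_zero.mpr (Ne.symm hp))]
  · simp

lemma carry_neg {i : Fin n} (hi : i ≠ 0) : carry k i (-i) = k := by
  obtain ⟨c, hc, hc'⟩ := carry_eq (k := k) i (-i)
  have hi0 : (i : ℕ) ≠ 0 := fun h => hi (Fin.ext h)
  have h1 : (i : ℕ) + (-i : Fin n) < 2 * n := by have := i.2; have := (-i).2; omega
  rw [add_neg_cancel] at hc'
  simp only [Fin.val_zero, zero_add] at hc'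
  have : c = 1 := by
    rcases Nat.lt_or_ge c 1 with h | h
    · obtain rfl : c = 0 := by omega
      omega
    · rcases Nat.lt_or_ge c 2 with h' | h'
      · omega
      · have := Nat.mul_le_mul_left n h'
        omega
  rw [hc, this, mul_one]

lemma val_add_val_neg {i : Fin n} (hi : i ≠ 0) : (i : ℕ) + ((-i : Fin n) : ℕ) = n := by
  have hi0 : (i : ℕ) ≠ 0 := fun h => hi (Fin.ext h)
  rw [Fin.val_neg, if_neg hi]
  have := i.2
  omega

lemma coeff_zero_mono_mul {i : Fin n} (hi : i ≠ 0) (x : O) (b : TwistedOrder D k) :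
    (mono D k i x * b).coeff 0 = x * (D.φ ^ (i : ℕ)) (b.coeff (-i)) * D.π ^ k := by
  rw [coeff_mul, Finset.sum_eq_single i]
  · rw [coeff_mono_self, zero_sub, carry_neg hi]
  · intro p _ hp
    simp [coeff_mono_ne hp]
  · simp

lemma coeff_zero_mul_mono {i : Fin n} (hi : i ≠ 0) (x : O) (b : TwistedOrder D k) :
    (b * mono D k i x).coeff 0 =
      b.coeff (-i) * (D.φ ^ ((-i : Fin n) : ℕ)) x * D.π ^ k := by
  rw [coeff_mul, Finset.sum_eq_single (-i)]
  · have := carry_neg (k := k) (neg_ne_zero.mpr hi)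
    rw [neg_neg] at this
    rw [zero_sub, neg_neg, coeff_mono_self, this]
  · intro p _ hp
    rw [coeff_mono_ne (by rw [zero_sub]; exact fun h => hp (by rw [← h, neg_neg]))]
    simp
  · simp

/-- The coefficients of `τ^i` for `i ≠ 0` have weight at least `w`, where `π^j τ^i` has weight
`i + n * j`. -/
def OffWeight (w : ℕ) (a : TwistedOrder D k) : Prop :=
  ∀ i : Fin n, i ≠ 0 → ∃ e, D.π ^ e ∣ a.coeff i ∧ w ≤ (i : ℕ) + n * e

lemma OffWeight.mono {w w' : ℕ} {a : TwistedOrder D k} (ha : OffWeight w a) (h : w' ≤ w) :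
    OffWeight w' a := fun i hi => (ha i hi).imp fun _ he => ⟨he.1, h.trans he.2⟩

lemma offWeight_of_le_one {w : ℕ} (hw : w ≤ 1) (a : TwistedOrder D k) : OffWeight w a :=
  fun i hi => ⟨0, by simp, by
    have hi0 : (i : ℕ) ≠ 0 := fun h => hi (Fin.ext h)
    omega⟩

lemma OffWeight.dvd {w : ℕ} {a : TwistedOrder D k} (ha : OffWeight w a) {i : Fin n} (hi : i ≠ 0)
    {j : ℕ} (hj : n * j ≤ w) : D.π ^ j ∣ a.coeff i := by
  obtain ⟨e, he, he'⟩ := ha i hi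
  refine (pow_dvd_pow _ ?_).trans he
  by_contra! h
  have h1 : n * (e + 1) ≤ n * j := Nat.mul_le_mul_left n h
  have := i.2
  rw [mul_add] at h1
  omega

lemma OffWeight.dvd_of_lt {w : ℕ} {a : TwistedOrder D k} (ha : OffWeight w a) {i : Fin n}
    (hi : i ≠ 0) {j : ℕ} (hj : (i : ℕ) + n * j < w) : D.π ^ (j + 1) ∣ a.coeff i := by
  obtain ⟨e, he, he'⟩ := ha i hi
  refine (pow_dvd_pow _ ?_).trans he
  have : n * j < n * e := by omega
  exact Nat.lt_of_mul_lt_mul_left this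

lemma offWeight_iff {w : ℕ} {a : TwistedOrder D k} : OffWeight w a ↔
    ∀ (i : Fin n) (j : ℕ), i ≠ 0 → (i : ℕ) + n * j < w → D.π ^ (j + 1) ∣ a.coeff i := by
  refine ⟨fun ha i j hi hj => ha.dvd_of_lt hi hj, fun H i hi => ?_⟩
  have hn : 0 < n := Nat.pos_of_ne_zero (NeZero.ne n)
  obtain ⟨e, he, he'⟩ := exists_level (Q := fun j => (i : ℕ) + n * j < w)
    (fun j hj => H i j hi hj) ⟨w, by
      have := Nat.le_mul_of_pos_left w hn
      omega⟩
  exact ⟨e, he, not_lt.mp he'⟩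

lemma OffWeight.add {w : ℕ} {a b : TwistedOrder D k} (ha : OffWeight w a) (hb : OffWeight w b) :
    OffWeight w (a + b) := by
  rw [offWeight_iff] at *
  exact fun i j hi hj => dvd_add (ha i j hi hj) (hb i j hi hj)

lemma OffWeight.neg {w : ℕ} {a : TwistedOrder D k} (ha : OffWeight w a) : OffWeight w (-a) := by
  rw [offWeight_iff] at *
  exact fun i j hi hj => (dvd_neg (α := O)).mpr (ha i j hi hj)

lemma OffWeight.sub {w : ℕ} {a b : TwistedOrder D k} (ha : OffWeight w a) (hb : OffWeight w b) :
    OffWeight w (a - b) := sub_eq_add_neg a b ▸ ha.add hb.neg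

lemma offWeight_const (w : ℕ) (x : O) : OffWeight w (const D k x) := fun i hi => ⟨w, by
  rw [coeff_const_ne hi]; exact dvd_zero _, by
  have := Nat.le_mul_of_pos_left w (Nat.pos_of_ne_zero (NeZero.ne n)); omega⟩

lemma offWeight_mono (i : Fin n) (j : ℕ) (x : O) :
    OffWeight ((i : ℕ) + n * j) (mono D k i (D.π ^ j * x)) := fun l _ => by
  by_cases hl : l = i
  · subst hl
    exact ⟨j, by rw [coeff_mono_self]; exact dvd_mul_right _ _, le_rfl⟩
  · refine ⟨(i : ℕ) + n * j, by rw [coeff_mono_ne hl]; exact dvd_zero _, ?_⟩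
    have := Nat.le_mul_of_pos_left ((i : ℕ) + n * j) (Nat.pos_of_ne_zero (NeZero.ne n))
    omega

variable [NeZero k]

/-- Weights are superadditive because every carry multiplies by `π^k` with `k ≥ 1`. -/
lemma OffWeight.mul {w w' w'' : ℕ} {a b : TwistedOrder D k} (ha : OffWeight w a)
    (hb : OffWeight w' b) (hw : w'' ≤ w + w' ∨ w'' ≤ 1) {e f : ℕ} (hae : D.π ^ e ∣ a.coeff 0)
    (he : w'' ≤ w' + n * e) (hbf : D.π ^ f ∣ b.coeff 0) (hf : w'' ≤ w + n * f) :
    OffWeight w'' (a * b) := by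
  rcases hw with hw | hw
  swap
  · exact offWeight_of_le_one hw _
  rw [offWeight_iff]
  refine fun l j hl hj => dvd_coeff_mul fun p r hpr => ?_
  have hn : 0 < n := Nat.pos_of_ne_zero (NeZero.ne n)
  by_cases hp : p = 0
  · subst hp
    rw [zero_add] at hpr
    subst hpr
    obtain ⟨f', hf1, hf2⟩ := hb r hl
    refine ⟨e, f', hae, hf1, ?_⟩
    have : n * j < n * (e + f') := by rw [mul_add]; omega
    have := Nat.lt_of_mul_lt_mul_left this
    omega
  by_cases hr : r = 0
  · subst hr
    rw [add_zero] at hpr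
    subst hpr
    obtain ⟨e', he1, he2⟩ := ha p hl
    refine ⟨e', f, he1, hbf, ?_⟩
    have : n * j < n * (e' + f) := by rw [mul_add]; omega
    have := Nat.lt_of_mul_lt_mul_left this
    omega
  obtain ⟨e', he1, he2⟩ := ha p hp
  obtain ⟨f', hf1, hf2⟩ := hb r hr
  refine ⟨e', f', he1, hf1, ?_⟩
  obtain ⟨c, hc, hc'⟩ := carry_eq (k := k) p r
  rw [hpr] at hc'
  rw [hc]
  have hck : c ≤ k * c := Nat.le_mul_of_pos_left _ (Nat.pos_of_ne_zero (NeZero.ne k))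
  have : n * j < n * (e' + f' + c) := by rw [mul_add, mul_add]; omega
  have := Nat.lt_of_mul_lt_mul_left this
  omega

/-- Weights in the constant term: `τ^i τ^(n-i) = π^k` with `i ≠ 0` turns the total weight
`n * (e + f + 1)` of `π^e τ^i` and `π^f τ^(n-i)` into `π^(e + f + k)`. -/
lemma dvd_coeff_zero_mul_sub {w w' m : ℕ} {a b : TwistedOrder D k} (ha : OffWeight w a)
    (hb : OffWeight w' b) (hm : m = 0 ∨ n * m < w + w') :
    D.π ^ (m + k) ∣ (a * b).coeff 0 - a.coeff 0 * b.coeff 0 := by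
  classical
  rw [coeff_mul, ← Finset.add_sum_erase _ _ (Finset.mem_univ (0 : Fin n))]
  simp only [sub_zero, carry_zero_left, pow_zero, mul_one, Fin.val_zero]
  rw [RingAut.one_apply, add_sub_cancel_left]
  refine Finset.dvd_sum fun p hp => ?_
  have hp : p ≠ 0 := Finset.ne_of_mem_erase hp
  rw [zero_sub]
  obtain ⟨e, he, he'⟩ := ha p hp
  obtain ⟨f, hf, hf'⟩ := hb (-p) (neg_ne_zero.mpr hp)
  refine (pow_dvd_pow _ ?_).trans (dvd_term he hf)
  rw [carry_neg hp]
  rcases hm with rfl | hm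
  · omega
  · have h1 := val_add_val_neg hp
    have : n * m < n * (e + f + 1) := by rw [mul_add, mul_add]; omega
    have := Nat.lt_of_mul_lt_mul_left this
    omega

lemma mem_truncIdeal_of_offWeight {h : ℕ} {a : TwistedOrder D k}
    (ha : OffWeight (n * (h - k)) a) (h0 : D.π ^ h ∣ a.coeff 0) : a ∈ truncIdeal D k h := by
  intro i
  split_ifs with hi
  · exact hi ▸ h0
  · exact ha.dvd hi le_rfl

lemma dvd_coeff_zero_of_mem {h : ℕ} {a : TwistedOrder D k} (ha : a ∈ truncIdeal D k h) :
    D.π ^ h ∣ a.coeff 0 := by simpa using ha 0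

lemma dvd_coeff_of_mem {h : ℕ} {a : TwistedOrder D k} (ha : a ∈ truncIdeal D k h) {i : Fin n}
    (hi : i ≠ 0) : D.π ^ (h - k) ∣ a.coeff i := by simpa [hi] using ha i

lemma const_mem_truncIdeal {h : ℕ} {x : O} (hx : D.π ^ h ∣ x) : const D k x ∈ truncIdeal D k h :=
  mem_truncIdeal_of_offWeight (offWeight_const _ _) (by rwa [coeff_const_zero])

lemma mul_mem_truncIdeal {h w w' : ℕ} {a b : TwistedOrder D k} (ha : OffWeight w a)
    (hb : OffWeight w' b) (hw : n * (h - k) < w + w') (ha0 : a.coeff 0 = 0)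
    (hb0 : b.coeff 0 = 0) : a * b ∈ truncIdeal D k h := by
  have hn : 0 < n := Nat.pos_of_ne_zero (NeZero.ne n)
  refine mem_truncIdeal_of_offWeight (ha.mul hb (Or.inl hw.le) (e := n * (h - k))
    (f := n * (h - k)) (by simp [ha0]) ?_ (by simp [hb0]) ?_) ?_
  · have := Nat.le_mul_of_pos_left (n * (h - k)) hn; omega
  · have := Nat.le_mul_of_pos_left (n * (h - k)) hn; omega
  · have := dvd_coeff_zero_mul_sub ha hb (Or.inr hw)
    rw [ha0, zero_mul, sub_zero] at this
    exact (pow_dvd_pow _ (by omega)).trans this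

end Weights

section Units

variable [NeZero k] {h : ℕ}

/-- The element `1 + x` of the unipotent group, for `x` with `π ∣ x_0`. -/
noncomputable def unipMk (h : ℕ) (x : TwistedOrder D k) (hx : D.π ∣ x.coeff 0) : unip D k h :=
  have hu : IsUnit (cls h (1 + x)) := by
    change IsUnit (Ideal.Quotient.mk (truncIdeal D k h) (1 + x))
    rw [map_add, map_one]
    refine IsNilpotent.isUnit_one_add ⟨n + n * h, ?_⟩
    rw [← map_pow]
    exact Ideal.Quotient.eq_zero_iff_mem.mpr (pow_mem_truncIdeal h hx)
  ⟨hu.unit, x, hx, hu.unit_spec⟩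

lemma coe_unipMk (x : TwistedOrder D k) (hx : D.π ∣ x.coeff 0) :
    ((unipMk h x hx : (TruncRing D k h)ˣ) : TruncRing D k h) = cls h (1 + x) :=
  IsUnit.unit_spec _

lemma unip_ext {u v : unip D k h} (huv : ((u : (TruncRing D k h)ˣ) : TruncRing D k h) =
    ((v : (TruncRing D k h)ˣ) : TruncRing D k h)) : u = v := Subtype.ext (Units.ext huv)

lemma unipMk_eq_iff {x y : TwistedOrder D k} (hx : D.π ∣ x.coeff 0) (hy : D.π ∣ y.coeff 0) :
    unipMk h x hx = unipMk h y hy ↔ x - y ∈ truncIdeal D k h := by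
  rw [← Ideal.Quotient.eq]
  constructor
  · intro H
    have := congrArg (fun u : unip D k h => ((u : (TruncRing D k h)ˣ) : TruncRing D k h)) H
    simpa only [coe_unipMk, map_add, add_right_inj] using this
  · intro H
    refine unip_ext ?_
    rw [coe_unipMk, coe_unipMk]
    change Ideal.Quotient.mk (truncIdeal D k h) (1 + x) =
      Ideal.Quotient.mk (truncIdeal D k h) (1 + y)
    rw [map_add, map_add, H]

lemma exists_unipMk (u : unip D k h) :
    ∃ (x : TwistedOrder D k) (hx : D.π ∣ x.coeff 0), u = unipMk h x hx := by
  obtain ⟨x, hx, hu⟩ := u.2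
  exact ⟨x, hx, unip_ext (hu.trans (coe_unipMk _ _).symm)⟩

lemma dvd_add_mul {x y : TwistedOrder D k} (hx : D.π ∣ x.coeff 0) (hy : D.π ∣ y.coeff 0) :
    D.π ∣ (x + y + x * y).coeff 0 :=
  dvd_add (dvd_add hx hy) (pi_dvd_mul_zero hx)

lemma unipMk_mul {x y : TwistedOrder D k} (hx : D.π ∣ x.coeff 0) (hy : D.π ∣ y.coeff 0) :
    unipMk h x hx * unipMk h y hy = unipMk h (x + y + x * y) (dvd_add_mul hx hy) := by
  refine unip_ext ?_
  rw [Subgroup.coe_mul, Units.val_mul, coe_unipMk, coe_unipMk, coe_unipMk, ← map_mul]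
  congr 1
  noncomm_ring

lemma unipMk_zero : unipMk h (0 : TwistedOrder D k) (by simp) = 1 :=
  unip_ext (by rw [coe_unipMk]; simp)

lemma mem_subgroupOf_iff {J : NonUnitalSubring (TwistedOrder D k)} (hJ : J ≤ jUnip D k)
    {u : unip D k h} : u ∈ (oneAdd h J hJ).subgroupOf (unip D k h) ↔
      ∃ (x : TwistedOrder D k) (hx : D.π ∣ x.coeff 0), x ∈ J ∧ u = unipMk h x hx := by
  rw [Subgroup.mem_subgroupOf]
  constructor
  · rintro ⟨x, hx, hu⟩
    exact ⟨x, hJ hx, hx, unip_ext (hu.trans (coe_unipMk _ _).symm)⟩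
  · rintro ⟨x, -, hx, rfl⟩
    exact ⟨x, hx, coe_unipMk _ _⟩

lemma represents_unipMk_iff {a x : TwistedOrder D k} (hx : D.π ∣ x.coeff 0) :
    Represents a (unipMk h x hx) ↔ a - (1 + x) ∈ truncIdeal D k h := by
  rw [Represents, coe_unipMk, Ideal.Quotient.eq]

lemma commute_mod_iff {x y z : TwistedOrder D k} (hx : D.π ∣ x.coeff 0) (hy : D.π ∣ y.coeff 0)
    (hz : D.π ∣ z.coeff 0) :
    unipMk h x hx * unipMk h y hy = unipMk h y hy * unipMk h x hx * unipMk h z hz ↔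
      (x * y - y * x) - (z + (y + x + y * x) * z) ∈ truncIdeal D k h := by
  rw [unipMk_mul, unipMk_mul, unipMk_mul, unipMk_eq_iff]
  refine iff_of_eq (congrArg (· ∈ _) ?_)
  abel

lemma commute_of_mem {x y : TwistedOrder D k} (hx : D.π ∣ x.coeff 0) (hy : D.π ∣ y.coeff 0)
    (hxy : x * y - y * x ∈ truncIdeal D k h) :
    unipMk h x hx * unipMk h y hy = unipMk h y hy * unipMk h x hx := by
  have := (commute_mod_iff (h := h) hx hy (z := 0) (by simp)).mpr (by simpa using hxy)
  rwa [unipMk_zero, mul_one] at this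

end Units

end TwistedOrder

/-! ### The subgroups `H`, `H'`, `H⁺` and the constant part -/

namespace TwistedOrder

variable {O : Type*} [CommRing O] {n : ℕ} {D : CyclicData O n} {k h : ℕ} [NeZero n] [NeZero k]

section Subgroups

lemma mem_jPrime_iff {a : TwistedOrder D k} :
    a ∈ jPrime D k h ↔ D.π ∣ a.coeff 0 ∧ OffWeight (n * (h - k) / 2 + 1) a := by
  rw [offWeight_iff]
  refine and_congr_right fun _ => forall_congr' fun i => forall_congr' fun j =>
    forall_congr' fun hi => ?_
  have hi0 : (i : ℕ) ≠ 0 := fun h => hi (Fin.ext h)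
  rw [le_level_iff]
  refine imp_congr_left ?_
  rcases le_total k h with hk | hk
  · obtain ⟨d, rfl⟩ := Nat.exists_eq_add_of_le hk
    rw [Nat.add_sub_cancel_left, mul_add, mul_assoc]
    omega
  · have := Nat.mul_le_mul_left n hk
    rw [Nat.sub_eq_zero_of_le hk, mul_zero, mul_assoc]
    omega

lemma mem_jPlus_iff {a : TwistedOrder D k} :
    a ∈ jPlus D k h ↔ D.π ∣ a.coeff 0 ∧ OffWeight ((n * (h - k) + 1) / 2) a ∧
      ∀ (i : Fin n) (j : ℕ), 2 * (i : ℕ) = n → 2 * j + 1 + k = h →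
        ∃ b, a.coeff i = D.π ^ j * b ∧ D.π ∣ (D.φ ^ (n / 2)) b - b := by
  rw [offWeight_iff]
  refine and_congr_right fun _ => and_congr_left fun _ => forall_congr' fun i =>
    forall_congr' fun j => forall_congr' fun hi => ?_
  have hi0 : (i : ℕ) ≠ 0 := fun h => hi (Fin.ext h)
  rw [lt_level_iff]
  refine imp_congr_left ?_
  rcases le_total k h with hk | hk
  · obtain ⟨d, rfl⟩ := Nat.exists_eq_add_of_le hk
    rw [Nat.add_sub_cancel_left, mul_add, mul_assoc]
    omega
  · have := Nat.mul_le_mul_left n hk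
    rw [Nat.sub_eq_zero_of_le hk, mul_zero, mul_assoc]
    omega

lemma mem_subHPrime_iff {u : unip D k h} : u ∈ subHPrime D k h ↔
    ∃ (x : TwistedOrder D k) (hx : D.π ∣ x.coeff 0),
      OffWeight (n * (h - k) / 2 + 1) x ∧ u = unipMk h x hx := by
  refine (mem_subgroupOf_iff _).trans ?_
  simp only [mem_jPrime_iff]
  grind

lemma mem_subHPlus_iff {u : unip D k h} : u ∈ subHPlus D k h ↔
    ∃ (x : TwistedOrder D k) (hx : D.π ∣ x.coeff 0), x ∈ jPlus D k h ∧ u = unipMk h x hx :=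
  mem_subgroupOf_iff _

lemma subHPrime_le_subHPlus : subHPrime D k h ≤ subHPlus D k h := by
  intro u hu
  obtain ⟨x, hx, hxw, rfl⟩ := mem_subHPrime_iff.mp hu
  refine mem_subHPlus_iff.mpr ⟨x, hx, mem_jPlus_iff.mpr ⟨hx, hxw.mono (by omega), ?_⟩, rfl⟩
  intro i j hi hj
  have hi0 : i ≠ 0 := by
    rintro rfl
    exact NeZero.ne n (by simpa using hi.symm)
  obtain ⟨y, hy⟩ := hxw.dvd_of_lt hi0 (j := j) (by
    obtain rfl : h = 2 * j + 1 + k := hj.symm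
    rw [Nat.add_sub_cancel, mul_add, mul_left_comm]
    omega)
  refine ⟨D.π * y, by rw [hy, pow_succ, mul_assoc], ?_⟩
  rw [map_mul, phi_pow_pi, ← mul_sub]
  exact dvd_mul_right _ _

lemma mem_subH_iff {u : unip D k h} : u ∈ subH D k h ↔
    ∃ (x : O) (hx : D.π ∣ (const D k x).coeff 0), u = unipMk h (const D k x) hx := by
  refine (mem_subgroupOf_iff _).trans ?_
  constructor
  · rintro ⟨x, hx, hx', rfl⟩
    have : x = const D k (x.coeff 0) := by
      ext i
      by_cases hi : i = 0
      · rw [hi, coeff_const_zero]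
      · rw [hx'.2.2 i hi, coeff_const_ne hi]
    exact ⟨x.coeff 0, this ▸ hx, (unipMk_eq_iff _ _).mpr (by
      rw [← this, sub_self]; exact Ideal.zero_mem _)⟩
  · rintro ⟨x, hx, rfl⟩
    exact ⟨_, hx, ⟨hx, by simpa using hx, fun i hi => coeff_const_ne hi _⟩, rfl⟩

lemma subH_le_subHPrime : subH D k h ≤ subHPrime D k h := by
  intro u hu
  obtain ⟨x, hx, rfl⟩ := mem_subH_iff.mp hu
  exact mem_subHPrime_iff.mpr ⟨_, hx, offWeight_const _ _, rfl⟩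

/-- The elements `a` with `π ∣ a_0` whose other coefficients have weight at least `w`. -/
def jLevel (D : CyclicData O n) (k w : ℕ) [NeZero k] : NonUnitalSubring (TwistedOrder D k) where
  carrier := {a | D.π ∣ a.coeff 0 ∧ OffWeight w a}
  zero_mem' := ⟨dvd_zero _, fun i _ => ⟨w, dvd_zero _, by
    have := Nat.le_mul_of_pos_left w (Nat.pos_of_ne_zero (NeZero.ne n)); omega⟩⟩
  add_mem' := fun ha hb => ⟨dvd_add ha.1 hb.1, ha.2.add hb.2⟩
  neg_mem' := fun ha => ⟨(dvd_neg (α := O)).mpr ha.1, ha.2.neg⟩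
  mul_mem' := fun ha hb => ⟨pi_dvd_mul_zero ha.1,
    ha.2.mul hb.2 (Or.inl (Nat.le_add_right _ _)) (e := 0) (f := 0) (by simp) (by simp) (by simp)
      (by simp)⟩

/-- The group of classes of `1 + a` with `a ∈ jLevel D k w`. -/
def levelSub (D : CyclicData O n) (k h w : ℕ) [NeZero k] : Subgroup (unip D k h) :=
  (oneAdd h (jLevel D k w) fun _ hx => hx.1).subgroupOf _

lemma mem_levelSub_iff {w : ℕ} {u : unip D k h} : u ∈ levelSub D k h w ↔
    ∃ (x : TwistedOrder D k) (hx : D.π ∣ x.coeff 0), OffWeight w x ∧ u = unipMk h x hx := by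
  refine (mem_subgroupOf_iff _).trans ?_
  exact ⟨fun ⟨x, hx, hx', hu⟩ => ⟨x, hx, hx'.2, hu⟩, fun ⟨x, hx, hx', hu⟩ => ⟨x, hx, ⟨hx, hx'⟩, hu⟩⟩

lemma subHPlus_le_levelSub : subHPlus D k h ≤ levelSub D k h ((n * (h - k) + 1) / 2) := by
  intro u hu
  obtain ⟨x, hx, hx', rfl⟩ := mem_subHPlus_iff.mp hu
  exact mem_levelSub_iff.mpr ⟨x, hx, (mem_jPlus_iff.mp hx').2.1, rfl⟩

/-- A constant term divisible by `π^h` can be replaced by `0` without changing the class. -/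
lemma unipMk_eq_of_coeff_zero {x : TwistedOrder D k} (hx : D.π ∣ x.coeff 0)
    (hx0 : D.π ^ h ∣ x.coeff 0) :
    ∃ (y : TwistedOrder D k) (hy : D.π ∣ y.coeff 0), y.coeff 0 = 0 ∧
      (∀ i ≠ 0, y.coeff i = x.coeff i) ∧ unipMk h x hx = unipMk h y hy := by
  have h0 : (x - const D k (x.coeff 0)).coeff 0 = 0 := by
    rw [coeff_sub, coeff_const_zero, sub_self]
  refine ⟨x - const D k (x.coeff 0), by rw [h0]; exact dvd_zero _, h0, fun i hi => ?_, ?_⟩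
  · rw [coeff_sub, coeff_const_ne hi, sub_zero]
  · rw [unipMk_eq_iff, sub_sub_cancel]
    exact const_mem_truncIdeal hx0

/-- The elements `a` with `π^h ∣ a_0` and all other weights above `n (h - k) / 2 + m`; the separate
condition `π ∣ a_0` only matters for `h = 0`. -/
def jOff (D : CyclicData O n) (k h m : ℕ) [NeZero k] : NonUnitalSubring (TwistedOrder D k) where
  carrier := {a | D.π ∣ a.coeff 0 ∧ D.π ^ h ∣ a.coeff 0 ∧ OffWeight (n * (h - k) / 2 + 1 + m) a}
  zero_mem' := ⟨dvd_zero _, dvd_zero _, ((jLevel D k _).zero_mem).2⟩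
  add_mem' := fun ha hb => ⟨dvd_add ha.1 hb.1, dvd_add ha.2.1 hb.2.1, ha.2.2.add hb.2.2⟩
  neg_mem' := fun ha => ⟨(dvd_neg (α := O)).mpr ha.1, (dvd_neg (α := O)).mpr ha.2.1, ha.2.2.neg⟩
  mul_mem' := fun {a b} ha hb => ⟨pi_dvd_mul_zero ha.1, by
    have h1 := dvd_coeff_zero_mul_sub ha.2.2 hb.2.2 (m := h - k) (by right; omega)
    have h2 := (pow_dvd_pow D.π (show h ≤ h - k + k by omega)).trans h1
    exact (dvd_sub_left (ha.2.1.mul_right _)).mp h2,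
    ((jLevel D k _).mul_mem ⟨ha.1, ha.2.2⟩ ⟨hb.1, hb.2.2⟩).2⟩

/-- The group of classes of `1 + a` with `a_0 = 0` and weights above `n (h - k) / 2 + m`. -/
def offSub (D : CyclicData O n) (k h m : ℕ) [NeZero k] : Subgroup (unip D k h) :=
  (oneAdd h (jOff D k h m) fun _ hx => hx.1).subgroupOf _

lemma mem_offSub_iff {m : ℕ} {u : unip D k h} : u ∈ offSub D k h m ↔
    ∃ (x : TwistedOrder D k) (hx : D.π ∣ x.coeff 0), x.coeff 0 = 0 ∧
      OffWeight (n * (h - k) / 2 + 1 + m) x ∧ u = unipMk h x hx := by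
  refine (mem_subgroupOf_iff _).trans ?_
  constructor
  · rintro ⟨x, hx, hx', rfl⟩
    obtain ⟨y, hy, hy0, hy', hxy⟩ := unipMk_eq_of_coeff_zero hx hx'.2.1
    exact ⟨y, hy, hy0, fun i hi => by rw [hy' i hi]; exact hx'.2.2 i hi, hxy⟩
  · rintro ⟨x, hx, hx0, hxw, rfl⟩
    exact ⟨x, hx, ⟨hx, by rw [hx0]; exact dvd_zero _, hxw⟩, rfl⟩

lemma offSub_anti {m m' : ℕ} (hm : m ≤ m') : offSub D k h m' ≤ offSub D k h m := by
  intro u hu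
  obtain ⟨x, hx, hx0, hxw, rfl⟩ := mem_offSub_iff.mp hu
  exact mem_offSub_iff.mpr ⟨x, hx, hx0, hxw.mono (by omega), rfl⟩

lemma offSub_eq_bot {m : ℕ} (hm : n * (h - k) ≤ n * (h - k) / 2 + 1 + m) : offSub D k h m = ⊥ := by
  rw [eq_bot_iff]
  intro u hu
  obtain ⟨x, hx, hx0, hxw, rfl⟩ := mem_offSub_iff.mp hu
  rw [Subgroup.mem_bot, ← unipMk_zero, unipMk_eq_iff, sub_zero]
  exact mem_truncIdeal_of_offWeight (hxw.mono hm) (by rw [hx0]; exact dvd_zero _)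

lemma offSub_le_subHPrime {m : ℕ} : offSub D k h m ≤ subHPrime D k h := by
  intro u hu
  obtain ⟨x, hx, hx0, hxw, rfl⟩ := mem_offSub_iff.mp hu
  exact mem_subHPrime_iff.mpr ⟨x, hx, hxw.mono (by omega), rfl⟩

/-- Every element is `(1 + a) t` with `a_0 = 0` and `t` constant. -/
lemma exists_eq_mul_subH {x : TwistedOrder D k} (hx : D.π ∣ x.coeff 0) {w : ℕ}
    (hxw : OffWeight w x) :
    ∃ t ∈ subH D k h, ∃ (a : TwistedOrder D k) (ha : D.π ∣ a.coeff 0), a.coeff 0 = 0 ∧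
      OffWeight w a ∧ unipMk h x hx = unipMk h a ha * t := by
  have hc : D.π ∣ (const D k (x.coeff 0)).coeff 0 := by rwa [coeff_const_zero]
  have ht : unipMk h (const D k (x.coeff 0)) hc ∈ subH D k h := mem_subH_iff.mpr ⟨_, hc, rfl⟩
  obtain ⟨y, hy, hy'⟩ := mem_subH_iff.mp (inv_mem ht)
  have h1 := mul_inv_cancel (unipMk h (const D k (x.coeff 0)) hc)
  rw [hy', unipMk_mul, ← unipMk_zero, unipMk_eq_iff, sub_zero] at h1
  have h2 := dvd_coeff_zero_of_mem h1
  have h3 : unipMk h x hx * (unipMk h (const D k (x.coeff 0)) hc)⁻¹ =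
      unipMk h (x + const D k y + x * const D k y) (dvd_add_mul hx hy) := by
    rw [hy', unipMk_mul]
  obtain ⟨a, ha, ha0, ha', h4⟩ := unipMk_eq_of_coeff_zero (h := h) (dvd_add_mul hx hy) (by
    rw [coeff_add, coeff_add, coeff_const_zero, coeff_mul_const] at *
    simpa [coeff_const_zero] using h2)
  refine ⟨_, ht, a, ha, ha0, fun i hi => ?_, ?_⟩
  · obtain ⟨e, he, he'⟩ := hxw i hi
    refine ⟨e, ?_, he'⟩
    rw [ha' i hi, coeff_add, coeff_add, coeff_const_ne hi, coeff_mul_const]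
    exact dvd_add (dvd_add he (dvd_zero _)) (he.mul_right _)
  · rw [← h4, ← h3, inv_mul_cancel_right]

end Subgroups

section ConstPart

lemma exists_constPart (u : unip D k h) : ∃ t : subH D k h, ∀ (x : TwistedOrder D k)
    (hx : D.π ∣ x.coeff 0), u = unipMk h x hx →
      (t : unip D k h) = unipMk h (const D k (x.coeff 0)) (by rwa [coeff_const_zero]) := by
  obtain ⟨x, hx, rfl⟩ := exists_unipMk u
  refine ⟨⟨unipMk h (const D k (x.coeff 0)) (by rwa [coeff_const_zero]),
    mem_subH_iff.mpr ⟨_, _, rfl⟩⟩, fun y hy hxy => ?_⟩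
  rw [unipMk_eq_iff] at hxy ⊢
  have := dvd_coeff_zero_of_mem hxy
  refine mem_truncIdeal_of_offWeight ((offWeight_const _ _).sub (offWeight_const _ _)) ?_
  rwa [coeff_sub, coeff_const_zero, coeff_const_zero]

/-- The map `∑ A_i τ^i ↦ A_0` from the unipotent group to `H`. -/
noncomputable def constPart (u : unip D k h) : subH D k h := (exists_constPart u).choose

lemma constPart_unipMk {x : TwistedOrder D k} (hx : D.π ∣ x.coeff 0) :
    (constPart (unipMk h x hx) : unip D k h) =
      unipMk h (const D k (x.coeff 0)) (by rwa [coeff_const_zero]) :=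
  (exists_constPart (unipMk h x hx)).choose_spec x hx rfl

lemma constPart_subH (t : subH D k h) : constPart (t : unip D k h) = t := by
  obtain ⟨x, hx, ht⟩ := mem_subH_iff.mp t.2
  ext1
  rw [ht, constPart_unipMk, unipMk_eq_iff, coeff_const_zero, sub_self]
  exact Ideal.zero_mem _

lemma constPart_eq_iff {x y : TwistedOrder D k} (hx : D.π ∣ x.coeff 0) (hy : D.π ∣ y.coeff 0) :
    constPart (unipMk h x hx) = constPart (unipMk h y hy) ↔
      D.π ^ h ∣ x.coeff 0 - y.coeff 0 := by
  rw [← Subtype.coe_inj, constPart_unipMk, constPart_unipMk, unipMk_eq_iff]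
  constructor
  · intro H
    simpa [coeff_const_zero] using dvd_coeff_zero_of_mem H
  · intro H
    exact mem_truncIdeal_of_offWeight ((offWeight_const _ _).sub (offWeight_const _ _))
      (by rwa [coeff_sub, coeff_const_zero, coeff_const_zero])

lemma constPart_mul {w w' : ℕ} (hw : n * (h - k) < w + w') {x y : TwistedOrder D k}
    (hx : D.π ∣ x.coeff 0) (hy : D.π ∣ y.coeff 0) (hxw : OffWeight w x) (hyw : OffWeight w' y) :
    constPart (unipMk h x hx * unipMk h y hy) =
      constPart (unipMk h x hx) * constPart (unipMk h y hy) := by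
  ext1
  rw [Subgroup.coe_mul, unipMk_mul, constPart_unipMk, constPart_unipMk, constPart_unipMk,
    unipMk_mul, unipMk_eq_iff]
  refine mem_truncIdeal_of_offWeight (((offWeight_const _ _)).sub
    (((offWeight_const _ _).add (offWeight_const _ _)).add fun i hi => ?_)) ?_
  · rw [coeff_const_mul]
    exact (offWeight_const (n * (h - k)) _ i hi).imp fun e he => ⟨he.1.mul_left _, he.2⟩
  · have := dvd_coeff_zero_mul_sub hxw hyw (Or.inr hw)
    simp only [coeff_sub, coeff_add, coeff_const_zero, coeff_const_mul]
    refine (pow_dvd_pow _ (show h ≤ h - k + k by omega)).trans ?_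
    convert this using 1
    ring

lemma constPart_mul_of_mem {u v : unip D k h} (hu : u ∈ subHPrime D k h)
    (hv : v ∈ subHPrime D k h) : constPart (u * v) = constPart u * constPart v := by
  obtain ⟨x, hx, hxw, rfl⟩ := mem_subHPrime_iff.mp hu
  obtain ⟨y, hy, hyw, rfl⟩ := mem_subHPrime_iff.mp hv
  exact constPart_mul (by omega) hx hy hxw hyw

variable {F : Type*} [Field F]

/-- The character `χ^♯(∑ A_i τ^i) = χ(A_0)` of `H'`. -/
noncomputable def sharp (χ : subH D k h →* Fˣ) : subHPrime D k h →* Fˣ :=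
  MonoidHom.mk' (fun u => χ (constPart (u : unip D k h))) fun u v => by
    rw [Subgroup.coe_mul, constPart_mul_of_mem u.2 v.2, map_mul]

lemma extendsSharp_iff [NeZero h] {χ : subH D k h →* Fˣ} {χt : subHPlus D k h →* Fˣ} :
    ExtendsSharp χ χt ↔ ∀ u : subHPlus D k h, (u : unip D k h) ∈ subHPrime D k h →
      χt u = χ (constPart (u : unip D k h)) := by
  constructor
  · intro H u hu
    obtain ⟨x, hx, hxu⟩ := exists_unipMk (u : unip D k h)
    refine H u _ (1 + x) hu ?_ ?_
    · rw [hxu, represents_unipMk_iff, sub_self]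
      exact Ideal.zero_mem _
    · rw [hxu, constPart_unipMk, represents_unipMk_iff]
      refine mem_truncIdeal_of_offWeight (fun i hi => ⟨n * (h - k), ?_, ?_⟩) ?_
      · simp [coeff_one, hi, coeff_const_ne hi]
      · have := Nat.le_mul_of_pos_left (n * (h - k)) (Nat.pos_of_ne_zero (NeZero.ne n))
        omega
      · simp [coeff_const_zero, coeff_one]
  · intro H u v a hu ha hv
    rw [H u hu]
    congr 1
    obtain ⟨x, hx, hxu⟩ := exists_unipMk (u : unip D k h)
    obtain ⟨y, hy, hyv⟩ := exists_unipMk (v : unip D k h)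
    rw [hxu, represents_unipMk_iff] at ha
    rw [hyv, represents_unipMk_iff] at hv
    rw [← constPart_subH v, hyv, hxu, constPart_eq_iff]
    have h1 := dvd_coeff_zero_of_mem ha
    have h2 := dvd_coeff_zero_of_mem hv
    rw [coeff_sub, coeff_add] at h1 h2
    rw [coeff_const_zero] at h2
    have := dvd_sub h2 h1
    convert this using 1
    ring

end ConstPart

end TwistedOrder

/-! ### The last layer, commutators and the extension of `χ^♯` -/

namespace TwistedOrder

variable {O : Type*} [CommRing O] {n : ℕ} {D : CyclicData O n} {k h : ℕ} [NeZero n] [NeZero k]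

section Commutators

/-- The element `1 + π^(h-1) γ`; the exponent is written so that it is positive also for `h = 1`,
when the element is trivial. -/
noncomputable def layer (D : CyclicData O n) (k h : ℕ) [NeZero k] (γ : O) : unip D k h :=
  unipMk h (const D k (D.π ^ (h - 2 + 1) * γ)) (by
    rw [coeff_const_zero, pow_succ, mul_assoc]
    exact (dvd_mul_right _ _).mul_left _)

lemma dvd_layer (γ : O) : D.π ∣ (const D k (D.π ^ (h - 2 + 1) * γ)).coeff 0 := by
  rw [coeff_const_zero, pow_succ, mul_assoc]
  exact (dvd_mul_right _ _).mul_left _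

lemma layer_mem_subH (γ : O) : layer D k h γ ∈ subH D k h := mem_subH_iff.mpr ⟨_, _, rfl⟩

lemma mem_lastLayer_iff {u : unip D k h} : u ∈ lastLayer D k h ↔ ∃ γ, u = layer D k h γ := by
  refine (mem_subgroupOf_iff _).trans ?_
  constructor
  · rintro ⟨x, hx, hx', rfl⟩
    obtain ⟨γ, hγ⟩ : D.π ^ (h - 2 + 1) ∣ x.coeff 0 := by
      rcases Nat.lt_or_ge h 2 with hh | hh
      · rw [show h - 2 + 1 = 1 by omega, pow_one]
        exact hx
      · rw [show h - 2 + 1 = h - 1 by omega]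
        exact hx'.2.1
    refine ⟨γ, (unipMk_eq_iff _ _).mpr ?_⟩
    convert Ideal.zero_mem _
    ext i
    by_cases hi : i = 0
    · rw [hi, coeff_sub, coeff_const_zero, hγ, sub_self, coeff_zero]
    · rw [coeff_sub, hx'.2.2 i hi, coeff_const_ne hi, sub_self, coeff_zero]
  · rintro ⟨γ, rfl⟩
    refine ⟨_, dvd_layer γ, ⟨dvd_layer γ, ?_, fun i hi => coeff_const_ne hi _⟩, rfl⟩
    rw [coeff_const_zero]
    exact (pow_dvd_pow _ (by omega)).mul_right _

lemma const_add (x y : O) : const D k (x + y) = const D k x + const D k y := by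
  ext i
  by_cases hi : i = 0
  · simp [hi, coeff_const_zero]
  · simp [coeff_const_ne hi]

/-- Multiples of `π^(h-1)` in degree `0` are killed by all `y` with `π ∣ y_0`. -/
lemma mul_layer_mem {y : TwistedOrder D k} (hy : D.π ∣ y.coeff 0) (γ : O) :
    y * const D k (D.π ^ (h - 2 + 1) * γ) ∈ truncIdeal D k h := by
  have hk := Nat.pos_of_ne_zero (NeZero.ne k)
  intro i
  rw [coeff_mul_const, map_mul, map_pow, phi_pow_pi]
  split_ifs with hi
  · subst hi
    refine (pow_dvd_pow _ (show h ≤ 1 + (h - 2 + 1) by omega)).trans ?_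
    rw [pow_add, pow_one]
    exact mul_dvd_mul hy (dvd_mul_right _ _)
  · exact ((pow_dvd_pow _ (by omega)).mul_right _).mul_left _

lemma layer_mul_mem {y : TwistedOrder D k} (hy : D.π ∣ y.coeff 0) (γ : O) :
    const D k (D.π ^ (h - 2 + 1) * γ) * y ∈ truncIdeal D k h := by
  have hk := Nat.pos_of_ne_zero (NeZero.ne k)
  intro i
  rw [coeff_const_mul]
  split_ifs with hi
  · subst hi
    refine (pow_dvd_pow _ (show h ≤ (h - 2 + 1) + 1 by omega)).trans ?_
    rw [pow_add, pow_one]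
    exact mul_dvd_mul (dvd_mul_right _ _) hy
  · exact ((pow_dvd_pow _ (by omega)).mul_right _).mul_right _

lemma layer_add (γ δ : O) : layer D k h (γ + δ) = layer D k h γ * layer D k h δ := by
  rw [layer, layer, layer, unipMk_mul, unipMk_eq_iff, mul_add, const_add, sub_add_cancel_left]
  exact neg_mem (layer_mul_mem (dvd_layer δ) γ)

lemma layer_eq_one {γ : O} (hγ : D.π ∣ γ) : layer D k h γ = 1 := by
  rw [layer, ← unipMk_zero, unipMk_eq_iff, sub_zero]
  refine const_mem_truncIdeal ?_
  refine (pow_dvd_pow _ (show h ≤ (h - 2 + 1) + 1 by omega)).trans ?_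
  rw [pow_succ]
  exact mul_dvd_mul_left _ hγ

lemma layer_congr {γ δ : O} (hγ : D.π ∣ γ - δ) : layer D k h γ = layer D k h δ := by
  rw [← sub_add_cancel γ δ, layer_add, layer_eq_one hγ, one_mul]

lemma layer_mul_comm (γ : O) (u : unip D k h) : layer D k h γ * u = u * layer D k h γ := by
  obtain ⟨x, hx, rfl⟩ := exists_unipMk u
  exact commute_of_mem _ _ (sub_mem (layer_mul_mem hx γ) (mul_layer_mem hx γ))

lemma lastLayer_le_center : lastLayer D k h ≤ Subgroup.center (unip D k h) := by
  intro u hu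
  obtain ⟨γ, rfl⟩ := mem_lastLayer_iff.mp hu
  exact Subgroup.mem_center_iff.mpr fun v => (layer_mul_comm γ v).symm

lemma lastLayer_le_subH : lastLayer D k h ≤ subH D k h := by
  intro u hu
  obtain ⟨γ, rfl⟩ := mem_lastLayer_iff.mp hu
  exact layer_mem_subH γ

/-- If the weights of `a` and `b` add up to at least `n (h - k)`, then the commutator of `1 + a`
and `1 + b` lies in the last layer and is given by the constant term of `ab - ba`. -/
lemma commutator_eq_layer {w w' : ℕ} {a b : TwistedOrder D k} (ha : D.π ∣ a.coeff 0)
    (hb : D.π ∣ b.coeff 0) (ha0 : a.coeff 0 = 0) (hb0 : b.coeff 0 = 0) (haw : OffWeight w a)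
    (hbw : OffWeight w' b) (hw : n * (h - k) ≤ w + w') {γ : O}
    (hγ : (a * b).coeff 0 - (b * a).coeff 0 = D.π ^ (h - 2 + 1) * γ) :
    unipMk h a ha * unipMk h b hb = unipMk h b hb * unipMk h a ha * layer D k h γ := by
  have hn : 0 < n := Nat.pos_of_ne_zero (NeZero.ne n)
  rw [layer, commute_mod_iff, ← sub_sub]
  refine sub_mem (mem_truncIdeal_of_offWeight ?_ ?_) (mul_layer_mem (dvd_add_mul hb ha) γ)
  · have h1 := Nat.le_mul_of_pos_left (n * (h - k)) hn
    refine OffWeight.sub (OffWeight.sub ?_ ?_) (offWeight_const _ _)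
    · exact haw.mul hbw (Or.inl hw) (e := n * (h - k)) (f := n * (h - k)) (by simp [ha0])
        (by omega) (by simp [hb0]) (by omega)
    · exact hbw.mul haw (Or.inl (by omega)) (e := n * (h - k)) (f := n * (h - k)) (by simp [hb0])
        (by omega) (by simp [ha0]) (by omega)
  · rw [coeff_sub, coeff_sub, hγ, coeff_const_zero, sub_self]
    exact dvd_zero _

lemma phi_pow_neg (i : Fin n) (x : O) :
    (D.φ ^ ((-i : Fin n) : ℕ)) ((D.φ ^ (i : ℕ)) x) = x := by
  rw [← phi_pow_add, neg_add_cancel]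
  rfl

lemma phi_pow_neg' (i : Fin n) (x : O) :
    (D.φ ^ (i : ℕ)) ((D.φ ^ ((-i : Fin n) : ℕ)) x) = x := by
  rw [← phi_pow_add, add_neg_cancel]
  rfl

/-- The commutator of `1 + β π^j' τ^(-i)` with `1 + a`, where `α π^j τ^i` is the term of `a` of
complementary weight. -/
lemma mono_commutator {i : Fin n} (hi : i ≠ 0) {j : ℕ} (hj : j + k < h) {a : TwistedOrder D k}
    (ha : D.π ∣ a.coeff 0) (ha0 : a.coeff 0 = 0) (haw : OffWeight ((i : ℕ) + n * j) a) {α : O}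
    (hα : a.coeff i = D.π ^ j * α) (β : O)
    (hb : D.π ∣ (mono D k (-i) (D.π ^ (h - k - 1 - j) * β)).coeff 0) :
    unipMk h (mono D k (-i) (D.π ^ (h - k - 1 - j) * β)) hb * unipMk h a ha =
      unipMk h a ha * unipMk h (mono D k (-i) (D.π ^ (h - k - 1 - j) * β)) hb *
        layer D k h (β * (D.φ ^ ((-i : Fin n) : ℕ)) α - α * (D.φ ^ (i : ℕ)) β) := by
  have hi' : -i ≠ 0 := neg_ne_zero.mpr hi
  have hk := Nat.pos_of_ne_zero (NeZero.ne k)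
  refine commutator_eq_layer hb ha (coeff_mono_ne hi'.symm _) ha0 (offWeight_mono (-i) _ β) haw
    ?_ ?_
  · have h1 := val_add_val_neg hi
    have h2 : n * (h - k) = n * (h - k - 1 - j) + n * j + n := by
      rw [← mul_add, ← Nat.mul_succ]
      congr 1
      omega
    omega
  · rw [coeff_zero_mono_mul hi', coeff_zero_mul_mono hi', neg_neg, hα]
    simp only [map_mul, map_pow, phi_pow_pi]
    have h1 : D.π ^ (h - 2 + 1) = D.π ^ (h - k - 1 - j) * D.π ^ j * D.π ^ k := by
      rw [← pow_add, ← pow_add]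
      congr 1
      omega
    rw [h1]
    ring

/-- Commutators of elements of weight at least `n (h - k) / 2` lie in `H'`, and their constant
term is that of `xy - yx`. -/
lemma exists_commutator {x y : TwistedOrder D k} (hx : D.π ∣ x.coeff 0) (hy : D.π ∣ y.coeff 0)
    {w : ℕ} (hw : n * (h - k) ≤ 2 * w) (hxw : OffWeight w x) (hyw : OffWeight w y) :
    ∃ (z : TwistedOrder D k) (hz : D.π ∣ z.coeff 0),
      unipMk h x hx * unipMk h y hy = unipMk h y hy * unipMk h x hx * unipMk h z hz ∧
      OffWeight (n * (h - k) / 2 + 1) z ∧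
      D.π ^ h ∣ z.coeff 0 - ((x * y).coeff 0 - (y * x).coeff 0) := by
  have hn : 0 < n := Nat.pos_of_ne_zero (NeZero.ne n)
  have hmul : ∀ {a b : TwistedOrder D k}, D.π ∣ a.coeff 0 → D.π ∣ b.coeff 0 → OffWeight w a →
      OffWeight w b → OffWeight (n * (h - k) / 2 + 1) (a * b) := by
    intro a b ha hb haw hbw
    exact haw.mul hbw (by omega) (e := 1) (f := 1) (by simpa using ha) (by omega)
      (by simpa using hb) (by omega)
  set y' := y + x + y * x with hy'
  have hy0 : D.π ∣ y'.coeff 0 := dvd_add_mul hy hx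
  have hyw' : unipMk h y' hy0 ∈ levelSub D k h w := by
    rw [← unipMk_mul hy hx]
    exact mul_mem (mem_levelSub_iff.mpr ⟨_, _, hyw, rfl⟩) (mem_levelSub_iff.mpr ⟨_, _, hxw, rfl⟩)
  obtain ⟨v, hv, hvw, hv'⟩ := mem_levelSub_iff.mp (inv_mem hyw')
  have hinv := mul_inv_cancel (unipMk h y' hy0)
  rw [hv', unipMk_mul, ← unipMk_zero, unipMk_eq_iff, sub_zero] at hinv
  set d := x * y - y * x with hd
  have hd0 : D.π ∣ d.coeff 0 := dvd_sub (pi_dvd_mul_zero hx) (pi_dvd_mul_zero hy)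
  have hdw : OffWeight (n * (h - k) / 2 + 1) d := (hmul hx hy hxw hyw).sub (hmul hy hx hyw hxw)
  have hz0 : D.π ∣ (d + v * d).coeff 0 := dvd_add hd0 (pi_dvd_mul_zero hv)
  refine ⟨d + v * d, hz0, (commute_mod_iff _ _ _).mpr ?_, ?_, ?_⟩
  · rw [← hy', ← hd, show d - (d + v * d + y' * (d + v * d)) = -((y' + v + y' * v) * d) by
      noncomm_ring]
    exact neg_mem (Ideal.IsTwoSided.mul_mem_of_left _ hinv)
  · refine hdw.add ?_
    rcases Nat.eq_zero_or_pos (n * (h - k)) with h0 | h0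
    · exact offWeight_of_le_one (by omega) _
    · exact hvw.mul hdw (by omega) (e := 1) (f := 1) (by simpa using hv) (by omega)
        (by simpa using hd0) (by omega)
  · have h1 : D.π ^ (h - 1) ∣ d.coeff 0 := by
      have hm : h - k - 1 = 0 ∨ n * (h - k - 1) < w + w := by
        rcases Nat.eq_zero_or_pos (h - k) with h0 | h0
        · left; omega
        · right
          have : n * (h - k - 1) + n = n * (h - k) := by
            rw [← Nat.mul_succ]
            congr 1
            omega
          omega
      have h2 := dvd_sub (dvd_coeff_zero_mul_sub hxw hyw hm) (dvd_coeff_zero_mul_sub hyw hxw hm)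
      rw [mul_comm (y.coeff 0), sub_sub_sub_cancel_right] at h2
      exact (pow_dvd_pow _ (by omega)).trans h2
    have h2 : D.π ^ h ∣ (v * d).coeff 0 := by
      have h3 := dvd_coeff_zero_mul_sub hvw hdw (m := h - k) (by right; omega)
      have h4 := (pow_dvd_pow D.π (show h ≤ h - k + k by omega)).trans h3
      refine (dvd_sub_left ?_).mp h4
      refine (pow_dvd_pow D.π (show h ≤ 1 + (h - 1) by omega)).trans ?_
      rw [pow_add, pow_one]
      exact mul_dvd_mul hv h1
    have h3 : (d + v * d).coeff 0 - ((x * y).coeff 0 - (y * x).coeff 0) = (v * d).coeff 0 := by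
      rw [coeff_add, hd, coeff_sub, add_sub_cancel_left]
    rw [h3]
    exact h2

end Commutators

section Sharp

variable {F : Type*} [Field F]

/-- Conjugation by elements of weight at least `n (h - k) / 2` preserves `H'` and `A_0` on it. -/
lemma conj_subHPrime {w : ℕ} (hw : n * (h - k) ≤ 2 * w) (hw' : w ≤ n * (h - k) / 2 + 1)
    {g u : unip D k h} (hg : g ∈ levelSub D k h w)
    (hu : u ∈ subHPrime D k h) :
    g⁻¹ * u * g ∈ subHPrime D k h ∧ constPart (g⁻¹ * u * g) = constPart u := by
  obtain ⟨x, hx, hxw, rfl⟩ := mem_levelSub_iff.mp hg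
  obtain ⟨y, hy, hyw, rfl⟩ := mem_subHPrime_iff.mp hu
  obtain ⟨z, hz, hz', hzw, hz0⟩ := exists_commutator hy hx hw (hyw.mono hw') hxw
  have h1 : (unipMk h x hx)⁻¹ * unipMk h y hy * unipMk h x hx =
      unipMk h y hy * unipMk h z hz := by
    rw [mul_assoc, hz']
    group
  have hzmem : unipMk h z hz ∈ subHPrime D k h := mem_subHPrime_iff.mpr ⟨z, hz, hzw, rfl⟩
  rw [h1]
  refine ⟨mul_mem hu hzmem, ?_⟩
  rw [constPart_mul_of_mem hu hzmem]
  have hm := Or.inr (a := h - k = 0) (show n * (h - k) < n * (h - k) / 2 + 1 + w by omega)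
  have h2 := dvd_sub (dvd_coeff_zero_mul_sub hyw hxw hm)
    (dvd_coeff_zero_mul_sub hxw hyw (hm.imp_right (by omega)))
  rw [mul_comm (x.coeff 0), sub_sub_sub_cancel_right] at h2
  have h3 := dvd_add hz0 ((pow_dvd_pow D.π (show h ≤ h - k + k by omega)).trans h2)
  rw [sub_add_cancel] at h3
  have : constPart (unipMk h z hz) = 1 := by
    have h4 := (constPart_eq_iff (h := h) hz (y := 0) (by simp)).mpr (by simpa using h3)
    rw [h4, unipMk_zero]
    exact constPart_subH 1
  rw [this, mul_one]

/-- The commutators of `H⁺` lie in `H'` and have trivial constant term. -/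
lemma subHPlus_commutator [NeZero h] {u v : unip D k h} (hu : u ∈ subHPlus D k h)
    (hv : v ∈ subHPlus D k h) : ∃ c ∈ offSub D k h 0, u * v = v * u * c := by
  have hn : 0 < n := Nat.pos_of_ne_zero (NeZero.ne n)
  obtain ⟨x, hx, hxP, rfl⟩ := mem_subHPlus_iff.mp hu
  obtain ⟨y, hy, hyP, rfl⟩ := mem_subHPlus_iff.mp hv
  obtain ⟨-, hxw, hxs⟩ := mem_jPlus_iff.mp hxP
  obtain ⟨-, hyw, hys⟩ := mem_jPlus_iff.mp hyP
  obtain ⟨z, hz, hz', hzw, hz0⟩ := exists_commutator (h := h) hx hy (by omega) hxw hyw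
  -- Only the pair `τ^(n/2)`, `τ^(n/2)` contributes modulo `π^h` to `(xy)_0 - x_0 y_0`; there the
  -- coefficients are fixed by `φ^(n/2)` modulo `π`, so that their product is symmetric.
  have key : D.π ^ h ∣ (x * y).coeff 0 - (y * x).coeff 0 := by
    rw [coeff_mul, coeff_mul, ← Equiv.sum_comp (Equiv.neg (Fin n)) (fun p => y.coeff p * _ * _),
      ← Finset.sum_sub_distrib]
    refine Finset.dvd_sum fun p _ => ?_
    simp only [Equiv.neg_apply, zero_sub, neg_neg]
    by_cases hp : p = 0
    · subst hp
      simp [carry_zero_left, mul_comm]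
    have hp' : -p ≠ 0 := neg_ne_zero.mpr hp
    have hc := carry_neg (k := k) hp'
    rw [neg_neg] at hc
    have hsum := val_add_val_neg hp
    rw [carry_neg hp, hc]
    obtain ⟨e, he, he'⟩ := hxw p hp
    obtain ⟨f, hf, hf'⟩ := hyw (-p) hp'
    by_cases hef : h ≤ e + f + k
    · have h1 := dvd_term (k := k) he hf
      rw [carry_neg hp] at h1
      have h2 := dvd_term (k := k) hf he
      rw [hc] at h2
      exact dvd_sub ((pow_dvd_pow _ hef).trans h1) ((pow_dvd_pow _ (by omega)).trans h2)
    · push Not at hef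
      -- Equality must hold in both weight bounds, so `p = n / 2`.
      have h1 : n * (e + f + 1) ≤ n * (h - k) := Nat.mul_le_mul_left n (by omega)
      have h2 : n * (h - k) < n * (e + f + 2) := by rw [mul_add, mul_add]; omega
      have h3 := Nat.lt_of_mul_lt_mul_left h2
      have h4 : h - k = e + f + 1 := by omega
      have h5 : n * (h - k) = n * e + n * f + n := by rw [h4]; ring
      have h6 : 2 * (p : ℕ) = n ∧ e = f := by
        have hlt := p.2
        have hpos : 0 < (p : ℕ) := Nat.pos_of_ne_zero fun h0 => hp (Fin.ext h0)
        rcases lt_trichotomy e f with hlt' | heq | hgt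
        · have := Nat.mul_le_mul_left n hlt'
          rw [Nat.succ_eq_add_one, mul_add] at this
          omega
        · subst heq
          omega
        · have := Nat.mul_le_mul_left n hgt
          rw [Nat.succ_eq_add_one, mul_add] at this
          omega
      obtain ⟨hp2, rfl⟩ := h6
      have hpp : (-p : Fin n) = p := Fin.ext (by omega)
      obtain ⟨a, ha, ha'⟩ := hxs p e hp2 (by omega)
      obtain ⟨b, hb, hb'⟩ := hys p e hp2 (by omega)
      rw [show n / 2 = (p : ℕ) by omega] at ha' hb'
      rw [hpp, ha, hb]
      simp only [map_mul, map_pow, phi_pow_pi]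
      have h7 : D.π ∣ a * (D.φ ^ (p : ℕ)) b - b * (D.φ ^ (p : ℕ)) a := by
        have := dvd_sub (hb'.mul_left a) (ha'.mul_left b)
        convert this using 1
        ring
      have h8 : D.π ^ h = D.π ^ e * D.π ^ e * D.π ^ k * D.π := by
        rw [← pow_add, ← pow_add, ← pow_succ]
        congr 1
        omega
      rw [h8]
      refine (mul_dvd_mul_left (D.π ^ e * D.π ^ e * D.π ^ k) h7).trans (dvd_of_eq ?_)
      ring
  have h0 := dvd_add hz0 key
  rw [sub_add_cancel] at h0
  obtain ⟨a, ha, ha0, ha', hza⟩ := unipMk_eq_of_coeff_zero hz h0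
  refine ⟨unipMk h z hz, ?_, hz'⟩
  rw [hza]
  exact mem_offSub_iff.mpr ⟨a, ha, ha0, fun i hi => by rw [ha' i hi]; exact hzw i hi, rfl⟩

lemma constPart_offSub {m : ℕ} {u : unip D k h} (hu : u ∈ offSub D k h m) : constPart u = 1 := by
  obtain ⟨x, hx, hx0, -, rfl⟩ := mem_offSub_iff.mp hu
  have h4 := (constPart_eq_iff (h := h) hx (y := 0) (by simp)).mpr (by simp [hx0])
  rw [h4, unipMk_zero]
  exact constPart_subH 1

open scoped commutatorElement in
/-- The function `χ^♯` extends to a character of `H⁺`. -/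
theorem exists_extendsSharp [NeZero h] [Finite (unip D k h)] [IsAlgClosed F] [CharZero F]
    (χ : subH D k h →* Fˣ) : ∃ χt : subHPlus D k h →* Fˣ, ExtendsSharp χ χt := by
  have hle : commutator (subHPlus D k h) ≤ (offSub D k h 0).subgroupOf (subHPlus D k h) := by
    rw [commutator_def, Subgroup.commutator_le]
    intro u _ v _
    obtain ⟨c, hc, hc'⟩ := subHPlus_commutator (inv_mem u.2) (inv_mem v.2)
    rw [Subgroup.mem_subgroupOf]
    have hc2 : ((⁅u, v⁆ : subHPlus D k h) : unip D k h) =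
        (u : unip D k h) * v * ((u : unip D k h)⁻¹ * (v : unip D k h)⁻¹) := by
      simp only [commutatorElement_def, Subgroup.coe_mul, Subgroup.coe_inv]
      group
    rw [hc2, hc']
    convert hc using 1
    group
  obtain ⟨χt, hχt⟩ := exists_extension_of_commutators
    ((subHPrime D k h).subgroupOf (subHPlus D k h))
    ((sharp χ).comp (Subgroup.subgroupOfEquivOfLe subHPrime_le_subHPlus).toMonoidHom)
    (fun x hx => by
      have h1 := constPart_offSub (Subgroup.mem_subgroupOf.mp (hle hx))
      change χ (constPart _) = 1
      rw [← map_one χ, ← h1]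
      rfl)
  refine ⟨χt, extendsSharp_iff.mpr fun u hu => ?_⟩
  exact hχt ⟨u, Subgroup.mem_subgroupOf.mpr hu⟩

end Sharp

end TwistedOrder

/-! ### Irreducibility by Mackey's criterion -/

namespace TwistedOrder

variable {O : Type*} [CommRing O] {n : ℕ} {D : CyclicData O n} {k h : ℕ} [NeZero n] [NeZero k]

section Mackey

variable {F : Type*} [Field F]

/-- The character `γ ↦ ω(1 + π^(h-1) γ)` is not fixed by `φ^i` for `0 < i < n`. -/
def LayerRegular {S : Subgroup (unip D k h)} (ω : S →* Fˣ) : Prop :=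
  ∀ i : Fin n, i ≠ 0 → ∃ (γ : O) (hm : layer D k h ((D.φ ^ (i : ℕ)) γ - γ) ∈ S),
    ω ⟨_, hm⟩ ≠ 1

lemma exists_mul_sub_dvd (hπ : Prime D.π) [Finite (O ⧸ Ideal.span {D.π})] {α : O}
    (hα : ¬ D.π ∣ α) (γ : O) : ∃ ε, D.π ∣ α * ε - γ := by
  have : (Ideal.span {D.π}).IsPrime := (Ideal.span_singleton_prime hπ.ne_zero).mpr hπ
  have hfield := Finite.isField_of_domain (O ⧸ Ideal.span {D.π})
  have hα0 : Ideal.Quotient.mk (Ideal.span {D.π}) α ≠ 0 := by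
    rwa [Ne, Ideal.Quotient.eq_zero_iff_dvd]
  obtain ⟨b, hb⟩ := hfield.mul_inv_cancel hα0
  obtain ⟨β, rfl⟩ := Ideal.Quotient.mk_surjective b
  refine ⟨β * γ, ?_⟩
  rw [← Ideal.Quotient.eq_zero_iff_dvd, map_sub, map_mul, map_mul, ← mul_assoc, hb, one_mul,
    sub_self]

lemma dvd_phi_pow_iff (i : ℕ) {x : O} : D.π ∣ (D.φ ^ i) x ↔ D.π ∣ x := by
  constructor
  · intro H
    have h1 := map_dvd (D.φ ^ i)⁻¹ H
    have h2 : (D.φ ^ i)⁻¹ D.π = D.π := by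
      conv_lhs => rw [← phi_pow_pi D i]
      rw [← RingAut.mul_apply, inv_mul_cancel, RingAut.one_apply]
    rwa [h2, ← RingAut.mul_apply, inv_mul_cancel, RingAut.one_apply] at h1
  · intro H
    have h1 := map_dvd (D.φ ^ i) H
    rwa [phi_pow_pi] at h1

/-- The term of lowest weight that prevents `1 + a` from lying in `H⁺`. -/
lemma exists_bad_term {a : TwistedOrder D k} (ha : D.π ∣ a.coeff 0)
    (haP : a ∉ jPlus D k h) : ∃ (i : Fin n) (j : ℕ) (α : O), i ≠ 0 ∧ a.coeff i = D.π ^ j * α ∧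
      OffWeight ((i : ℕ) + n * j) a ∧ ((2 * ((i : ℕ) + n * j) < n * (h - k) ∧ ¬ D.π ∣ α) ∨
        (2 * (i : ℕ) = n ∧ 2 * j + 1 + k = h ∧ ¬ D.π ∣ (D.φ ^ (i : ℕ)) α - α)) := by
  classical
  have hn : 0 < n := Nat.pos_of_ne_zero (NeZero.ne n)
  by_cases hw : OffWeight ((n * (h - k) + 1) / 2) a
  · rw [mem_jPlus_iff, and_iff_right ha, and_iff_right hw] at haP
    push Not at haP
    obtain ⟨i, j, hi, hj, hb⟩ := haP
    have hi0 : i ≠ 0 := by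
      rintro rfl
      simp at hi
      omega
    have hN : n * (h - k) = 2 * ((i : ℕ) + n * j) := by
      rw [show h - k = 2 * j + 1 by omega, mul_add, mul_left_comm]
      omega
    have hw' : OffWeight ((i : ℕ) + n * j) a := hw.mono (by omega)
    obtain ⟨α, hα⟩ := hw'.dvd hi0 (j := j) (by omega)
    refine ⟨i, j, α, hi0, hα, hw', Or.inr ⟨hi, hj, ?_⟩⟩
    have := hb α hα
    rwa [show n / 2 = (i : ℕ) by omega] at this
  · have hex : ∃ w, ¬ OffWeight w a := ⟨_, hw⟩
    have hmin := Nat.find_min' hex hw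
    obtain ⟨w, hw1⟩ : ∃ w, Nat.find hex = w + 1 := Nat.exists_eq_succ_of_ne_zero fun h0 =>
      Nat.find_spec hex (offWeight_of_le_one (by omega) _)
    have hbad := Nat.find_spec hex
    have hgood : OffWeight w a := not_not.mp (Nat.find_min hex (by omega))
    rw [hw1, offWeight_iff] at hbad
    push Not at hbad
    obtain ⟨i, j, hi, hij, hdvd⟩ := hbad
    have hij' : w = (i : ℕ) + n * j := by
      by_contra hne
      exact hdvd (hgood.dvd_of_lt hi (by omega))
    obtain ⟨α, hα⟩ := hgood.dvd hi (j := j) (by omega)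
    refine ⟨i, j, α, hi, hα, hij' ▸ hgood, Or.inl ⟨by omega, fun hd => hdvd ?_⟩⟩
    rw [hα, pow_succ]
    exact mul_dvd_mul_left _ hd

/-- An element outside `H⁺` conjugates some element of `H⁺` to its product with an element of
the last layer on which `χ` is not trivial. -/
lemma exists_conj_ne [NeZero h] (hπ : Prime D.π) [Finite (O ⧸ Ideal.span {D.π})]
    {χ : subH D k h →* Fˣ} (hχ : k < h → LayerRegular χ) {χt : subHPlus D k h →* Fˣ}
    (hext : ExtendsSharp χ χt) (g : unip D k h) (hg : g ∉ subHPlus D k h) :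
    ∃ (s : subHPlus D k h) (hs : g⁻¹ * s * g ∈ subHPlus D k h), χt ⟨_, hs⟩ ≠ χt s := by
  have hn : 0 < n := Nat.pos_of_ne_zero (NeZero.ne n)
  have hk : 0 < k := Nat.pos_of_ne_zero (NeZero.ne k)
  obtain ⟨y, hy, rfl⟩ := exists_unipMk g
  obtain ⟨t, ht, a, ha, ha0, -, hya⟩ := exists_eq_mul_subH (h := h) hy
    (offWeight_of_le_one zero_le_one y)
  have ht' : t ∈ subHPlus D k h := subHPrime_le_subHPlus (subH_le_subHPrime ht)
  have haP : a ∉ jPlus D k h := by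
    intro haP
    refine hg ?_
    rw [hya]
    exact mul_mem (mem_subHPlus_iff.mpr ⟨a, ha, haP, rfl⟩) ht'
  obtain ⟨i, j, α, hi, hα, haw, hbad⟩ := exists_bad_term ha haP
  have hipos : 0 < (i : ℕ) := Nat.pos_of_ne_zero fun h0 => hi (Fin.ext h0)
  have hj : j + k < h := by
    rcases hbad with ⟨h1, -⟩ | ⟨-, h1, -⟩
    · have : n * j < n * (h - k) := by omega
      have := Nat.lt_of_mul_lt_mul_left this
      omega
    · omega
  have hi' : -i ≠ 0 := neg_ne_zero.mpr hi
  have hsum := val_add_val_neg hi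
  have hN : n * (h - k) = n * (h - k - 1 - j) + n * j + n := by
    rw [← mul_add, ← Nat.mul_succ]
    congr 1
    omega
  -- It suffices to find `β` such that `s = 1 + β π^(h-k-1-j) τ^(-i)` lies in `H⁺` and `χ` does
  -- not kill its commutator with `1 + a`.
  suffices H : ∃ β, mono D k (-i) (D.π ^ (h - k - 1 - j) * β) ∈ jPlus D k h ∧
      χ ⟨_, layer_mem_subH (β * (D.φ ^ ((-i : Fin n) : ℕ)) α - α * (D.φ ^ (i : ℕ)) β)⟩ ≠ 1 by
    obtain ⟨β, hβ, hne⟩ := H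
    have hb := (mem_jPlus_iff.mp hβ).1
    set b := mono D k (-i) (D.π ^ (h - k - 1 - j) * β)
    set c := layer D k h (β * (D.φ ^ ((-i : Fin n) : ℕ)) α - α * (D.φ ^ (i : ℕ)) β) with hc
    have hcP : c ∈ subHPrime D k h := subH_le_subHPrime (layer_mem_subH _)
    have hbs : unipMk h b hb ∈ subHPlus D k h := mem_subHPlus_iff.mpr ⟨b, hb, hβ, rfl⟩
    have hcomm : unipMk h b hb * unipMk h a ha = unipMk h a ha * unipMk h b hb * c :=
      mono_commutator hi hj ha ha0 haw hα β hb
    have hconj : (unipMk h y hy)⁻¹ * unipMk h b hb * unipMk h y hy =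
        t⁻¹ * (unipMk h b hb * c) * t := by
      rw [hya, mul_inv_rev, mul_assoc, mul_assoc, ← mul_assoc _ _ t, hcomm]
      group
    have hmem : (unipMk h y hy)⁻¹ * unipMk h b hb * unipMk h y hy ∈ subHPlus D k h := by
      rw [hconj]
      exact mul_mem (mul_mem (inv_mem ht') (mul_mem hbs (subHPrime_le_subHPlus hcP))) ht'
    refine ⟨⟨_, hbs⟩, hmem, ?_⟩
    have hval : χt ⟨_, hmem⟩ = χt ⟨_, hbs⟩ * χt ⟨c, subHPrime_le_subHPlus hcP⟩ := by
      have : (⟨_, hmem⟩ : subHPlus D k h) =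
          ⟨t, ht'⟩⁻¹ * (⟨_, hbs⟩ * ⟨c, subHPrime_le_subHPlus hcP⟩) * ⟨t, ht'⟩ := Subtype.ext hconj
      rw [this]
      simp only [map_mul, map_inv]
      rw [mul_right_comm, inv_mul_cancel, one_mul]
    rw [hval, extendsSharp_iff.mp hext ⟨c, _⟩ hcP, Ne, mul_eq_left]
    intro h1
    refine hne (Eq.trans ?_ h1)
    congr 1
    exact (constPart_subH ⟨c, layer_mem_subH _⟩).symm
  rcases hbad with ⟨hlt, hα0⟩ | ⟨hi2, hj2, hα0⟩
  -- If the bad term is below the middle weight, then `s` lies in `H'` for every `β`. With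
  -- `β = φ^(-i)(ε)` and `α ε ≡ γ` the commutator is the layer of `φ^(-i)(γ) - γ`.
  · obtain ⟨γ, hm, hγ⟩ := hχ (by omega) (-i) hi'
    obtain ⟨ε, hε⟩ := exists_mul_sub_dvd hπ hα0 γ
    refine ⟨(D.φ ^ ((-i : Fin n) : ℕ)) ε, ?_, ?_⟩
    · have h1 : mono D k (-i) (D.π ^ (h - k - 1 - j) * (D.φ ^ ((-i : Fin n) : ℕ)) ε) ∈
          jPrime D k h := by
        refine mem_jPrime_iff.mpr ⟨?_, (offWeight_mono _ _ _).mono (by omega)⟩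
        rw [coeff_mono_ne hi'.symm]
        exact dvd_zero _
      refine mem_jPlus_iff.mpr ⟨(mem_jPrime_iff.mp h1).1, (mem_jPrime_iff.mp h1).2.mono (by omega),
        fun i' j' hi2 hj2 => ?_⟩
      have hi0 : i' ≠ 0 := by
        rintro rfl
        simp at hi2
        omega
      obtain ⟨x, hx⟩ := (mem_jPrime_iff.mp h1).2.dvd_of_lt hi0 (j := j') (by
        rw [show h - k = 2 * j' + 1 by omega, mul_add, mul_left_comm]
        omega)
      refine ⟨D.π * x, by rw [hx, pow_succ, mul_assoc], ?_⟩
      rw [map_mul, phi_pow_pi, ← mul_sub]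
      exact dvd_mul_right _ _
    · intro h1
      refine hγ (Eq.trans ?_ h1)
      congr 1
      refine Subtype.ext (layer_congr ?_)
      rw [phi_pow_neg', ← map_mul]
      have h2 := (dvd_phi_pow_iff ((-i : Fin n) : ℕ)).mpr hε
      rw [map_sub] at h2
      have h3 := dvd_sub hε h2
      rw [mul_comm ε α]
      convert h3 using 1
      ring
  -- In the middle weight `s` lies in `H⁺` only if `φ^i` fixes `β` modulo `π`; then the commutator
  -- is the layer of `β (φ^i(α) - α)`, and `β` is chosen to make this `φ^i(γ) - γ`.
  · obtain ⟨γ, hm, hγ⟩ := hχ (by omega) i hi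
    obtain ⟨β, hβ⟩ := exists_mul_sub_dvd hπ hα0 ((D.φ ^ (i : ℕ)) γ - γ)
    have hii : (-i : Fin n) = i := Fin.ext (by omega)
    have hinvol : ∀ x, (D.φ ^ (i : ℕ)) ((D.φ ^ (i : ℕ)) x) = x := by
      intro x
      have := phi_pow_neg (D := D) i x
      rwa [hii] at this
    -- `φ^i` maps both `φ^i(α) - α` and `φ^i(γ) - γ` to their negatives and so fixes `β`.
    have hfix : D.π ∣ (D.φ ^ (i : ℕ)) β - β := by
      have h2 := (dvd_phi_pow_iff (i : ℕ)).mpr hβ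
      simp only [map_sub, map_mul, hinvol] at h2
      have h3 := dvd_add h2 hβ
      refine (hπ.dvd_or_dvd (a := (D.φ ^ (i : ℕ)) α - α) ?_).resolve_left hα0
      rw [← dvd_neg]
      convert h3 using 1
      ring
    rw [hii, show h - k - 1 - j = j by omega]
    refine ⟨β, mem_jPlus_iff.mpr
      ⟨?_, (offWeight_mono _ _ _).mono ?_, fun i' j' hi2' hj2' => ?_⟩, ?_⟩
    · rw [coeff_mono_ne hi.symm]
      exact dvd_zero _
    · rw [show h - k = 2 * j + 1 by omega, mul_add, mul_left_comm]
      omega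
    · obtain rfl : i' = i := Fin.ext (by omega)
      obtain rfl : j' = j := by omega
      refine ⟨β, coeff_mono_self _ _, ?_⟩
      rwa [show n / 2 = (i' : ℕ) by omega]
    · intro h1
      refine hγ (Eq.trans ?_ h1)
      congr 1
      refine Subtype.ext (layer_congr ?_)
      have h3 := dvd_sub (hfix.mul_left α) hβ
      convert h3 using 1
      ring

theorem ind_isIrreducible [NeZero h] [Finite (unip D k h)] [CharZero F] (hπ : Prime D.π)
    [Finite (O ⧸ Ideal.span {D.π})] {χ : subH D k h →* Fˣ} (hχ : k < h → LayerRegular χ)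
    {χt : subHPlus D k h →* Fˣ} (hext : ExtendsSharp χ χt) :
    (Representation.ind (subHPlus D k h).subtype (charRep χt)).IsIrreducible :=
  ind_isIrreducible_of_mackey _ _ (exists_conj_ne hπ hχ hext)

/-- Conjugation by a central element fixes `χt`, while an element outside `H⁺` moves it. -/
lemma center_le_subHPlus [NeZero h] (hπ : Prime D.π) [Finite (O ⧸ Ideal.span {D.π})]
    {χ : subH D k h →* Fˣ} (hχ : k < h → LayerRegular χ) {χt : subHPlus D k h →* Fˣ}
    (hext : ExtendsSharp χ χt) : Subgroup.center (unip D k h) ≤ subHPlus D k h := by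
  intro z hz
  by_contra hz'
  obtain ⟨s, hs, hne⟩ := exists_conj_ne hπ hχ hext z hz'
  refine hne (congrArg χt (Subtype.ext ?_))
  change z⁻¹ * (s : unip D k h) * z = s
  rw [mul_assoc, Subgroup.mem_center_iff.mp hz, inv_mul_cancel_left]

/-- The representation induced from `χt` has central character `χt`. -/
lemma isCentralCharacter_ind [NeZero h] {χt : subHPlus D k h →* Fˣ}
    (hz : Subgroup.center (unip D k h) ≤ subHPlus D k h) :
    IsCentralCharacter (Representation.ind (subHPlus D k h).subtype (charRep χt))
      (χt.comp (Subgroup.inclusion hz)) := by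
  intro z v
  have : Representation.ind (subHPlus D k h).subtype (charRep χt) (z : unip D k h) =
      ((χt.comp (Subgroup.inclusion hz)) z : F) • LinearMap.id := by
    refine ind_hom_ext fun x => ?_
    rw [ind_indVec, Subgroup.mem_center_iff.mp (inv_mem z.2)]
    have := indVec_mul _ χt (Subgroup.inclusion hz z)⁻¹ x
    simp only [map_inv, inv_inv] at this
    exact this
  rw [this]
  rfl

end Mackey

/-! ### Exhaustion -/

section Exhaustion

variable {F : Type*} [Field F] [IsAlgClosed F] [CharZero F] [Finite (unip D k h)] [NeZero h]
  {V : Type*} [AddCommGroup V] [Module F V] [FiniteDimensional F V]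
  (ρ : Representation F (unip D k h) V)

lemma offSub_comm {m : ℕ} {u v : unip D k h} (hu : u ∈ offSub D k h m)
    (hv : v ∈ offSub D k h m) : u * v = v * u := by
  obtain ⟨x, hx, hx0, hxw, rfl⟩ := mem_offSub_iff.mp hu
  obtain ⟨y, hy, hy0, hyw, rfl⟩ := mem_offSub_iff.mp hv
  exact commute_of_mem _ _ (sub_mem (mul_mem_truncIdeal hxw hyw (by omega) hx0 hy0)
    (mul_mem_truncIdeal hyw hxw (by omega) hy0 hx0))

/-- If the central character of `ρ` is regular on the last layer, `ρ` has a nonzero vector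
fixed by the elements `1 + a` of weight above `n (h - k) / 2 + m`, by descending induction
on `m`: the elements whose commutators with one layer lie in the last layer permute the
characters of this layer transitively. -/
lemma exists_fixed_offSub [Nontrivial V] (hπ : Prime D.π) [Finite (O ⧸ Ideal.span {D.π})]
    {ω : Subgroup.center (unip D k h) →* Fˣ} (hρ : IsCentralCharacter ρ ω)
    (hω : k < h → LayerRegular ω) (l m : ℕ)
    (hm : n * (h - k) ≤ n * (h - k) / 2 + 1 + m + l) :
    ∃ v : V, v ≠ 0 ∧ ∀ u ∈ offSub D k h m, ρ u v = v := by
  induction l generalizing m with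
  | zero =>
    obtain ⟨v, hv⟩ := exists_ne (0 : V)
    refine ⟨v, hv, fun u hu => ?_⟩
    rw [offSub_eq_bot (by simpa using hm), Subgroup.mem_bot] at hu
    simp [hu]
  | succ l ih =>
    by_cases hm' : n * (h - k) ≤ n * (h - k) / 2 + 1 + m + l
    · exact ih m hm'
    obtain ⟨v, hv, hfix⟩ := ih (m + 1) (by omega)
    obtain ⟨Λ, w, hw, hΛ, hΛ1⟩ := exists_eigenvector_of_fixed ρ (offSub_anti (Nat.le_succ m))
      (fun s hs t ht => ⟨1, one_mem _, by rw [mul_one, offSub_comm hs ht]⟩) hv hfix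
    have hnorm : (lastLayer D k h).Normal := ⟨fun u hu g => by
      rwa [Subgroup.mem_center_iff.mp (lastLayer_le_center hu), mul_inv_cancel_right]⟩
    -- `Γ` consists of the elements whose commutators with `offSub D k h m` lie in the last layer.
    set Γ : Subgroup (unip D k h) := (Subgroup.centralizer
      ((offSub D k h m).map (QuotientGroup.mk' (lastLayer D k h)))).comap
        (QuotientGroup.mk' (lastLayer D k h))
    have memΓ : ∀ g, g ∈ Γ ↔ ∀ s ∈ offSub D k h m, s⁻¹ * g⁻¹ * s * g ∈ lastLayer D k h := by
      intro g
      rw [Subgroup.mem_comap, Subgroup.mem_centralizer_iff]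
      simp only [Subgroup.coe_map, Set.forall_mem_image, SetLike.mem_coe, ← map_mul]
      refine forall₂_congr fun s _ => ?_
      rw [eq_comm, QuotientGroup.mk'_apply, QuotientGroup.mk'_apply, QuotientGroup.eq,
        mul_inv_rev, mul_assoc (s⁻¹ * g⁻¹)]
    have hconj := exists_conj_eigenvector ρ (offSub D k h m) Γ (lastLayer D k h)
      (ω.comp (Subgroup.inclusion lastLayer_le_center)) (fun g hg => (memΓ g).mp hg)
      (fun g x _ => by
        have h1 : g⁻¹ * (x : unip D k h) * g = x := by
          rw [mul_assoc, ← Subgroup.mem_center_iff.mp (lastLayer_le_center x.2),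
            inv_mul_cancel_left]
        exact ⟨h1.symm ▸ x.2, congrArg _ (Subtype.ext h1)⟩)
      Λ 1 (v := w)
    specialize hconj ?_ (fun x => hρ (Subgroup.inclusion lastLayer_le_center x) _) hΛ
    swap
    · obtain ⟨g, -, hg⟩ := hconj
      refine ⟨ρ g w, fun h0 => hw ?_, fun u hu => by simpa using hg ⟨u, hu⟩⟩
      have := congrArg (ρ g⁻¹) h0
      rwa [← Module.End.mul_apply, ← map_mul, inv_mul_cancel, map_one, map_zero] at this
    -- An element `s` whose commutators with `Γ` are killed by `ω` has no term of weight exactly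
    -- `n (h - k) / 2 + 1 + m`: such a term would give a nontrivial commutator with the element
    -- `g = 1 + α π^(h-k-1-j) τ^(-i)` of `Γ`.
    intro s hs
    refine hΛ1 s ?_
    obtain ⟨b, hb, hb0, hbw, hsb⟩ := mem_offSub_iff.mp s.2
    refine mem_offSub_iff.mpr ⟨b, hb, hb0, offWeight_iff.mpr fun i j hi hij => ?_, hsb⟩
    by_cases hlt : (i : ℕ) + n * j < n * (h - k) / 2 + 1 + m
    · exact hbw.dvd_of_lt hi hlt
    have hipos : 0 < (i : ℕ) := Nat.pos_of_ne_zero fun h0 => hi (Fin.ext h0)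
    have hijw : (i : ℕ) + n * j = n * (h - k) / 2 + 1 + m := by omega
    have hj : j + k < h := by
      have : n * j < n * (h - k) := by omega
      have := Nat.lt_of_mul_lt_mul_left this
      omega
    obtain ⟨β, hβ⟩ := hbw.dvd hi (j := j) (by omega)
    rw [hβ, pow_succ]
    refine mul_dvd_mul_left _ ?_
    by_contra hβ0
    have hi' : -i ≠ 0 := neg_ne_zero.mpr hi
    obtain ⟨γ, hγm, hγ⟩ := hω (by omega) (-i) hi'
    obtain ⟨ε, hε⟩ := exists_mul_sub_dvd hπ hβ0 γ
    set α := (D.φ ^ ((-i : Fin n) : ℕ)) ε with hα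
    have hc : D.π ∣ (mono D k (-i) (D.π ^ (h - k - 1 - j) * α)).coeff 0 := by
      rw [coeff_mono_ne hi'.symm]
      exact dvd_zero _
    set g := unipMk h (mono D k (-i) (D.π ^ (h - k - 1 - j) * α)) hc with hg
    have hcomm : ∀ (b' : TwistedOrder D k) (hb' : D.π ∣ b'.coeff 0) (β' : O), b'.coeff 0 = 0 →
        OffWeight (n * (h - k) / 2 + 1 + m) b' → b'.coeff i = D.π ^ j * β' →
        (unipMk h b' hb')⁻¹ * g⁻¹ * unipMk h b' hb' * g =
          (layer D k h (α * (D.φ ^ ((-i : Fin n) : ℕ)) β' - β' * (D.φ ^ (i : ℕ)) α))⁻¹ := by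
      intro b' hb' β' hb0' hbw' hβ'
      have h1 := mono_commutator hi hj hb' hb0' (hbw'.mono hijw.le) hβ' α hc
      rw [← hg] at h1
      rw [mul_assoc, mul_assoc, eq_inv_iff_mul_eq_one, mul_assoc, mul_assoc, ← h1]
      group
    have hgΓ : g ∈ Γ := by
      rw [memΓ]
      intro s' hs'
      obtain ⟨b', hb', hb0', hbw', rfl⟩ := mem_offSub_iff.mp hs'
      obtain ⟨β', hβ'⟩ := hbw'.dvd hi (j := j) (by omega)
      rw [hcomm b' hb' β' hb0' hbw' hβ']
      exact inv_mem (mem_lastLayer_iff.mpr ⟨_, rfl⟩)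
    have h1 := hs g hgΓ
    refine hγ ?_
    rw [← inv_eq_one, ← map_inv]
    refine Eq.trans ?_ h1
    refine congrArg ω (Subtype.ext ?_)
    change (layer D k h ((D.φ ^ ((-i : Fin n) : ℕ)) γ - γ))⁻¹ = (s : unip D k h)⁻¹ * g⁻¹ * s * g
    rw [hsb, hcomm b hb β hb0 hbw hβ]
    refine congrArg _ (layer_congr ?_)
    rw [hα, phi_pow_neg', ← map_mul]
    have h2 := (dvd_phi_pow_iff ((-i : Fin n) : ℕ)).mpr hε
    rw [map_sub] at h2
    have h3 := dvd_sub hε h2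
    rw [mul_comm ε β]
    convert h3 using 1
    ring

/-- Any two extensions of `χ^♯` to `H⁺` are conjugate under the elements of weight at least
`n (h - k) / 2`, so that a representation which contains one of them contains the other. -/
lemma exists_conj_extendsSharp (hπ : Prime D.π) [Finite (O ⧸ Ideal.span {D.π})]
    {χ : subH D k h →* Fˣ} (hχ : k < h → LayerRegular χ) {Λ χt : subHPlus D k h →* Fˣ}
    (hΛ : ExtendsSharp χ Λ) (hχt : ExtendsSharp χ χt) {v : V}
    (hv : ∀ s : subHPlus D k h, ρ s v = (Λ s : F) • v) :
    ∃ g, ∀ s : subHPlus D k h, ρ s (ρ g v) = (χt s : F) • ρ g v := by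
  have hn : 0 < n := Nat.pos_of_ne_zero (NeZero.ne n)
  rw [extendsSharp_iff] at hΛ hχt
  set w := (n * (h - k) + 1) / 2 with hw
  have hw2 : n * (h - k) ≤ 2 * w := by omega
  have hcomm : ∀ {x y : TwistedOrder D k} (hx : D.π ∣ x.coeff 0) (hy : D.π ∣ y.coeff 0),
      OffWeight w x → OffWeight w y → ∃ (z : TwistedOrder D k) (hz : D.π ∣ z.coeff 0),
      (unipMk h x hx)⁻¹ * (unipMk h y hy)⁻¹ * unipMk h x hx * unipMk h y hy = unipMk h z hz ∧
      OffWeight (n * (h - k) / 2 + 1) z ∧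
      D.π ^ h ∣ z.coeff 0 - ((x * y).coeff 0 - (y * x).coeff 0) := by
    intro x y hx hy hxw hyw
    obtain ⟨z, hz, hz', hzw, hz0⟩ := exists_commutator hx hy hw2 hxw hyw
    refine ⟨z, hz, ?_, hzw, hz0⟩
    rw [mul_assoc, hz']
    group
  have hc : ∀ g ∈ levelSub D k h w, ∀ s ∈ subHPlus D k h,
      s⁻¹ * g⁻¹ * s * g ∈ subHPrime D k h := by
    intro g hg s hs
    obtain ⟨y, hy, hyw, rfl⟩ := mem_levelSub_iff.mp hg
    obtain ⟨x, hx, hxw, rfl⟩ := mem_levelSub_iff.mp (subHPlus_le_levelSub hs)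
    obtain ⟨z, hz, hz', hzw, -⟩ := hcomm hx hy hxw hyw
    rw [hz']
    exact mem_subHPrime_iff.mpr ⟨z, hz, hzw, rfl⟩
  have hconj := exists_conj_eigenvector ρ (subHPlus D k h) (levelSub D k h w)
    (subHPrime D k h) (sharp χ) hc (fun g x hgx => by
      obtain ⟨h1, h2⟩ := conj_subHPrime hw2 (by omega)
        (hgx.elim id fun h => subHPlus_le_levelSub h) x.2
      exact ⟨h1, congrArg χ h2⟩) Λ χt (v := v)
  specialize hconj ?_ (fun x => by
        rw [show sharp χ x = Λ (Subgroup.inclusion subHPrime_le_subHPlus x) from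
          (hΛ (Subgroup.inclusion subHPrime_le_subHPlus x) x.2).symm]
        exact hv (Subgroup.inclusion subHPrime_le_subHPlus x)) hv
  swap
  · obtain ⟨g, -, hg⟩ := hconj
    exact ⟨g, hg⟩
  intro s hs
  -- If `χ^♯` kills the commutators of `s` with all elements of weight `n (h - k) / 2`, then
  -- `s` lies in `H'`.
  suffices hsP : (s : unip D k h) ∈ subHPrime D k h by rw [hΛ s hsP, hχt s hsP]
  obtain ⟨b, hb, hbP, hsb⟩ := mem_subHPlus_iff.mp s.2
  obtain ⟨-, hbw, hbs⟩ := mem_jPlus_iff.mp hbP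
  refine mem_subHPrime_iff.mpr ⟨b, hb, offWeight_iff.mpr fun i j hi hij => ?_, hsb⟩
  by_cases hlt : (i : ℕ) + n * j < w
  · exact hbw.dvd_of_lt hi hlt
  have hipos : 0 < (i : ℕ) := Nat.pos_of_ne_zero fun h0 => hi (Fin.ext h0)
  have hN : n * (h - k) = 2 * (i : ℕ) + n * (2 * j) := by rw [mul_left_comm]; omega
  have hhk : h - k = 2 * j + 1 := by
    have h1 : n * (2 * j) < n * (h - k) := by omega
    have h2 : n * (h - k) < n * (2 * j + 2) := by rw [mul_add]; omega
    have := Nat.lt_of_mul_lt_mul_left h1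
    have := Nat.lt_of_mul_lt_mul_left h2
    omega
  have hi2 : 2 * (i : ℕ) = n := by
    rw [hhk, mul_add] at hN
    omega
  obtain ⟨β, hβ, hβfix⟩ := hbs i j hi2 (by omega)
  rw [show n / 2 = (i : ℕ) by omega] at hβfix
  rw [hβ, pow_succ]
  refine mul_dvd_mul_left _ ?_
  by_contra hβ0
  have hii : (-i : Fin n) = i := Fin.ext (by have := val_add_val_neg hi; omega)
  obtain ⟨γ, hγm, hγ⟩ := hχ (by omega) i hi
  obtain ⟨α, hα⟩ := exists_mul_sub_dvd hπ hβ0 γ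
  have hy : D.π ∣ (mono D k i (D.π ^ j * α)).coeff 0 := by
    rw [coeff_mono_ne hi.symm]
    exact dvd_zero _
  have hyw : OffWeight w (mono D k i (D.π ^ j * α)) := (offWeight_mono i j α).mono (by omega)
  obtain ⟨z, hz, hz', hzw, hz0⟩ := hcomm hb hy hbw hyw
  have h1 := hs _ (mem_levelSub_iff.mpr ⟨_, hy, hyw, rfl⟩)
  refine hγ (Eq.trans (congrArg χ ?_) h1)
  change _ = constPart ((s : unip D k h)⁻¹ * _ * (s : unip D k h) * _)
  rw [hsb, hz']
  refine (constPart_subH ⟨_, hγm⟩).symm.trans ((constPart_eq_iff (dvd_layer _) hz).mpr ?_)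
  rw [coeff_const_zero]
  rw [coeff_zero_mono_mul hi, coeff_zero_mul_mono hi, hii, hβ] at hz0
  simp only [map_mul, map_pow, phi_pow_pi] at hz0
  have h2 : D.π ^ (h - 2 + 1) = D.π ^ j * D.π ^ j * D.π ^ k := by
    have hk : 0 < k := Nat.pos_of_ne_zero (NeZero.ne k)
    rw [← pow_add, ← pow_add]
    congr 1
    omega
  have h3 : D.π ∣ (D.φ ^ (i : ℕ)) γ - γ - (β * (D.φ ^ (i : ℕ)) α - α * (D.φ ^ (i : ℕ)) β) := by
    have h4 := (dvd_phi_pow_iff (i : ℕ)).mpr hα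
    rw [map_sub, map_mul] at h4
    have h5 := dvd_add (dvd_sub hα h4) ((hβfix.mul_right ((D.φ ^ (i : ℕ)) α)).add
      (hβfix.mul_left α))
    convert h5 using 1
    ring
  have h4 := mul_dvd_mul_left (D.π ^ (h - 2 + 1)) h3
  rw [← pow_succ] at h4
  have h5 := dvd_sub ((pow_dvd_pow D.π (show h ≤ h - 2 + 1 + 1 by omega)).trans h4) hz0
  convert h5 using 1
  rw [h2]
  ring

/-- Every irreducible representation whose central character is regular on the last layer is
induced from `H⁺`. -/
theorem exists_equiv_ind (hπ : Prime D.π) [Finite (O ⧸ Ideal.span {D.π})]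
    (hirr : ρ.IsIrreducible) {ω : Subgroup.center (unip D k h) →* Fˣ}
    (hρ : IsCentralCharacter ρ ω) (hω : k < h → LayerRegular ω) :
    ∃ χ : subH D k h →* Fˣ,
      (∀ (u : unip D k h) (hz : u ∈ Subgroup.center (unip D k h)) (hu : u ∈ subH D k h),
        χ ⟨u, hu⟩ = ω ⟨u, hz⟩) ∧ (k < h → LayerRegular χ) ∧
      ∀ χt : subHPlus D k h →* Fˣ, ExtendsSharp χ χt →
        Nonempty (ρ.Equiv (Representation.ind (subHPlus D k h).subtype (charRep χt))) := by
  have hV : Nontrivial V := by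
    by_contra hV
    rw [not_nontrivial_iff_subsingleton] at hV
    exact bot_ne_top (α := Subrepresentation ρ)
      (Subrepresentation.toSubmodule_injective (Subsingleton.elim _ _))
  obtain ⟨v, hv, hfix⟩ := exists_fixed_offSub ρ hπ hρ hω (n * (h - k)) 0 (by omega)
  obtain ⟨Λ, w, hw, hΛ, hΛ1⟩ := exists_eigenvector_of_fixed ρ
    (offSub_le_subHPrime.trans subHPrime_le_subHPlus)
    (fun s hs t ht => subHPlus_commutator hs ht) hv hfix
  have hHle : subH D k h ≤ subHPlus D k h := subH_le_subHPrime.trans subHPrime_le_subHPlus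
  set χ : subH D k h →* Fˣ := Λ.comp (Subgroup.inclusion hHle)
  have hχω : ∀ (u : unip D k h) (hz : u ∈ Subgroup.center (unip D k h)) (hu : u ∈ subH D k h),
      χ ⟨u, hu⟩ = ω ⟨u, hz⟩ := by
    intro u hz hu
    refine Units.ext (smul_left_injective F hw ?_)
    exact (hΛ ⟨u, hHle hu⟩).symm.trans (hρ ⟨u, hz⟩ w)
  have hχ : k < h → LayerRegular χ := by
    intro hk i hi
    obtain ⟨γ, hm, hγ⟩ := hω hk i hi
    exact ⟨γ, layer_mem_subH _, by rwa [hχω _ hm]⟩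
  have hΛχ : ExtendsSharp χ Λ := by
    rw [extendsSharp_iff]
    intro u hu
    obtain ⟨x, hx, hxw, hxu⟩ := mem_subHPrime_iff.mp hu
    obtain ⟨t, ht, a, ha, ha0, haw, hxa⟩ := exists_eq_mul_subH (h := h) hx hxw
    have haE : unipMk h a ha ∈ offSub D k h 0 := mem_offSub_iff.mpr ⟨a, ha, ha0, haw, rfl⟩
    have haP := offSub_le_subHPrime haE
    have hua : (u : unip D k h) = unipMk h a ha * t := hxu.trans hxa
    have hu' : u = ⟨_, subHPrime_le_subHPlus haP⟩ * ⟨t, hHle ht⟩ := Subtype.ext hua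
    have hcp : constPart (u : unip D k h) = ⟨t, ht⟩ := by
      rw [hua, constPart_mul_of_mem haP (subH_le_subHPrime ht), constPart_offSub haE, one_mul]
      exact constPart_subH ⟨t, ht⟩
    rw [hcp, hu', map_mul, hΛ1 _ haE, one_mul]
    rfl
  refine ⟨χ, hχω, hχ, fun χt hχt => ?_⟩
  obtain ⟨g, hg⟩ := exists_conj_extendsSharp ρ hπ hχ hΛχ hχt hΛ
  refine nonempty_equiv_ind _ _ ρ hirr (ind_isIrreducible hπ hχ hχt) (v := ρ g w)
    (fun h0 => hw ?_) hg
  have := congrArg (ρ g⁻¹) h0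
  rwa [← Module.End.mul_apply, ← map_mul, inv_mul_cancel, map_one, map_zero] at this

end Exhaustion

end TwistedOrder

/-! ### Finite fields -/

section FiniteFields

open Polynomial

variable {κ : Type*} [CommRing κ] [IsDomain κ] [Finite κ]

lemma ncard_rootSet_le (p : κ[X]) (hp : p ≠ 0) (S : Set κ) (hS : ∀ x ∈ S, p.eval x = 0) :
    S.ncard ≤ p.natDegree := by
  classical
  have h1 : S ⊆ (p.roots.toFinset : Set κ) := fun x hx => by
    simpa [hp] using hS x hx
  calc S.ncard ≤ (p.roots.toFinset : Set κ).ncard := Set.ncard_le_ncard h1 (Finset.finite_toSet _)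
    _ = p.roots.toFinset.card := Set.ncard_coe_finset _
    _ ≤ p.natDegree := (Multiset.toFinset_card_le _).trans (card_roots' p)

lemma ncard_pow_eq_self_le {m : ℕ} (hm : 1 < m) : {x : κ | x ^ m = x}.ncard ≤ m := by
  have hdeg : (X ^ m - X : κ[X]).natDegree = m := by
    rw [natDegree_sub_eq_left_of_natDegree_lt] <;> simp [hm]
  have hne : (X ^ m - X : κ[X]) ≠ 0 := by
    intro h
    rw [h, natDegree_zero] at hdeg
    omega
  calc _ ≤ _ := ncard_rootSet_le _ hne _ (fun x hx => by simpa [sub_eq_zero] using hx)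
    _ = m := hdeg

lemma exists_pow_ne_self {q n i : ℕ} (hcard : Nat.card κ = q ^ n) (hi : 0 < i) (hin : i < n) :
    ∃ x : κ, x ^ q ^ i ≠ x := by
  have hκ : 1 < Nat.card κ := Finite.one_lt_card
  have hq : 1 < q := by
    by_contra! h
    have := Nat.pow_le_pow_left h n
    rw [one_pow] at this
    omega
  by_contra! h
  have h1 := ncard_pow_eq_self_le (κ := κ) (Nat.one_lt_pow hi.ne' hq)
  rw [show {x : κ | x ^ q ^ i = x} = Set.univ from Set.eq_univ_of_forall h, Set.ncard_univ,
    hcard] at h1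
  exact absurd h1 (not_le.mpr (Nat.pow_lt_pow_right hq hin))

/-- Additive Hilbert 90 for a finite field with Frobenius `σ`, by counting: the kernel of `σ - 1`
has at most `q` elements and the kernel of the trace has at most `q^(n-1)`. -/
lemma exists_sub_eq_of_trace_eq_zero {q n : ℕ} (hn : 0 < n) (hcard : Nat.card κ = q ^ n)
    (σ : κ →+* κ) (hσ : ∀ x, σ x = x ^ q) {w : κ} (hw : ∑ j ∈ Finset.range n, w ^ q ^ j = 0) :
    ∃ v, w = σ v - v := by
  have hκ : 1 < Nat.card κ := Finite.one_lt_card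
  have hq : 1 < q := by
    by_contra! h
    have := Nat.pow_le_pow_left h n
    rw [one_pow] at this
    omega
  obtain ⟨m, rfl⟩ : ∃ m, n = m + 1 := ⟨n - 1, by omega⟩
  set g : κ →+ κ := (σ : κ →+ κ) - AddMonoidHom.id κ with hg
  have hg' : ∀ x, g x = σ x - x := fun x => rfl
  have hker : Nat.card g.ker ≤ q := by
    have h1 := ncard_pow_eq_self_le (κ := κ) hq
    rwa [show {x : κ | x ^ q = x} = (g.ker : Set κ) by
      ext x
      rw [SetLike.mem_coe, AddMonoidHom.mem_ker, hg', hσ, sub_eq_zero]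
      rfl, ← Nat.card_coe_set_eq] at h1
  have hrange : q ^ m ≤ Nat.card g.range := by
    have h1 := g.ker.card_mul_index
    rw [AddSubgroup.index_ker, hcard, pow_succ'] at h1
    have h2 := Nat.mul_le_mul_right (Nat.card g.range) hker
    rw [h1] at h2
    exact Nat.le_of_mul_le_mul_left h2 (by omega)
  have hfrob : ∀ v : κ, v ^ Nat.card κ = v := by
    let := (Finite.isField_of_domain κ).toField
    let := Fintype.ofFinite κ
    intro v
    rw [Nat.card_eq_fintype_card]
    exact FiniteField.pow_card v
  set T : Set κ := {w | ∑ j ∈ Finset.range (m + 1), w ^ q ^ j = 0} with hT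
  have hTle : T.ncard ≤ q ^ m := by
    set p : κ[X] := ∑ j ∈ Finset.range (m + 1), X ^ q ^ j with hp
    have hdeg : p.natDegree ≤ q ^ m := by
      refine natDegree_sum_le_of_forall_le _ _ fun j hj => ?_
      rw [natDegree_X_pow]
      exact Nat.pow_le_pow_right (by omega) (by simpa [Nat.lt_succ_iff] using hj)
    have hne : p ≠ 0 := by
      intro h
      have h1 : p.coeff 1 = 1 := by
        rw [hp, finsetSum_coeff, Finset.sum_eq_single 0]
        · simp
        · intro j _ hj
          rw [coeff_X_pow, if_neg]
          exact (Nat.one_lt_pow hj hq).ne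
        · simp
      rw [h] at h1
      simp at h1
    exact (ncard_rootSet_le p hne T fun x hx => by
      rw [hp, eval_finsetSum]
      simpa only [eval_pow, eval_X] using
        (show ∑ j ∈ Finset.range (m + 1), x ^ q ^ j = 0 from hx)).trans hdeg
  have hsub : (g.range : Set κ) ⊆ T := by
    rintro _ ⟨v, rfl⟩
    have hpow : ∀ j, (g v) ^ q ^ j = v ^ q ^ (j + 1) - v ^ q ^ j := by
      intro j
      induction j with
      | zero => simp [hg', hσ]
      | succ j ih =>
        rw [pow_succ q j, pow_mul, ih, ← hσ, map_sub, hσ, hσ, ← pow_mul, ← pow_mul, ← pow_succ,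
          ← pow_succ]
    rw [hT, Set.mem_ofPred_eq, Finset.sum_congr rfl fun j _ => hpow j,
      Finset.sum_range_sub (fun j => v ^ q ^ j), ← hcard, hfrob v, pow_zero,
      pow_one, sub_self]
  have heq : (g.range : Set κ) = T := Set.eq_of_subset_of_ncard_le hsub (by
    rw [← Nat.card_coe_set_eq (g.range : Set κ)]
    exact hTle.trans hrange) (Set.toFinite _)
  obtain ⟨v, hv⟩ : w ∈ (g.range : Set κ) := heq ▸ hw
  exact ⟨v, hv.symm⟩

/-- The kernel of `σ - 1` is the fixed field of `σ`; a nonzero `δ = σ(x) - x` satisfies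
`σ(δ) = -δ`, and multiplication by `δ` maps the fixed field onto the image of `σ - 1`. -/
lemma index_fixed_sq (σ : κ →+* κ) (hσ : ∀ x, σ (σ x) = x) (hne : ∃ x, σ x ≠ x) :
    (((σ : κ →+ κ) - AddMonoidHom.id κ).ker).index ^ 2 = Nat.card κ := by
  set g : κ →+ κ := (σ : κ →+ κ) - AddMonoidHom.id κ with hg
  have hg' : ∀ x, g x = σ x - x := fun x => rfl
  obtain ⟨x, hx⟩ := hne
  have hδ0 : g x ≠ 0 := sub_ne_zero.mpr hx
  have hσδ : σ (g x) = -g x := by rw [hg', map_sub, hσ, neg_sub]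
  obtain ⟨c, hc⟩ := (Finite.isField_of_domain κ).mul_inv_cancel hδ0
  have hcard : Nat.card g.ker = Nat.card g.range := by
    refine Nat.card_eq_of_bijective (fun b => ⟨g x * b, x * b, ?_⟩) ⟨fun a b h => ?_, fun r => ?_⟩
    · have hb : σ b = b := sub_eq_zero.mp b.2
      rw [hg', hg', map_mul, hb]
      ring
    · exact Subtype.ext (mul_left_cancel₀ hδ0 (congrArg Subtype.val h))
    · obtain ⟨r, v, rfl⟩ := r
      refine ⟨⟨c * g v, ?_⟩, Subtype.ext ?_⟩
      · have h2 : σ (g v) = -g v := by rw [hg', map_sub, hσ, neg_sub]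
        have h3 : σ c = -c := by
          have h4 := congrArg σ hc
          rw [map_mul, map_one, hσδ] at h4
          refine mul_left_cancel₀ hδ0 ?_
          linear_combination -h4 + hc
        rw [AddMonoidHom.mem_ker, hg', map_mul, h2, h3]
        ring
      · change g x * (c * g v) = g v
        rw [← mul_assoc, hc, one_mul]
  have h1 := g.ker.card_mul_index
  rw [hcard, ← AddSubgroup.index_ker, ← sq] at h1
  exact h1

end FiniteFields

/-! ### The index of `H⁺` -/

namespace TwistedOrder

variable {O : Type*} [CommRing O] {n : ℕ} {D : CyclicData O n} {k h : ℕ} [NeZero n] [NeZero k]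

section Index

/-- The truncation ideal as an additive group. -/
abbrev truncAdd (D : CyclicData O n) (k h : ℕ) : AddSubgroup (TwistedOrder D k) :=
  (truncIdeal D k h).toAddSubgroup

/-- The classes of `1 + x`, `x ∈ J`, are counted by the quotient of `J` by the truncation ideal. -/
lemma natCard_oneAdd {J : NonUnitalSubring (TwistedOrder D k)} (hJ : J ≤ jUnip D k) :
    Nat.card ((oneAdd h J hJ).subgroupOf (unip D k h)) =
      (truncAdd D k h).relIndex J.toAddSubgroup := by
  let f : J.toAddSubgroup → (oneAdd h J hJ).subgroupOf (unip D k h) := fun x =>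
    ⟨unipMk h x.1 (hJ x.2), (mem_subgroupOf_iff hJ).mpr ⟨x.1, hJ x.2, x.2, rfl⟩⟩
  have hf : ∀ x y, f x = f y ↔ x.1 - y.1 ∈ truncIdeal D k h := fun x y =>
    Subtype.ext_iff.trans (unipMk_eq_iff (hJ x.2) (hJ y.2))
  have hrel : ∀ x y : J.toAddSubgroup,
      QuotientAddGroup.leftRel ((truncAdd D k h).addSubgroupOf J.toAddSubgroup) x y ↔
        f x = f y := by
    intro x y
    rw [QuotientAddGroup.leftRel_apply, AddSubgroup.mem_addSubgroupOf, eq_comm, hf]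
    refine iff_of_eq (congrArg (· ∈ truncIdeal D k h) ?_)
    exact neg_add_eq_sub _ _
  symm
  refine Nat.card_eq_of_bijective
    (Quotient.lift f fun x y hxy => (hrel x y).mp hxy) ⟨?_, ?_⟩
  · rintro ⟨x⟩ ⟨y⟩ hxy
    exact Quotient.sound ((hrel x y).mpr hxy)
  · rintro ⟨u, hu⟩
    obtain ⟨x, hx, hx', rfl⟩ := (mem_subgroupOf_iff hJ).mp hu
    exact ⟨Quotient.mk _ ⟨x, hx'⟩, rfl⟩

lemma natCard_unip : Nat.card (unip D k h) =
    (truncAdd D k h).relIndex (jUnip D k).toAddSubgroup := by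
  rw [← natCard_oneAdd (h := h) (le_refl (jUnip D k)), show
    (oneAdd h (jUnip D k) le_rfl).subgroupOf (unip D k h) = ⊤ from Subgroup.subgroupOf_self _]
  exact (Nat.card_congr Subgroup.topEquiv.toEquiv).symm

lemma trunc_le_jUnip [NeZero h] : truncAdd D k h ≤ (jUnip D k).toAddSubgroup := fun _ ha =>
  (dvd_pow_self D.π (NeZero.ne h)).trans (dvd_coeff_zero_of_mem ha)

lemma trunc_le_jPlus [NeZero h] : truncAdd D k h ≤ (jPlus D k h).toAddSubgroup := by
  intro a ha
  refine mem_jPlus_iff.mpr ⟨trunc_le_jUnip ha, fun i hi => ⟨h - k, dvd_coeff_of_mem ha hi, ?_⟩,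
    fun i j hi hj => ?_⟩
  · have := Nat.le_mul_of_pos_left (h - k) (Nat.pos_of_ne_zero (NeZero.ne n))
    have : (i : ℕ) ≠ 0 := fun h => hi (Fin.ext h)
    omega
  · have hi0 : i ≠ 0 := by
      rintro rfl
      exact NeZero.ne n (by simpa using hi.symm)
    obtain ⟨y, hy⟩ := (pow_dvd_pow D.π (show j + 1 ≤ h - k by omega)).trans
      (dvd_coeff_of_mem ha hi0)
    refine ⟨D.π * y, by rw [hy, pow_succ, mul_assoc], ?_⟩
    rw [map_mul, phi_pow_pi, ← mul_sub]
    exact dvd_mul_right _ _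

/-- The index of `H⁺`, in terms of additive indices. -/
lemma index_subHPlus_mul [NeZero h] (hfin : (truncAdd D k h).index ≠ 0) :
    (subHPlus D k h).index * (jUnip D k).toAddSubgroup.index =
      (jPlus D k h).toAddSubgroup.index := by
  have h1 := AddSubgroup.relIndex_mul_index (trunc_le_jUnip (D := D) (k := k) (h := h))
  have h2 := AddSubgroup.relIndex_mul_index (trunc_le_jPlus (D := D) (k := k) (h := h))
  have h3 := (subHPlus D k h).card_mul_index
  have h4 : Nat.card (subHPlus D k h) = _ := natCard_oneAdd (h := h) _
  rw [h4, natCard_unip] at h3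
  have h5 : (truncAdd D k h).relIndex (jPlus D k h).toAddSubgroup ≠ 0 :=
    left_ne_zero_of_mul (h2.trans_ne hfin)
  refine Nat.eq_of_mul_eq_mul_left (Nat.pos_of_ne_zero h5) ?_
  rw [← mul_assoc, h3, h1, h2]

lemma finite_unip [NeZero h] (hfin : (truncAdd D k h).index ≠ 0) : Finite (unip D k h) := by
  have h1 := AddSubgroup.relIndex_mul_index (trunc_le_jUnip (D := D) (k := k) (h := h))
  refine Nat.finite_of_card_ne_zero ?_
  rw [natCard_unip]
  exact left_ne_zero_of_mul (h1.trans_ne hfin)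

/-- The additive map `x ↦ x τ^i`. -/
def monoHom (D : CyclicData O n) (k : ℕ) (i : Fin n) : O →+ TwistedOrder D k where
  toFun := mono D k i
  map_zero' := TwistedOrder.ext (Pi.single_zero (M := fun _ => O) i)
  map_add' x y := TwistedOrder.ext (Pi.single_add (f := fun _ => O) i x y)

/-- An additive group defined by conditions on the single coefficients has as index the product
of the indices of these conditions. -/
lemma index_eq_prod {J : AddSubgroup (TwistedOrder D k)}
    (hJ : ∀ a ∈ J, ∀ i, mono D k i (a.coeff i) ∈ J) :
    J.index = ∏ i, (J.comap (monoHom D k i)).index := by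
  let c : TwistedOrder D k →+ (Fin n → O) :=
    { toFun := coeff, map_zero' := rfl, map_add' := fun _ _ => rfl }
  have hc : Function.Surjective c := fun f => ⟨⟨f⟩, rfl⟩
  rw [← AddSubgroup.index_pi, ← AddSubgroup.index_comap_of_surjective _ hc]
  congr 1
  ext a
  rw [AddSubgroup.mem_comap, AddSubgroup.mem_pi]
  refine ⟨fun ha i _ => hJ a ha i, fun ha => ?_⟩
  have : a = ∑ i, monoHom D k i (a.coeff i) := by
    apply coeff_injective
    change c a = c _
    rw [map_sum]
    exact (Finset.univ_sum_single a.coeff).symm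
  rw [this]
  exact J.sum_mem fun i _ => ha i (Set.mem_univ i)

variable [IsDomain O]

/-- Multiplication by `π`. -/
abbrev mulPi (D : CyclicData O n) : O →+ O := AddMonoidHom.mulLeft D.π

lemma index_range_mulPi : (mulPi D).range.index = Nat.card (O ⧸ Ideal.span {D.π}) := by
  have : (mulPi D).range = (Ideal.span {D.π}).toAddSubgroup := by
    ext x
    change (∃ y, D.π * y = x) ↔ x ∈ Ideal.span {D.π}
    rw [Ideal.mem_span_singleton]
    exact ⟨fun ⟨y, hy⟩ => ⟨y, hy.symm⟩, fun ⟨y, hy⟩ => ⟨y, hy.symm⟩⟩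
  rw [this]
  rfl

lemma index_pow_mul (hπ : D.π ≠ 0) (e : ℕ) {A B : AddSubgroup O}
    (hAB : ∀ x, x ∈ A ↔ ∃ b ∈ B, x = D.π ^ e * b) :
    A.index = B.index * Nat.card (O ⧸ Ideal.span {D.π}) ^ e := by
  induction e generalizing A with
  | zero =>
    have : A = B := by ext x; simp [hAB]
    rw [this, pow_zero, mul_one]
  | succ e ih =>
    have hinj : Function.Injective (mulPi D) := mul_right_injective₀ hπ
    have hcomap := ih (A := A.comap (mulPi D)) (fun x => by
      rw [AddSubgroup.mem_comap, hAB]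
      refine exists_congr fun b => and_congr_right fun _ => ?_
      rw [pow_succ', mul_assoc]
      exact mul_right_inj' hπ)
    have hmap : (A.comap (mulPi D)).map (mulPi D) = A := by
      refine AddSubgroup.map_comap_eq_self fun x hx => ?_
      obtain ⟨b, -, rfl⟩ := (hAB x).mp hx
      exact ⟨D.π ^ e * b, by rw [pow_succ', mul_assoc]; rfl⟩
    rw [← hmap, AddSubgroup.index_map_of_injective _ hinj, hcomap, index_range_mulPi, pow_succ,
      mul_assoc]

lemma index_pow (hπ : D.π ≠ 0) (e : ℕ) {A : AddSubgroup O} (hA : ∀ x, x ∈ A ↔ D.π ^ e ∣ x) :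
    A.index = Nat.card (O ⧸ Ideal.span {D.π}) ^ e := by
  rw [index_pow_mul hπ e (B := ⊤) fun x => (hA x).trans ⟨fun ⟨b, hb⟩ => ⟨b, trivial, hb⟩,
    fun ⟨b, _, hb⟩ => ⟨b, hb⟩⟩, AddSubgroup.index_top, one_mul]

lemma index_truncAdd_ne_zero (hπ : D.π ≠ 0) [Finite (O ⧸ Ideal.span {D.π})] :
    (truncAdd D k h).index ≠ 0 := by
  have hmono : ∀ (i : Fin n) (x : O),
      mono D k i x ∈ truncIdeal D k h ↔ D.π ^ (if i = 0 then h else h - k) ∣ x := by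
    refine fun i x => ⟨fun H => ?_, fun H l => ?_⟩
    · have := H i
      rwa [coeff_mono_self] at this
    · by_cases hl : l = i
      · subst hl
        rwa [coeff_mono_self]
      · rw [coeff_mono_ne hl]
        exact dvd_zero _
  have hmem : ∀ a ∈ truncAdd D k h, ∀ i, mono D k i (a.coeff i) ∈ truncAdd D k h :=
    fun a ha i => (hmono i _).mpr (ha i)
  rw [index_eq_prod hmem, Finset.prod_ne_zero_iff]
  intro i _
  rw [index_pow (D := D) hπ (if i = 0 then h else h - k) fun x => hmono i x]
  exact pow_ne_zero _ Nat.card_pos.ne'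

lemma mono_mem_jUnip_iff {i : Fin n} {x : O} :
    mono D k i x ∈ jUnip D k ↔ (i = 0 → D.π ∣ x) := by
  change D.π ∣ (mono D k i x).coeff 0 ↔ _
  by_cases hi : i = 0
  · subst hi
    rw [coeff_mono_self, imp_iff_right rfl]
  · simp [coeff_mono_ne (Ne.symm hi), hi]

lemma index_jUnip (hπ : D.π ≠ 0) : (jUnip D k).toAddSubgroup.index =
    Nat.card (O ⧸ Ideal.span {D.π}) := by
  rw [index_eq_prod fun a (ha : D.π ∣ a.coeff 0) i =>
      mono_mem_jUnip_iff.mpr fun hi => hi ▸ ha, Finset.prod_eq_single 0]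
  · rw [index_pow hπ 1, pow_one]
    intro x
    rw [pow_one]
    exact (mono_mem_jUnip_iff (D := D) (k := k)).trans (by simp)
  · intro i _ hi
    rw [AddSubgroup.index_eq_one, eq_top_iff]
    exact fun x _ => (mono_mem_jUnip_iff (D := D) (k := k)).mpr fun h => absurd h hi
  · simp

lemma mono_mem_jPlus_zero {x : O} : mono D k 0 x ∈ jPlus D k h ↔ D.π ∣ x := by
  rw [mem_jPlus_iff, coeff_mono_self]
  refine ⟨fun H => H.1, fun H => ⟨H, offWeight_const _ x, fun i j hi _ => ?_⟩⟩
  have hi0 : i ≠ 0 := by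
    rintro rfl
    exact NeZero.ne n (by simpa using hi.symm)
  exact ⟨0, by rw [coeff_mono_ne hi0, mul_zero], by simp⟩

lemma mono_mem_jPlus_iff {i : Fin n} (hi : i ≠ 0) {x : O} : mono D k i x ∈ jPlus D k h ↔
    (∃ e, D.π ^ e ∣ x ∧ (n * (h - k) + 1) / 2 ≤ (i : ℕ) + n * e) ∧
      ∀ j : ℕ, 2 * (i : ℕ) = n → 2 * j + 1 + k = h →
        ∃ b, x = D.π ^ j * b ∧ D.π ∣ (D.φ ^ (n / 2)) b - b := by
  rw [mem_jPlus_iff, coeff_mono_ne (Ne.symm hi)]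
  refine (and_iff_right (dvd_zero _)).trans (and_congr ⟨fun H => ?_, fun H l hl => ?_⟩
    ⟨fun H j h2 hj => ?_, fun H l j h2 hj => ?_⟩)
  · have := H i hi
    rwa [coeff_mono_self] at this
  · by_cases hli : l = i
    · subst hli
      rwa [coeff_mono_self]
    · obtain ⟨e, -, he⟩ := H
      refine ⟨(n * (h - k) + 1) / 2, by rw [coeff_mono_ne hli]; exact dvd_zero _, ?_⟩
      have := Nat.le_mul_of_pos_left ((n * (h - k) + 1) / 2) (Nat.pos_of_ne_zero (NeZero.ne n))
      omega
  · have := H i j h2 hj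
    rwa [coeff_mono_self] at this
  · by_cases hli : l = i
    · subst hli
      rw [coeff_mono_self]
      exact H j h2 hj
    · exact ⟨0, by rw [coeff_mono_ne hli, mul_zero], by simp⟩

lemma mono_mem_jPlus {a : TwistedOrder D k} (ha : a ∈ jPlus D k h) (i : Fin n) :
    mono D k i (a.coeff i) ∈ jPlus D k h := by
  obtain ⟨h1, h2, h3⟩ := mem_jPlus_iff.mp ha
  by_cases hi : i = 0
  · subst hi
    exact mono_mem_jPlus_zero.mpr h1
  · exact (mono_mem_jPlus_iff hi).mpr ⟨h2 i hi, fun j => h3 i j⟩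

/-- The `i`-th coefficients of the elements of `jPlus`. -/
abbrev plusCoeff (D : CyclicData O n) (k h : ℕ) [NeZero k] (i : Fin n) : AddSubgroup O :=
  (jPlus D k h).toAddSubgroup.comap (monoHom D k i)

lemma index_jPlus (hπ : D.π ≠ 0) : (jPlus D k h).toAddSubgroup.index =
    (∏ i ∈ Finset.univ.erase (0 : Fin n), (plusCoeff D k h i).index) *
      Nat.card (O ⧸ Ideal.span {D.π}) := by
  rw [index_eq_prod fun a ha i => mono_mem_jPlus ha i,
    ← Finset.prod_erase_mul _ _ (Finset.mem_univ (0 : Fin n))]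
  congr 1
  rw [index_pow hπ 1, pow_one]
  intro x
  rw [pow_one]
  exact mono_mem_jPlus_zero (D := D) (k := k) (h := h)

lemma index_plusCoeff (hπ : D.π ≠ 0) {i : Fin n} (hi : i ≠ 0) {e : ℕ}
    (hspec : ∀ j, 2 * (i : ℕ) = n → 2 * j + 1 + k ≠ h)
    (he : ∀ m, (n * (h - k) + 1) / 2 ≤ (i : ℕ) + n * m ↔ e ≤ m) :
    (plusCoeff D k h i).index = Nat.card (O ⧸ Ideal.span {D.π}) ^ e := by
  refine index_pow (D := D) hπ e fun x =>
    (mono_mem_jPlus_iff (D := D) (k := k) (h := h) hi).trans ⟨?_, fun H => ⟨?_, ?_⟩⟩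
  · rintro ⟨⟨m, hm, hm'⟩, -⟩
    exact (pow_dvd_pow _ ((he m).mp hm')).trans hm
  · exact ⟨e, H, (he e).mpr le_rfl⟩
  · exact fun j h2 hj => absurd hj (hspec j h2)

/-- In the middle degree `n / 2` with `h - k` odd, the last coordinate runs through the fixed field
of the involution `φ^(n/2)`, which has index the square root of the cardinality. -/
lemma index_plusCoeff_sq (hπ : Prime D.π) [Finite (O ⧸ Ideal.span {D.π})]
    (hφ : ∀ i, 0 < i → i < n → ∃ x, ¬ D.π ∣ (D.φ ^ i) x - x) {i : Fin n}
    (hi2 : 2 * (i : ℕ) = n) {j : ℕ} (hj : 2 * j + 1 + k = h) :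
    (plusCoeff D k h i).index ^ 2 = Nat.card (O ⧸ Ideal.span {D.π}) ^ (h - k) := by
  have hn : 0 < n := Nat.pos_of_ne_zero (NeZero.ne n)
  have hi : i ≠ 0 := by
    rintro rfl
    exact NeZero.ne n (by simpa using hi2.symm)
  have hprime : (Ideal.span {D.π}).IsPrime := (Ideal.span_singleton_prime hπ.ne_zero).mpr hπ
  let f : O →+* O := ((D.φ ^ (n / 2) : RingAut O) : O ≃+* O).toRingHom
  let σ : O ⧸ Ideal.span {D.π} →+* O ⧸ Ideal.span {D.π} :=
    Ideal.quotientMap _ f (by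
      rw [Ideal.span_singleton_le_iff_mem, Ideal.mem_comap, Ideal.mem_span_singleton]
      exact dvd_of_eq (phi_pow_pi D _).symm)
  have hσ : ∀ x : O, σ (Ideal.Quotient.mk _ x) = Ideal.Quotient.mk _ ((D.φ ^ (n / 2)) x) :=
    fun x => Ideal.quotientMap_mk
  have hσσ : ∀ x, σ (σ x) = x := by
    intro x
    obtain ⟨x, rfl⟩ := Ideal.Quotient.mk_surjective x
    rw [hσ, hσ, ← RingAut.mul_apply, ← pow_add, show n / 2 + n / 2 = n by omega, D.φ_pow]
    rfl
  have hmk : ∀ x : O, σ (Ideal.Quotient.mk _ x) = Ideal.Quotient.mk _ x ↔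
      D.π ∣ (D.φ ^ (n / 2)) x - x := fun x => by
    rw [hσ, Ideal.Quotient.eq, Ideal.mem_span_singleton]
  have hne : ∃ x, σ x ≠ x := by
    obtain ⟨x, hx⟩ := hφ (n / 2) (by omega) (by omega)
    exact ⟨Ideal.Quotient.mk _ x, fun H => hx ((hmk x).mp H)⟩
  set B : AddSubgroup O := AddSubgroup.comap (Ideal.Quotient.mk (Ideal.span {D.π}) : O →+ _)
    (((σ : O ⧸ Ideal.span {D.π} →+ O ⧸ Ideal.span {D.π}) - AddMonoidHom.id _).ker) with hB
  have hBmem : ∀ b, b ∈ B ↔ D.π ∣ (D.φ ^ (n / 2)) b - b := fun b =>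
    sub_eq_zero.trans (hmk b)
  have hBidx : B.index ^ 2 = Nat.card (O ⧸ Ideal.span {D.π}) := by
    rw [hB, AddSubgroup.index_comap_of_surjective _ Ideal.Quotient.mk_surjective,
      index_fixed_sq σ hσσ hne]
  rw [index_pow_mul hπ.ne_zero j (B := B), mul_pow, hBidx, ← pow_mul, ← pow_succ',
    show h - k = j * 2 + 1 by omega]
  intro x
  refine (mono_mem_jPlus_iff (D := D) (k := k) (h := h) hi).trans ⟨?_, ?_⟩
  · rintro ⟨-, H⟩
    obtain ⟨b, rfl, hb⟩ := H j hi2 hj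
    exact ⟨b, (hBmem b).mpr hb, rfl⟩
  · rintro ⟨b, hb, rfl⟩
    refine ⟨⟨j, dvd_mul_right _ _, ?_⟩, fun j' _ hj' => ⟨b, ?_, (hBmem b).mp hb⟩⟩
    · rw [show h - k = 2 * j + 1 by omega, mul_add, mul_left_comm]
      omega
    · rw [show j' = j by omega]

/-- The degrees `i` and `-i` together contribute `(O : π)^(h-k)` to the index. -/
lemma index_plusCoeff_mul_neg (hπ : Prime D.π) [Finite (O ⧸ Ideal.span {D.π})]
    (hφ : ∀ i, 0 < i → i < n → ∃ x, ¬ D.π ∣ (D.φ ^ i) x - x) {i : Fin n} (hi : i ≠ 0) :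
    (plusCoeff D k h i).index * (plusCoeff D k h (-i)).index =
      Nat.card (O ⧸ Ideal.span {D.π}) ^ (h - k) := by
  have hi' : -i ≠ 0 := neg_ne_zero.mpr hi
  have hsum := val_add_val_neg hi
  have hlt := i.2
  have hlt' := (-i).2
  have hi0 : (i : ℕ) ≠ 0 := fun h => hi (Fin.ext h)
  by_cases hspec : 2 * (i : ℕ) = n ∧ ∃ j, 2 * j + 1 + k = h
  · obtain ⟨h2, j, hj⟩ := hspec
    rw [show -i = i from Fin.ext (by omega), ← sq, index_plusCoeff_sq hπ hφ h2 hj]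
  rw [not_and, not_exists] at hspec
  -- multiples of `n` are compared through their quotients
  have hmul : ∀ (c m s : ℕ), s < n → (n * c ≤ s + n * m ↔ c ≤ m) := by
    intro c m s hs
    constructor
    · intro H
      by_contra! hcm
      have := Nat.mul_le_mul_left n hcm
      rw [Nat.mul_succ] at this
      omega
    · intro H
      have := Nat.mul_le_mul_left n H
      omega
  obtain ⟨c, hc | hc⟩ := Nat.even_or_odd' (h - k)
  · have hw : (n * (h - k) + 1) / 2 = n * c := by
      rw [hc, mul_left_comm]
      omega
    rw [index_plusCoeff hπ.ne_zero hi (e := c) (fun j _ => by omega)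
        (fun m => by rw [hw]; exact hmul c m _ hlt),
      index_plusCoeff hπ.ne_zero hi' (e := c) (fun j _ => by omega)
        (fun m => by rw [hw]; exact hmul c m _ hlt'), ← pow_add, hc, two_mul]
  · have hne : 2 * (i : ℕ) ≠ n := fun h2 => hspec h2 c (by omega)
    have hw : (n * (h - k) + 1) / 2 = n * c + (n + 1) / 2 := by
      rw [hc, mul_add, mul_left_comm]
      omega
    have hlarge : ∀ s m : ℕ, s < n → n < 2 * s →
        ((n * (h - k) + 1) / 2 ≤ s + n * m ↔ c ≤ m) := by
      intro s m hs hs2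
      rw [hw, ← hmul c m (s - (n + 1) / 2) (by omega)]
      omega
    have hsmall : ∀ s m : ℕ, 0 < s → 2 * s < n →
        ((n * (h - k) + 1) / 2 ≤ s + n * m ↔ c + 1 ≤ m) := by
      intro s m hs hs2
      rw [hw, ← hmul (c + 1) m (s + (n - (n + 1) / 2)) (by omega), mul_add]
      omega
    rcases lt_or_gt_of_ne hne with hlt2 | hgt2
    · rw [index_plusCoeff hπ.ne_zero hi (e := c + 1) (fun j h2 => absurd h2 hne)
          (fun m => hsmall _ m (by omega) hlt2),
        index_plusCoeff hπ.ne_zero hi' (e := c) (fun j h2 => by omega)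
          (fun m => hlarge _ m hlt' (by omega)), ← pow_add, hc]
      congr 1
      omega
    · rw [index_plusCoeff hπ.ne_zero hi (e := c) (fun j h2 => absurd h2 hne)
          (fun m => hlarge _ m hlt hgt2),
        index_plusCoeff hπ.ne_zero hi' (e := c + 1) (fun j h2 => by omega)
          (fun m => hsmall _ m (by omega) (by omega)), ← pow_add, hc]
      congr 1
      omega

/-- The square of the index is the product of the contributions of all pairs `{i, -i}`, `i ≠ 0`. -/
theorem index_subHPlus [NeZero h] (hπ : Prime D.π) [Finite (O ⧸ Ideal.span {D.π})]
    (hφ : ∀ i, 0 < i → i < n → ∃ x, ¬ D.π ∣ (D.φ ^ i) x - x) {q : ℕ}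
    (hq : Nat.card (O ⧸ Ideal.span {D.π}) = q ^ n) :
    (subHPlus D k h).index = q ^ (n * (n - 1) * (h - k) / 2) := by
  have h1 := index_subHPlus_mul (D := D) (k := k) (h := h) (index_truncAdd_ne_zero hπ.ne_zero)
  rw [index_jUnip hπ.ne_zero, index_jPlus hπ.ne_zero] at h1
  have h2 := Nat.eq_of_mul_eq_mul_right Nat.card_pos h1
  have h3 : ∏ i ∈ Finset.univ.erase (0 : Fin n), (plusCoeff D k h i).index =
      ∏ i ∈ Finset.univ.erase (0 : Fin n), (plusCoeff D k h (-i)).index :=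
    Finset.prod_nbij' (fun i => -i) (fun i => -i) (by simp) (by simp) (by simp) (by simp)
      (by simp)
  refine Nat.pow_left_injective (two_ne_zero) ?_
  change _ ^ 2 = (q ^ _) ^ 2
  have h4 : n * (n - 1) * (h - k) / 2 * 2 = n * ((h - k) * (n - 1)) := by
    rw [Nat.div_mul_cancel ((Nat.even_mul_pred_self n).two_dvd.mul_right _)]
    ring
  rw [h2, ← pow_mul, h4, sq]
  nth_rewrite 2 [h3]
  rw [← Finset.prod_mul_distrib,
    Finset.prod_congr rfl fun i hi => index_plusCoeff_mul_neg hπ hφ (Finset.ne_of_mem_erase hi),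
    Finset.prod_const, Finset.card_erase_of_mem (Finset.mem_univ _), Finset.card_univ,
    Fintype.card_fin, hq, ← pow_mul, ← pow_mul]

end Index

end TwistedOrder

/-! ### Frobenius, stabilizers and the local field -/

namespace TwistedOrder

variable {O : Type*} [CommRing O] {n : ℕ} {D : CyclicData O n} {k h : ℕ} [NeZero n] [NeZero k]

section Frobenius

variable {q : ℕ}

lemma mk_phi_pow (hφ : ∀ x, D.π ∣ D.φ x - x ^ q) (j : ℕ) (x : O) :
    Ideal.Quotient.mk (Ideal.span {D.π}) ((D.φ ^ j) x) =
      Ideal.Quotient.mk (Ideal.span {D.π}) x ^ q ^ j := by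
  induction j generalizing x with
  | zero => simp
  | succ j ih =>
    rw [pow_succ, RingAut.mul_apply, ih, pow_succ', pow_mul]
    congr 1
    rw [← map_pow, Ideal.Quotient.eq, Ideal.mem_span_singleton]
    exact hφ x

lemma exists_not_dvd_phi_pow_sub (hπ : Prime D.π) (hφ : ∀ x, D.π ∣ D.φ x - x ^ q)
    (hq : Nat.card (O ⧸ Ideal.span {D.π}) = q ^ n) [Finite (O ⧸ Ideal.span {D.π})] (i : ℕ)
    (hi : 0 < i) (hin : i < n) : ∃ x, ¬ D.π ∣ (D.φ ^ i) x - x := by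
  have : (Ideal.span {D.π}).IsPrime := (Ideal.span_singleton_prime hπ.ne_zero).mpr hπ
  obtain ⟨x, hx⟩ := exists_pow_ne_self hq hi hin
  obtain ⟨x, rfl⟩ := Ideal.Quotient.mk_surjective x
  refine ⟨x, fun H => hx ?_⟩
  rwa [← mk_phi_pow hφ, Ideal.Quotient.eq, Ideal.mem_span_singleton]

/-- Additive Hilbert 90 for the residue field. -/
lemma exists_phi_sub_dvd (hπ : Prime D.π) (hφ : ∀ x, D.π ∣ D.φ x - x ^ q)
    (hq : Nat.card (O ⧸ Ideal.span {D.π}) = q ^ n) [Finite (O ⧸ Ideal.span {D.π})] {w : O}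
    (hw : ∑ j ∈ Finset.range n, (D.φ ^ j) w = 0) : ∃ v, D.π ∣ w - (D.φ v - v) := by
  have : (Ideal.span {D.π}).IsPrime := (Ideal.span_singleton_prime hπ.ne_zero).mpr hπ
  let σ : O ⧸ Ideal.span {D.π} →+* O ⧸ Ideal.span {D.π} :=
    Ideal.quotientMap _ (D.φ : O ≃+* O).toRingHom (by
      rw [Ideal.span_singleton_le_iff_mem, Ideal.mem_comap, Ideal.mem_span_singleton]
      exact dvd_of_eq D.φ_π.symm)
  have hσ' : ∀ x : O, σ (Ideal.Quotient.mk _ x) = Ideal.Quotient.mk _ (D.φ x) :=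
    fun x => Ideal.quotientMap_mk
  have hσ : ∀ x, σ x = x ^ q := by
    intro x
    obtain ⟨x, rfl⟩ := Ideal.Quotient.mk_surjective x
    have := mk_phi_pow hφ 1 x
    rwa [pow_one, pow_one, ← hσ'] at this
  obtain ⟨v, hv⟩ := exists_sub_eq_of_trace_eq_zero (w := Ideal.Quotient.mk _ w)
    (Nat.pos_of_ne_zero (NeZero.ne n)) hq σ hσ (by
      rw [← Finset.sum_congr rfl fun j _ => mk_phi_pow hφ j w, ← map_sum, hw, map_zero])
  obtain ⟨v, rfl⟩ := Ideal.Quotient.mk_surjective v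
  refine ⟨v, ?_⟩
  rwa [hσ', ← map_sub, Ideal.Quotient.eq, Ideal.mem_span_singleton] at hv

end Frobenius

section Stabilizer

lemma Represents.mul {a b : TwistedOrder D k} {u v : unip D k h} (ha : Represents a u)
    (hb : Represents b v) : Represents (a * b) (u * v) := by
  rw [Represents] at *
  rw [Subgroup.coe_mul, Units.val_mul, ← ha, ← hb]
  exact map_mul _ _ _

lemma Represents.eq_iff {a b : TwistedOrder D k} {u v : unip D k h} (ha : Represents a u)
    (hb : Represents b v) : u = v ↔ a - b ∈ truncIdeal D k h := by
  rw [← Ideal.Quotient.eq]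
  rw [Represents] at ha hb
  exact ⟨fun H => ha.trans (H ▸ hb.symm), fun H => unip_ext (ha.symm.trans (H.trans hb))⟩

lemma const_sub (x y : O) : const D k (x - y) = const D k x - const D k y :=
  TwistedOrder.ext (Pi.single_sub (f := fun _ => O) 0 x y)

lemma const_mul (x y : O) : const D k (x * y) = const D k x * const D k y := by
  ext l
  rw [coeff_const_mul]
  by_cases hl : l = 0
  · rw [hl, coeff_const_zero, coeff_const_zero]
  · rw [coeff_const_ne hl, coeff_const_ne hl, mul_zero]

lemma dvd_sub_one_of_represents [NeZero h] {x : O} {u : unip D k h}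
    (hu : Represents (const D k x) u) : D.π ∣ x - 1 := by
  obtain ⟨y, hy, rfl⟩ := exists_unipMk u
  have h1 := (dvd_pow_self D.π (NeZero.ne h)).trans
    (dvd_coeff_zero_of_mem ((represents_unipMk_iff hy).mp hu))
  rw [coeff_sub, coeff_add, coeff_const_zero, coeff_one, if_pos rfl] at h1
  convert dvd_add h1 hy using 1
  ring

lemma mem_subH_of_represents [NeZero h] {x : O} {u : unip D k h}
    (hu : Represents (const D k x) u) : u ∈ subH D k h := by
  have h0 : D.π ∣ (const D k (x - 1)).coeff 0 := by
    rw [coeff_const_zero]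
    exact dvd_sub_one_of_represents hu
  refine mem_subH_iff.mpr ⟨x - 1, h0, (hu.eq_iff (coe_unipMk _ h0).symm).mpr ?_⟩
  rw [const_sub]
  convert Ideal.zero_mem (truncIdeal D k h) using 1
  exact sub_eq_zero.mpr (add_sub_cancel (1 : TwistedOrder D k) (const D k x)).symm

lemma represents_layer (γ : O) :
    Represents (const D k (1 + D.π ^ (h - 2 + 1) * γ)) (layer D k h γ) := by
  rw [const_add]
  exact (coe_unipMk _ (dvd_layer γ)).symm

/-- The character `ω` of `S` takes the same values on the elements `x` and `φ^i(x)` of `C`. -/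
def FixedBy {F : Type*} [Field F] (C : Subgroup (unip D k h)) {S : Subgroup (unip D k h)}
    (ω : S →* Fˣ) (i : ℕ) : Prop :=
  ∀ (x : O) (u v : S), (u : unip D k h) ∈ C → (v : unip D k h) ∈ C →
    Represents (const D k x) (u : unip D k h) →
    Represents (const D k ((D.φ ^ i) x)) (v : unip D k h) → ω v = ω u

/-- A character that is trivial on all `φ^i(γ) - γ` in the last layer is fixed by `φ^i` on
all constants `x` for which `φ^i(x) / x` lies in the last layer and has this form. -/
lemma fixedBy_of_dvd {F : Type*} [Field F] {C S : Subgroup (unip D k h)}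
    (hS : lastLayer D k h ≤ S) {ω : S →* Fˣ} {i : ℕ}
    (hC : ∀ u ∈ C, ∀ x, Represents (const D k x) u →
      ∃ δ, D.π ^ h ∣ (D.φ ^ i) x - x * (1 + D.π ^ (h - 2 + 1) * ((D.φ ^ i) δ - δ)))
    (hω : ∀ (γ : O) (hm : layer D k h ((D.φ ^ i) γ - γ) ∈ S), ω ⟨_, hm⟩ = 1) :
    FixedBy C ω i := by
  intro x u v hu _ hux hvx
  obtain ⟨δ, hδ⟩ := hC u hu x hux
  have hm : layer D k h ((D.φ ^ i) δ - δ) ∈ S := hS (mem_lastLayer_iff.mpr ⟨_, rfl⟩)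
  have hv : v = u * ⟨_, hm⟩ := by
    refine Subtype.ext ((hvx.eq_iff (hux.mul (represents_layer _))).mpr ?_)
    rw [← const_mul, ← const_sub]
    exact const_mem_truncIdeal hδ
  rw [hv, map_mul, hω, mul_one]

lemma exists_layer_of_mem_lastLayer (hh : 2 ≤ h) (i : ℕ) {u : unip D k h}
    (hu : u ∈ lastLayer D k h) {x : O} (hx : Represents (const D k x) u) :
    ∃ δ, D.π ^ h ∣ (D.φ ^ i) x - x * (1 + D.π ^ (h - 2 + 1) * ((D.φ ^ i) δ - δ)) := by
  obtain ⟨γ, rfl⟩ := mem_lastLayer_iff.mp hu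
  have h1 := dvd_coeff_zero_of_mem ((hx.eq_iff (represents_layer γ)).mp rfl)
  rw [coeff_sub, coeff_const_zero, coeff_const_zero] at h1
  obtain ⟨y, hy⟩ := h1
  obtain rfl : x = 1 + D.π ^ (h - 2 + 1) * γ + D.π ^ h * y := by rw [← hy]; ring
  obtain ⟨m, rfl⟩ := Nat.exists_eq_add_of_le' hh
  refine ⟨γ, (D.φ ^ i) y - y * (1 + D.π ^ (m + 1) * ((D.φ ^ i) γ - γ)) -
    D.π ^ m * γ * ((D.φ ^ i) γ - γ), ?_⟩
  simp only [map_add, map_mul, map_pow, map_one, phi_pow_pi, Nat.add_sub_cancel]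
  ring

/-- For `k = 1`, the constants in the center are fixed by `φ` modulo `π^(h-1)`, as they commute
with `1 + τ`; by additive Hilbert 90 the quotient `φ(x) / x` comes from the last layer. -/
lemma exists_layer_of_mem_center [IsDomain O] [NeZero h] {q : ℕ} (hπ : Prime D.π)
    (hφ : ∀ x, D.π ∣ D.φ x - x ^ q) (hq : Nat.card (O ⧸ Ideal.span {D.π}) = q ^ n)
    [Finite (O ⧸ Ideal.span {D.π})] (hn : 1 < n) (hk : k = 1) (hh : 2 ≤ h) (i : ℕ)
    {u : unip D k h} (hu : u ∈ Subgroup.center (unip D k h)) {x : O}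
    (hx : Represents (const D k x) u) :
    ∃ δ, D.π ^ h ∣ (D.φ ^ i) x - x * (1 + D.π ^ (h - 2 + 1) * ((D.φ ^ i) δ - δ)) := by
  obtain ⟨m, rfl⟩ := Nat.exists_eq_add_of_le' hh
  simp only [Nat.add_sub_cancel]
  let one : Fin n := ⟨1, hn⟩
  have hone : one ≠ 0 := fun H => by simpa [one] using congrArg Fin.val H
  have ht0 : D.π ∣ (mono D k one 1).coeff 0 := by
    rw [coeff_mono_ne hone.symm]
    exact dvd_zero _
  have ht : Represents (1 + mono D k one 1) (unipMk (m + 2) (mono D k one 1) ht0) :=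
    (coe_unipMk _ ht0).symm
  have hcomm := ((ht.mul hx).eq_iff (hx.mul ht)).mp (Subgroup.mem_center_iff.mp hu _)
  obtain ⟨w, hw⟩ : D.π ^ (m + 1) ∣ D.φ x - x := by
    have h1 := dvd_coeff_of_mem hcomm hone
    rw [coeff_sub, coeff_mul_const, coeff_const_mul, coeff_add, coeff_one, if_neg hone,
      coeff_mono_self, zero_add, one_mul, mul_one, hk] at h1
    exact h1
  have hsum : ∀ i : ℕ, (D.φ ^ i) x - x =
      D.π ^ (m + 1) * ∑ j ∈ Finset.range i, (D.φ ^ j) w := by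
    intro i
    have h1 := Finset.sum_range_sub (fun j => (D.φ ^ j) x) i
    rw [pow_zero, RingAut.one_apply] at h1
    rw [← h1, Finset.mul_sum]
    refine Finset.sum_congr rfl fun j _ => ?_
    rw [pow_succ, RingAut.mul_apply, ← map_sub, hw, map_mul, map_pow, phi_pow_pi]
  have hw0 : ∑ j ∈ Finset.range n, (D.φ ^ j) w = 0 := by
    have h1 := hsum n
    rw [D.φ_pow, RingAut.one_apply, sub_self] at h1
    exact (mul_eq_zero.mp h1.symm).resolve_left (pow_ne_zero _ hπ.ne_zero)
  obtain ⟨δ, z, hz⟩ := exists_phi_sub_dvd hπ hφ hq hw0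
  obtain ⟨y, hy⟩ := dvd_sub_one_of_represents hx
  have hw' : w = D.φ δ - δ + D.π * z := by rw [← hz]; ring
  have hsumw : ∑ j ∈ Finset.range i, (D.φ ^ j) w =
      (D.φ ^ i) δ - δ + D.π * ∑ j ∈ Finset.range i, (D.φ ^ j) z := by
    have h1 : ∀ j, (D.φ ^ j) w = ((D.φ ^ (j + 1)) δ - (D.φ ^ j) δ) + D.π * (D.φ ^ j) z := by
      intro j
      rw [hw', map_add, map_sub, map_mul, phi_pow_pi, pow_succ, RingAut.mul_apply]
    rw [Finset.sum_congr rfl fun j _ => h1 j, Finset.sum_add_distrib, ← Finset.mul_sum,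
      Finset.sum_range_sub (fun j => (D.φ ^ j) δ), pow_zero, RingAut.one_apply]
  have h1 := hsum i
  rw [hsumw] at h1
  refine ⟨δ, ∑ j ∈ Finset.range i, (D.φ ^ j) z - y * ((D.φ ^ i) δ - δ), ?_⟩
  rw [show (D.φ ^ i) x = x + ((D.φ ^ i) x - x) by ring, h1,
    show x = 1 + D.π * y by rw [← hy]; ring]
  ring

/-- Characters with trivial stabilizer are regular on the last layer. -/
lemma layerRegular_of_not_fixedBy [IsDomain O] [NeZero h] {q : ℕ} (hπ : Prime D.π)
    (hφ : ∀ x, D.π ∣ D.φ x - x ^ q) (hq : Nat.card (O ⧸ Ideal.span {D.π}) = q ^ n)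
    [Finite (O ⧸ Ideal.span {D.π})] {F : Type*} [Field F] {C S : Subgroup (unip D k h)}
    (hC : C = lastLayer D k h ∨ C = Subgroup.center (unip D k h) ∧ (k = 1 ∨ h ≤ k))
    (hS : lastLayer D k h ≤ S) {ω : S →* Fˣ}
    (hω : ∀ i, 0 < i → i < n → ¬ FixedBy C ω i) (hkh : k < h) : LayerRegular ω := by
  have hh : 2 ≤ h := by
    have := Nat.pos_of_ne_zero (NeZero.ne k)
    omega
  intro i hi
  have hi0 : 0 < (i : ℕ) := Nat.pos_of_ne_zero fun h => hi (Fin.ext h)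
  by_contra! H
  refine hω i hi0 i.2 (fixedBy_of_dvd hS ?_ H)
  rintro u hu x hx
  rcases hC with rfl | ⟨rfl, hk⟩
  · exact exists_layer_of_mem_lastLayer hh i hu hx
  · exact exists_layer_of_mem_center hπ hφ hq (by omega) (by omega) hh i hu hx

end Stabilizer

end TwistedOrder

section LocalField

variable {K : Type*} [Field K] [ValuativeRel K] [TopologicalSpace K]
  [IsNonarchimedeanLocalField K] {L : Type*} [Field L] [Algebra K L] [FiniteDimensional K L]

open TwistedOrder

lemma galAct_pow (σ : Gal(L/K)) (m : ℕ) : galAct (σ ^ m) = galAct σ ^ m := by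
  induction m with
  | zero => ext x; simp [galAct]
  | succ m ih => rw [pow_succ, pow_succ, ← ih]; ext x; simp [galAct]

lemma galAct_one : galAct (1 : Gal(L/K)) = 1 := by
  have := galAct_pow (1 : Gal(L/K)) 0
  rwa [pow_zero, pow_zero] at this

lemma natCard_quotient_map_maximalIdeal (R S : Type*) [CommRing R] [IsLocalRing R] [CommRing S]
    [Algebra R S] [Module.Finite R S] [Module.Free R S] :
    Nat.card (S ⧸ (IsLocalRing.maximalIdeal R).map (algebraMap R S)) =
      Nat.card (IsLocalRing.ResidueField R) ^ Module.finrank R S := by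
  let : Field (R ⧸ IsLocalRing.maximalIdeal R) := Ideal.Quotient.field _
  have : Module.Finite (R ⧸ IsLocalRing.maximalIdeal R)
      (S ⧸ (IsLocalRing.maximalIdeal R).map (algebraMap R S)) :=
    Module.Finite.of_restrictScalars_finite R _ _
  rw [← IsLocalRing.finrank_quotient_map (R := R) (S := S)]
  exact Module.natCard_eq_pow_finrank (K := R ⧸ IsLocalRing.maximalIdeal R)

/-- The residue field of the unramified extension `L` has `q^n` elements. -/
lemma natCard_quotient_pi [IsGalois K L] {π : 𝒪[K]} (hπ : Irreducible π) :
    Nat.card (ringOfInt K L ⧸ Ideal.span {algebraMap 𝒪[K] (ringOfInt K L) π}) =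
      Nat.card 𝓀[K] ^ Module.finrank K L := by
  have hfin : Module.Finite 𝒪[K] (ringOfInt K L) := IsIntegralClosure.finite 𝒪[K] K L _
  have hfree : Module.Free 𝒪[K] (ringOfInt K L) := IsIntegralClosure.module_free 𝒪[K] K L _
  have hrank : Module.finrank 𝒪[K] (ringOfInt K L) = Module.finrank K L :=
    IsIntegralClosure.rank 𝒪[K] K L _
  rw [← hrank, ← natCard_quotient_map_maximalIdeal, hπ.maximalIdeal_eq, Ideal.map_span,
    Set.image_singleton]

variable [IsGalois K L] {n h k : ℕ} [NeZero n] [NeZero h] [NeZero k]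
  {hn : Module.finrank K L = n} {π : 𝒪[K]} {φ : Gal(L/K)} {F : Type*} [Field F]

/-- As `φ^i` acts nontrivially on the residue field, it is not the identity of `L`. -/
lemma not_fixedBy_of_hasTrivialStabilizer {C S : Subgroup (unip (localData hn φ π) k h)}
    {ω : S →* Fˣ} (hω : HasTrivialStabilizer C S ω) {i : ℕ}
    (hi : ∃ x, ¬ (localData hn φ π).π ∣ ((localData hn φ π).φ ^ i) x - x) :
    ¬ FixedBy C ω i := by
  intro H
  have hpow : galAct (φ ^ i) = (localData hn φ π).φ ^ i := galAct_pow φ i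
  have h1 : φ ^ i = 1 := hω _ fun x u v hu hv hux hvx =>
    H x u v hu hv hux (by rwa [← hpow])
  obtain ⟨x, hx⟩ := hi
  refine hx ?_
  rw [← hpow, h1, galAct_one, RingAut.one_apply, sub_self]
  exact dvd_zero _

/-- The stabilizer only depends on the values at the classes of constants in `C`. -/
lemma HasTrivialStabilizer.transfer {C S S' : Subgroup (unip (localData hn φ π) k h)}
    {ω : S →* Fˣ} {ω' : S' →* Fˣ} (hω : HasTrivialStabilizer C S ω)
    (hS : ∀ u ∈ C, ∀ x, Represents (const (localData hn φ π) k x) u → u ∈ S')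
    (heq : ∀ (u : unip (localData hn φ π) k h) (hu : u ∈ S) (hu' : u ∈ S'), u ∈ C →
      ω ⟨u, hu⟩ = ω' ⟨u, hu'⟩) : HasTrivialStabilizer C S' ω' := by
  intro σ hσ
  refine hω σ fun x u v hu hv hux hvx => ?_
  have hu' := hS _ hu _ hux
  have hv' := hS _ hv _ hvx
  rw [heq u.1 u.2 hu' hu, heq v.1 v.2 hv' hv]
  exact hσ x ⟨_, hu'⟩ ⟨_, hv'⟩ hu hv hux hvx

end LocalField

open TwistedOrder in
theorem theoremt
    {K : Type*} [Field K] [ValuativeRel K] [TopologicalSpace K] [IsNonarchimedeanLocalField K]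
    {L : Type*} [Field L] [Algebra K L] [FiniteDimensional K L] [IsGalois K L]
    (n h k : ℕ) [NeZero n] [NeZero h] [NeZero k] (hn : Module.finrank K L = n)
    (π : 𝒪[K]) (hπ : Irreducible π)
    -- `L / K` is unramified: `π` is still a uniformizer of `L`
    (hunr : Prime (algebraMap 𝒪[K] (ringOfInt K L) π))
    -- `φ` is the Frobenius
    (φ : Gal(L/K))
    (hφ : ∀ x : ringOfInt K L, algebraMap 𝒪[K] (ringOfInt K L) π ∣
      galAct φ x - x ^ Nat.card 𝓀[K])
    {F : Type*} [Field F] [IsAlgClosed F] [CharZero F]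
    (C : Subgroup (unip (localData hn φ π) k h))
    (hC : C = lastLayer (localData hn φ π) k h ∨
      C = Subgroup.center (unip (localData hn φ π) k h) ∧ (k = 1 ∨ h ≤ k)) :
    (∀ χ : subH (localData hn φ π) k h →* Fˣ,
      HasTrivialStabilizer C (subH (localData hn φ π) k h) χ →
      (∃ χt : subHPlus (localData hn φ π) k h →* Fˣ, ExtendsSharp χ χt) ∧
      ∀ χt : subHPlus (localData hn φ π) k h →* Fˣ, ExtendsSharp χ χt →
        (Representation.ind (subHPlus (localData hn φ π) k h).subtype (charRep χt)).IsIrreducible ∧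
        Module.finrank F
          (Representation.IndV (subHPlus (localData hn φ π) k h).subtype (charRep χt)) =
          Nat.card 𝓀[K] ^ (n * (n - 1) * (h - k) / 2) ∧
        ∃ ω : Subgroup.center (unip (localData hn φ π) k h) →* Fˣ,
          IsCentralCharacter
            (Representation.ind (subHPlus (localData hn φ π) k h).subtype (charRep χt)) ω ∧
          HasTrivialStabilizer C (Subgroup.center (unip (localData hn φ π) k h)) ω) ∧
    (∀ (V : Type*) [AddCommGroup V] [Module F V]
      (ρ : Representation F (unip (localData hn φ π) k h) V), ρ.IsIrreducible →
      ∀ ω : Subgroup.center (unip (localData hn φ π) k h) →* Fˣ, IsCentralCharacter ρ ω →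
      HasTrivialStabilizer C (Subgroup.center (unip (localData hn φ π) k h)) ω →
      ∃ χ : subH (localData hn φ π) k h →* Fˣ,
        HasTrivialStabilizer C (subH (localData hn φ π) k h) χ ∧
        ∀ χt : subHPlus (localData hn φ π) k h →* Fˣ, ExtendsSharp χ χt →
          Nonempty (ρ.Equiv
            (Representation.ind (subHPlus (localData hn φ π) k h).subtype (charRep χt)))) := by
  let D := localData hn φ π
  have hprime : Prime D.π := hunr
  have hcard : Nat.card (ringOfInt K L ⧸ Ideal.span {D.π}) = Nat.card 𝓀[K] ^ n :=
    (natCard_quotient_pi hπ).trans (congrArg _ hn)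
  have hfinq : Finite (ringOfInt K L ⧸ Ideal.span {D.π}) := by
    refine Nat.finite_of_card_ne_zero ?_
    rw [hcard]
    exact pow_ne_zero _ Nat.card_pos.ne'
  have hfin : Finite (unip D k h) := finite_unip (index_truncAdd_ne_zero hprime.ne_zero)
  have hφ' : ∀ i, 0 < i → i < n → ∃ x, ¬ D.π ∣ (D.φ ^ i) x - x :=
    exists_not_dvd_phi_pow_sub hprime hφ hcard
  have hreg : ∀ {S : Subgroup (unip D k h)} {ω : S →* Fˣ}, lastLayer D k h ≤ S →
      HasTrivialStabilizer C S ω → k < h → LayerRegular ω := fun hS hω =>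
    layerRegular_of_not_fixedBy hprime hφ hcard hC hS fun i hi hin =>
      not_fixedBy_of_hasTrivialStabilizer hω (hφ' i hi hin)
  have hCz : C ≤ Subgroup.center (unip D k h) := by
    rcases hC with rfl | ⟨rfl, -⟩
    · exact lastLayer_le_center
    · exact le_rfl
  refine ⟨fun χ hχ => ?_, ?_⟩
  · have hχ' := hreg lastLayer_le_subH hχ
    refine ⟨exists_extendsSharp χ, fun χt hext => ⟨ind_isIrreducible hprime hχ' hext, ?_, ?_⟩⟩
    · rw [finrank_ind]
      exact index_subHPlus hprime hφ' hcard
    · have hz := center_le_subHPlus hprime hχ' hext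
      refine ⟨_, isCentralCharacter_ind hz, hχ.transfer (fun u hu _ _ => hCz hu) ?_⟩
      intro u hu hu' _
      obtain ⟨x, hx, rfl⟩ := mem_subH_iff.mp hu
      have hrep : Represents (1 + const D k x) (unipMk h (const D k x) hx) :=
        (coe_unipMk _ hx).symm
      rw [show (1 : TwistedOrder D k) = const D k 1 from rfl, ← const_add] at hrep
      refine (hext ⟨_, hz hu'⟩ ⟨_, hu⟩ _ (subH_le_subHPrime hu) hrep ?_).symm
      rwa [coeff_const_zero]
  · intro V _ _ ρ hirr ω hρ hω
    have := hirr.finiteDimensional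
    obtain ⟨χ, heq, -, hequiv⟩ := exists_equiv_ind ρ hprime hirr hρ (hreg lastLayer_le_center hω)
    exact ⟨χ, hω.transfer (fun u _ x hx => mem_subH_of_represents hx)
      fun u hz hu _ => (heq u hz hu).symm, hequiv⟩
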